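/- Let $K$ be a local field, i.e. a topological field isomorphic to $\mathbb R$ or $\mathbb C$, or a nonarchimedean local field. Let $dy$ be an additive Haar measure on $K$, let $|y|$ be the normalized absolute value on $K$ (so $d(ay)=|a|\,dy$ for $a\ne 0$, and $|0|=0$), and let $\lambda$ be a nontrivial continuous unitary character of $(K,+)$. Consider the following operators on $L^2(K,dy)$. * $A$ is multiplication by $\log|y|$, with domain $\{f\in L^2 : \log|y|\,f\in L^2\}$. * $\mathcal F$ is the Fourier transform on $L^2(K,dy)$, the closure of $\varphi\mapsto\int_K\varphi(y)\lambda(-xy)\,dy$ on $L^1\cap L^2$, and $B=\mathcal F^{-1}A\,\mathcal F$ is the Fourier conjugate of $A$, with its natural domain. Thus $B$ acts on the Fourier transform as multiplication by $\log|x|$. * $\mathbf K=i\,[B,A]=i(BA-AB)$ is the commutator operator, with its natural domain, i.e. all $f$ in the domains of $A$ and $B$ such that $Af$ is in the domain of $B$ and $Bf$ is in the domain of $A$. * $I$ is the Inversion, $(If)(y)=|y|^{-1}f(1/y)$. In terms of the function $|u|^{1/2}f(u)$ in $L^2(K^\times,du/|u|)$, it is the substitution $u\mapsto 1/u$. **Theorem.**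 The commutator operator anticommutes with the Inversion. Precisely: 1. the set of all $f$ such that both $f$ and $If$ are in the domain of $\mathbf K$ is dense in $L^2(K,dy)$, and $\mathbf K(If)=-I(\mathbf Kf)$ for every such $f$; 2. $\mathbf K$ is closable, and its closure $\overline{\mathbf K}$ anticommutes with $I$: if $f$ is in the domain of $\overline{\mathbf K}$, then so is $If$, and $\overline{\mathbf K}(If)=-I(\overline{\mathbf K}f)$. -/

import Mathlib

open MeasureTheory Filter
open scoped NNReal ENNReal Topology

/-- A local field: a topological field which is isomorphic, as a topological field, to `ℝ` or to
`ℂ`, or which is a nonarchimedean local field (the topology is given by a nontrivial valuation, and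
is locally compact). -/
class IsLocalField (K : Type*) [Field K] [TopologicalSpace K] : Prop where
  real_or_complex_or_nonarchimedean :
    (∃ e : K ≃+* ℝ, IsHomeomorph e) ∨ (∃ e : K ≃+* ℂ, IsHomeomorph e) ∨
      ∃ _ : ValuativeRel K, IsNonarchimedeanLocalField K

namespace IsLocalField

theorem isTopologicalRing_of_ringEquiv {K R : Type*} [Field K] [TopologicalSpace K] [Ring R]
    [TopologicalSpace R] [IsTopologicalRing R] (e : K ≃+* R) (he : IsHomeomorph e) :
    IsTopologicalRing K where
  continuous_add := by
    rw [he.isInducing.continuous_iff]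
    have h : (⇑e ∘ fun p : K × K => p.1 + p.2) = fun p => e p.1 + e p.2 := by
      funext p; simp
    rw [h]
    exact (he.continuous.comp continuous_fst).add (he.continuous.comp continuous_snd)
  continuous_mul := by
    rw [he.isInducing.continuous_iff]
    have h : (⇑e ∘ fun p : K × K => p.1 * p.2) = fun p => e p.1 * e p.2 := by
      funext p; simp
    rw [h]
    exact (he.continuous.comp continuous_fst).mul (he.continuous.comp continuous_snd)
  continuous_neg := by
    rw [he.isInducing.continuous_iff]
    have h : (⇑e ∘ fun x : K => -x) = fun x => -e x := by
      funext p; simp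
    rw [h]
    exact he.continuous.neg

instance (K : Type*) [Field K] [TopologicalSpace K] [h : IsLocalField K] : IsTopologicalRing K := by
  obtain ⟨e, he⟩ | ⟨e, he⟩ | ⟨_, _⟩ := h.real_or_complex_or_nonarchimedean
  · exact isTopologicalRing_of_ringEquiv e he
  · exact isTopologicalRing_of_ringEquiv e he
  · infer_instance

instance (K : Type*) [Field K] [TopologicalSpace K] [h : IsLocalField K] :
    LocallyCompactSpace K := by
  obtain ⟨e, he⟩ | ⟨e, he⟩ | ⟨_, _⟩ := h.real_or_complex_or_nonarchimedean
  · exact he.isClosedEmbedding.locallyCompactSpace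
  · exact he.isClosedEmbedding.locallyCompactSpace
  · infer_instance

end IsLocalField

noncomputable section LocalOperators

/-- The composition `g ∘ f` of two partially defined operators on its natural domain, the set of
all `x` in the domain of `f` such that `f x` lies in the domain of `g`. -/
def LinearPMap.naturalComp {H : Type*} [AddCommGroup H] [Module ℂ H] (g f : H →ₗ.[ℂ] H) :
    H →ₗ.[ℂ] H :=
  g.comp (f.domRestrict ((g.domain.comap f.toFun).map f.domain.subtype)) (by
    rintro ⟨x, hx⟩
    obtain ⟨⟨z, hz, hzx⟩, hxf⟩ := hx
    have h : f.domRestrict ((g.domain.comap f.toFun).map f.domain.subtype)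
        ⟨x, ⟨⟨z, hz, hzx⟩, hxf⟩⟩ = f z := LinearPMap.domRestrict_apply hzx.symm
    rw [h]
    exact hz)

variable {K : Type*} [Field K] [TopologicalSpace K] [IsTopologicalRing K] [LocallyCompactSpace K]
  [MeasurableSpace K] [BorelSpace K]

/-- The normalized absolute value `|y|`: the factor by which multiplication by `y` scales the
additive Haar measure (so `|y|` is the square of the usual modulus if the field is `ℂ`). -/
def normAbs (y : K) : ℝ :=
  open scoped Classical in if h : y = 0 then 0 else (distribHaarChar K (Units.mk0 y h) : ℝ)

/-- The operator `A` on `L²(K, dy)` of multiplication by `log |y|`, on its maximal domain. -/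
def opA (μ : Measure K) : Lp ℂ 2 μ →ₗ.[ℂ] Lp ℂ 2 μ where
  domain :=
    { carrier := {f | MemLp (fun y => (Real.log (normAbs y) : ℂ) * f y) 2 μ}
      zero_mem' := by
        refine (memLp_congr_ae ?_).2 (MemLp.zero (ε := ℂ))
        filter_upwards [Lp.coeFn_zero ℂ 2 μ] with y hy
        change (Real.log (normAbs y) : ℂ) * (0 : Lp ℂ 2 μ) y = 0
        rw [hy, Pi.zero_apply, mul_zero]
      add_mem' := by
        intro f g hf hg
        refine (memLp_congr_ae ?_).2 (MemLp.add hf hg)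
        filter_upwards [Lp.coeFn_add f g] with y hy
        change (Real.log (normAbs y) : ℂ) * (f + g : Lp ℂ 2 μ) y = (Real.log (normAbs y) : ℂ) * f y + (Real.log (normAbs y) : ℂ) * g y
        rw [hy, Pi.add_apply, mul_add]
      smul_mem' := by
        intro c f hf
        refine (memLp_congr_ae ?_).2 (MemLp.const_smul hf c)
        filter_upwards [Lp.coeFn_smul c f] with y hy
        change (Real.log (normAbs y) : ℂ) * (c • f : Lp ℂ 2 μ) y = c * ((Real.log (normAbs y) : ℂ) * f y)
        rw [hy, Pi.smul_apply, smul_eq_mul, mul_left_comm] }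
  toFun :=
    { toFun := fun f => MemLp.toLp _ f.2
      map_add' := by
        rintro ⟨f, hf⟩ ⟨g, hg⟩
        rw [← MemLp.toLp_add, MemLp.toLp_eq_toLp_iff]
        filter_upwards [Lp.coeFn_add f g] with y hy
        change (Real.log (normAbs y) : ℂ) * (f + g : Lp ℂ 2 μ) y = (Real.log (normAbs y) : ℂ) * f y + (Real.log (normAbs y) : ℂ) * g y
        rw [hy, Pi.add_apply, mul_add]
      map_smul' := by
        rintro c ⟨f, hf⟩
        rw [RingHom.id_apply, ← MemLp.toLp_const_smul, MemLp.toLp_eq_toLp_iff]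
        filter_upwards [Lp.coeFn_smul c f] with y hy
        change (Real.log (normAbs y) : ℂ) * (c • f : Lp ℂ 2 μ) y = c * ((Real.log (normAbs y) : ℂ) * f y)
        rw [hy, Pi.smul_apply, smul_eq_mul, mul_left_comm] }

theorem fourierIntegral_coe_zero {ψ : AddChar K Circle} {μ : Measure K} :
    Fourier.fourierIntegral ψ μ (0 : Lp ℂ 2 μ) = 0 := by
  unfold Fourier.fourierIntegral
  ext x
  rw [VectorFourier.fourierIntegral_congr_ae _ _ _ (Lp.coeFn_zero ℂ 2 μ)]
  simp [VectorFourier.fourierIntegral]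

theorem fourierIntegral_coe_add {ψ : AddChar K Circle} (hψ : Continuous ψ) {μ : Measure K}
    {f g : Lp ℂ 2 μ} (hf : Integrable f μ) (hg : Integrable g μ) :
    Fourier.fourierIntegral ψ μ (f + g : Lp ℂ 2 μ) =
      Fourier.fourierIntegral ψ μ f + Fourier.fourierIntegral ψ μ g := by
  have hL : Continuous fun p : K × K => LinearMap.mul K K p.1 p.2 := by
    simpa using continuous_mul
  have h := VectorFourier.fourierIntegral_add (L := LinearMap.mul K K) hψ hL hf hg
  rw [← VectorFourier.fourierIntegral_congr_ae _ _ _ (Lp.coeFn_add f g)] at h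
  exact h

theorem fourierIntegral_coe_smul {ψ : AddChar K Circle} {μ : Measure K} (c : ℂ)
    (f : Lp ℂ 2 μ) :
    Fourier.fourierIntegral ψ μ (c • f : Lp ℂ 2 μ) = c • Fourier.fourierIntegral ψ μ f := by
  have h := VectorFourier.fourierIntegral_const_smul ψ μ (LinearMap.mul K K) f c
  rw [← VectorFourier.fourierIntegral_congr_ae _ _ _ (Lp.coeFn_smul c f)] at h
  exact h

/-- The Fourier integral `x ↦ ∫ φ(y) ψ(-yx) dy`, as an operator on `L²(K, dy)` whose domain consists
of all `φ` in `L¹ ∩ L²` with Fourier integral in `L²`. -/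
def fourierL1L2 (ψ : AddChar K Circle) (hψ : Continuous ψ) (μ : Measure K) :
    Lp ℂ 2 μ →ₗ.[ℂ] Lp ℂ 2 μ where
  domain :=
    { carrier := {f | Integrable f μ ∧ MemLp (Fourier.fourierIntegral ψ μ f) 2 μ}
      zero_mem' := by
        refine ⟨(integrable_congr (Lp.coeFn_zero ℂ 2 μ)).2 (integrable_zero K ℂ μ), ?_⟩
        rw [fourierIntegral_coe_zero]
        exact MemLp.zero
      add_mem' := by
        rintro f g ⟨hf, hf'⟩ ⟨hg, hg'⟩
        refine ⟨(integrable_congr (Lp.coeFn_add f g)).2 (hf.add hg), ?_⟩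
        rw [fourierIntegral_coe_add hψ hf hg]
        exact hf'.add hg'
      smul_mem' := by
        rintro c f ⟨hf, hf'⟩
        refine ⟨(integrable_congr (Lp.coeFn_smul c f)).2 (hf.smul c), ?_⟩
        rw [fourierIntegral_coe_smul]
        exact hf'.const_smul c }
  toFun :=
    { toFun := fun f => MemLp.toLp _ f.2.2
      map_add' := by
        rintro ⟨f, hf⟩ ⟨g, hg⟩
        rw [← MemLp.toLp_add]
        exact MemLp.toLp_congr _ _ (Eventually.of_forall
          (congrFun (fourierIntegral_coe_add hψ hf.1 hg.1)))
      map_smul' := by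
        rintro c ⟨f, hf⟩
        rw [RingHom.id_apply, ← MemLp.toLp_const_smul]
        exact MemLp.toLp_congr _ _ (Eventually.of_forall
          (congrFun (fourierIntegral_coe_smul c f))) }

/-- The Fourier transform `F` on `L²(K, dy)`: the closure of the Fourier integral on `L¹ ∩ L²`. -/
def opF (ψ : AddChar K Circle) (hψ : Continuous ψ) (μ : Measure K) :
    Lp ℂ 2 μ →ₗ.[ℂ] Lp ℂ 2 μ :=
  (fourierL1L2 ψ hψ μ).closure

/-- The Fourier conjugate `B = F⁻¹ A F` of `A`, on its natural domain. It acts on the Fourier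
transform as multiplication by `log |x|`. -/
def opB (ψ : AddChar K Circle) (hψ : Continuous ψ) (μ : Measure K) :
    Lp ℂ 2 μ →ₗ.[ℂ] Lp ℂ 2 μ :=
  (opF ψ hψ μ).inverse.naturalComp ((opA μ).naturalComp (opF ψ hψ μ))

/-- The commutator operator `i [B, A] = i (B A - A B)`, on its natural domain. -/
def commutatorOp (ψ : AddChar K Circle) (hψ : Continuous ψ) (μ : Measure K) :
    Lp ℂ 2 μ →ₗ.[ℂ] Lp ℂ 2 μ :=
  Complex.I • ((opB ψ hψ μ).naturalComp (opA μ) - (opA μ).naturalComp (opB ψ hψ μ))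

/-- The Inversion on `L²(K, dy)`, sending `f` to `y ↦ |y|⁻¹ f(1/y)`. In terms of the functions
`|u|^{1/2} f(u)` in `L²(Kˣ, d*u)` it is the substitution `u ↦ 1/u`. As `dy / |y|` is invariant under
`y ↦ 1/y`, the function `y ↦ |y|⁻¹ f(1/y)` is always in `L²(K, dy)`, so that the second alternative
never occurs. -/
def inversion (μ : Measure K) (f : Lp ℂ 2 μ) : Lp ℂ 2 μ :=
  open scoped Classical in
  if h : MemLp (fun y => ((normAbs y)⁻¹ : ℂ) * f y⁻¹) 2 μ then h.toLp else 0

end LocalOperators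

set_option linter.unusedSectionVars false

/-! ### Topology of a local field: separation, a topologically nilpotent element, second
countability -/

namespace IsLocalField

/-! Let `D_t` be the unitary dilation `f ↦ |t|^{1/2} f(t·)`. Conjugation by `D_t` shifts `A` by the
scalar `-log|t|` and, because the Fourier transform turns `D_t` into `D_{1/t}`, shifts `B` by
`+log|t|`. Scalars drop out of a commutator, so `𝐊` commutes with every dilation. The Fourier
transform `F` exchanges `A` and `B` up to the reflection `D_{-1}`, so `F` anticommutes with `𝐊`.

Both `F` and the Inversion `I` replace `D_t` by `D_{1/t}`. Hence `FI` commutes with all dilations;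
morally it is a multiplicative convolution operator, an average of the `D_t`, and so commutes with
`𝐊`. Therefore `I = F⁻¹(FI)` anticommutes with `𝐊`.

To make this rigorous, put `C_k = ∫ k(t) D_t dt/|t|`. If `φ` and its Fourier integral `φ̂` are
integrable, `k = |t|^{1/2} φ` and `r = |t|^{1/2} φ̂`, then `C_k F = I C_r`, because both are the
integral operator with kernel `φ̂(xy)` (`IsFourierOperator.mulConv_map`; an operator form of the
local functional equation). Thus `C_k F I = I C_r I` is convolution with `t ↦ r(1/t)`, a genuine
average of dilations, which preserves every closed dilation-stable subspace, in particular the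
closed graph of `𝐊`. Letting `k` run through an approximate identity at `1` shows that `FI`
preserves this graph (`inversion_mem_closure_graph`).

There remain density and closability. `𝐊` is symmetric, so closability follows from density of its
domain. Vectors in the domain are obtained by applying `C_k* C_k* C_k C_k`, with `k*(t) = k(1/t)`,
to the dense domain of `A²` (`smoothing_mem_domain`); this operator commutes with `I`, so the images
under `I` are in the domain as well.

The measure need not be self-dual for `ψ`: Plancherel holds with a constant `c`, and `F/√c` is
unitary. -/

theorem t2Space_and_isTopologicalDivisionRing_and_exists_pow_tendsto (K : Type*) [Field K]
    [TopologicalSpace K] [h : IsLocalField K] :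
    T2Space K ∧ IsTopologicalDivisionRing K ∧
      ∃ a : K, a ≠ 0 ∧ Tendsto (fun n : ℕ => a ^ n) atTop (𝓝 0) := by
  have key : ∀ {R : Type} [Field R] [TopologicalSpace R] [T2Space R] [IsTopologicalDivisionRing R]
      (e : K ≃+* R) (_ : IsHomeomorph e) (a : R) (_ : a ≠ 0)
      (_ : Tendsto (fun n : ℕ => a ^ n) atTop (𝓝 0)), T2Space K ∧ IsTopologicalDivisionRing K ∧
      ∃ a : K, a ≠ 0 ∧ Tendsto (fun n : ℕ => a ^ n) atTop (𝓝 0) := by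
    intro R _ _ _ _ e he a ha hlim
    have hcr := isTopologicalRing_of_ringEquiv e he
    refine ⟨he.isEmbedding.t2Space, { continuousAt_inv₀ := fun {x} hx => ?_ }, e.symm a,
      by simpa using ha, ?_⟩
    · change Tendsto _ _ _
      rw [he.isInducing.tendsto_nhds_iff]
      have : (⇑e ∘ fun x : K => x⁻¹) = fun x => (e x)⁻¹ := by
        funext x; simp
      rw [this, map_inv₀]
      exact he.continuous.continuousAt.inv₀ (by simpa using hx)
    · rw [he.isInducing.tendsto_nhds_iff]
      simpa [Function.comp_def] using hlim
  obtain ⟨e, he⟩ | ⟨e, he⟩ | ⟨_, _⟩ := h.real_or_complex_or_nonarchimedean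
  · exact key e he (1 / 2) (by norm_num)
      (tendsto_pow_atTop_nhds_zero_of_lt_one (by norm_num) (by norm_num))
  · exact key e he (1 / 2) (by norm_num)
      (tendsto_pow_atTop_nhds_zero_of_norm_lt_one (by norm_num))
  · have : T2Space K := by
      let := IsTopologicalAddGroup.rightUniformSpace K
      have := isUniformAddGroup_of_addCommGroup (G := K)
      infer_instance
    refine ⟨this, inferInstance, ?_⟩
    obtain ⟨a, ha, ha1⟩ := Valuation.IsNontrivial.exists_lt_one (v := ValuativeRel.valuation K)
    have ha0 : a ≠ 0 := by simpa using ha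
    refine ⟨a, ha0, ?_⟩
    rw [(IsValuativeTopology.hasBasis_nhds_zero' K).tendsto_right_iff]
    intro γ hγ
    -- The valuation has rank at most one, so its value group is archimedean and the powers of an
    -- element of value below `1` pass below every nonzero `γ`.
    have : MulArchimedean (ValuativeRel.ValueGroupWithZero K) :=
      ValuativeRel.isRankLeOne_iff_mulArchimedean.mp inferInstance
    obtain ⟨n, hn⟩ := exists_pow_lt₀ ha1 (Units.mk0 γ hγ)
    filter_upwards [eventually_ge_atTop n] with m hm
    simp only [map_pow]
    exact (pow_le_pow_right_of_le_one' ha1.le hm).trans_lt hn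

variable (K : Type*) [Field K] [TopologicalSpace K] [IsLocalField K]

instance : T2Space K := (t2Space_and_isTopologicalDivisionRing_and_exists_pow_tendsto K).1

instance : IsTopologicalDivisionRing K :=
  (t2Space_and_isTopologicalDivisionRing_and_exists_pow_tendsto K).2.1

theorem exists_pow_tendsto_zero :
    ∃ a : K, a ≠ 0 ∧ Tendsto (fun n : ℕ => a ^ n) atTop (𝓝 0) :=
  (t2Space_and_isTopologicalDivisionRing_and_exists_pow_tendsto K).2.2

variable {K}

/-- The dilates of a compact set by the powers of a topologically nilpotent element shrink to
zero. -/
theorem eventually_pow_mul_mem {a : K} (ha : Tendsto (fun n : ℕ => a ^ n) atTop (𝓝 0))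
    {C : Set K} (hC : IsCompact C) {U : Set K} (hU : U ∈ 𝓝 0) :
    ∀ᶠ n : ℕ in atTop, ∀ x ∈ C, a ^ n * x ∈ U := by
  have h : ∀ᶠ b : K in 𝓝 0, ∀ x ∈ C, b * x ∈ U := by
    apply hC.eventually_forall_of_forall_eventually
    intro x _
    have : Tendsto (fun p : K × K => p.1 * p.2) (𝓝 (0, x)) (𝓝 (0 * x)) :=
      continuous_mul.tendsto _
    rw [zero_mul] at this
    exact this hU
  exact ha.eventually h

/-- For `a` topologically nilpotent and `C` a compact neighbourhood of `0`, the sets `aⁿC` form a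
countable basis at `0`, so `K` is pseudometrizable, and the sets `a⁻ⁿC` cover `K`, so it is
σ-compact. -/
instance : SecondCountableTopology K := by
  obtain ⟨a, ha0, ha⟩ := exists_pow_tendsto_zero K
  obtain ⟨C, hC, hC0⟩ := exists_compact_mem_nhds (0 : K)
  have hmem : ∀ n : ℕ, (fun x => a ^ n * x) '' C ∈ 𝓝 (0 : K) := by
    intro n
    have := (Homeomorph.mulLeft₀ (a ^ n) (pow_ne_zero n ha0)).isOpenMap.image_mem_nhds hC0
    simpa using this
  have hb : (𝓝 (0 : K)).HasBasis (fun _ : ℕ => True) fun n => (fun x => a ^ n * x) '' C := by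
    refine ⟨fun U => ⟨fun hU => ?_, ?_⟩⟩
    · obtain ⟨n, hn⟩ := (eventually_pow_mul_mem ha hC hU).exists
      exact ⟨n, trivial, by rintro _ ⟨x, hx, rfl⟩; exact hn x hx⟩
    · rintro ⟨n, -, hn⟩
      exact mem_of_superset (hmem n) hn
  have hcg : (𝓝 (0 : K)).IsCountablyGenerated := hb.isCountablyGenerated
  let _ := IsTopologicalAddGroup.rightUniformSpace K
  have := isUniformAddGroup_of_addCommGroup (G := K)
  have : (uniformity K).IsCountablyGenerated := IsUniformAddGroup.uniformity_countably_generated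
  have : SigmaCompactSpace K := by
    refine ⟨fun n => (fun x => (a ^ n)⁻¹ * x) '' C, fun n => hC.image (by fun_prop), ?_⟩
    rw [Set.eq_univ_iff_forall]
    intro x
    obtain ⟨n, hn⟩ := (eventually_pow_mul_mem ha (isCompact_singleton (x := x)) hC0).exists
    exact Set.mem_iUnion.2 ⟨n, a ^ n * x, hn x rfl, by field_simp⟩
  let _ := UniformSpace.pseudoMetricSpace K
  infer_instance

end IsLocalField

/-! ### The normalized absolute value and the scaling of Haar measure -/

section NormAbs

variable {K : Type*} [Field K] [TopologicalSpace K] [IsLocalField K]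

theorem normAbs_of_ne_zero {y : K} (hy : y ≠ 0) :
    normAbs y = (distribHaarChar K (Units.mk0 y hy) : ℝ) := by
  rw [normAbs, dif_neg hy]

@[simp] theorem normAbs_zero : normAbs (0 : K) = 0 := by
  rw [normAbs, dif_pos rfl]

theorem normAbs_pos {y : K} (hy : y ≠ 0) : 0 < normAbs y := by
  rw [normAbs_of_ne_zero hy]
  exact_mod_cast distribHaarChar_pos

theorem normAbs_ne_zero {y : K} (hy : y ≠ 0) : normAbs y ≠ 0 := (normAbs_pos hy).ne'

theorem normAbs_nonneg (y : K) : 0 ≤ normAbs y := by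
  rcases eq_or_ne y 0 with rfl | hy
  · simp
  · exact (normAbs_pos hy).le

@[simp] theorem normAbs_one : normAbs (1 : K) = 1 := by
  rw [normAbs_of_ne_zero one_ne_zero]
  simp

@[simp] theorem normAbs_mul (x y : K) : normAbs (x * y) = normAbs x * normAbs y := by
  rcases eq_or_ne x 0 with rfl | hx
  · simp
  rcases eq_or_ne y 0 with rfl | hy
  · simp
  rw [normAbs_of_ne_zero hx, normAbs_of_ne_zero hy, normAbs_of_ne_zero (mul_ne_zero hx hy),
    Units.mk0_mul, map_mul, NNReal.coe_mul]

@[simp] theorem normAbs_inv (x : K) : normAbs x⁻¹ = (normAbs x)⁻¹ := by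
  rcases eq_or_ne x 0 with rfl | hx
  · simp
  · refine eq_inv_of_mul_eq_one_left ?_
    rw [← normAbs_mul, inv_mul_cancel₀ hx, normAbs_one]

@[simp] theorem normAbs_pow (x : K) (n : ℕ) : normAbs (x ^ n) = normAbs x ^ n := by
  induction n with
  | zero => simp
  | succ n ih => rw [pow_succ, normAbs_mul, ih, pow_succ]

@[simp] theorem normAbs_neg (x : K) : normAbs (-x) = normAbs x := by
  have h : normAbs (-1 : K) = 1 := by
    have h2 : normAbs (-1 : K) * normAbs (-1 : K) = 1 := by
      rw [← normAbs_mul]; simp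
    nlinarith [normAbs_nonneg (-1 : K)]
  rw [← neg_one_mul, normAbs_mul, h, one_mul]

theorem log_normAbs_mul {x y : K} (hx : x ≠ 0) (hy : y ≠ 0) :
    Real.log (normAbs (x * y)) = Real.log (normAbs x) + Real.log (normAbs y) := by
  rw [normAbs_mul, Real.log_mul (normAbs_ne_zero hx) (normAbs_ne_zero hy)]

theorem log_normAbs_inv (x : K) : Real.log (normAbs x⁻¹) = -Real.log (normAbs x) := by
  rw [normAbs_inv, Real.log_inv]

variable [MeasurableSpace K] [BorelSpace K] (μ : Measure K) [μ.IsAddHaarMeasure]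

theorem measure_preimage_mul_left {t : K} (ht : t ≠ 0) (s : Set K) :
    μ ((fun y => t * y) ⁻¹' s) = ENNReal.ofReal (normAbs t)⁻¹ * μ s := by
  have h := distribHaarChar_mul μ (Units.mk0 t⁻¹ (inv_ne_zero ht)) s
  rw [← normAbs_inv, normAbs_of_ne_zero (inv_ne_zero ht), ENNReal.ofReal_coe_nnreal, h]
  congr 1
  ext y
  rw [Set.mem_smul_set_iff_inv_smul_mem]
  simp [Units.smul_def]

theorem map_mul_left_measure {t : K} (ht : t ≠ 0) :
    μ.map (fun y => t * y) = ENNReal.ofReal (normAbs t)⁻¹ • μ := by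
  ext s hs
  rw [Measure.map_apply (by fun_prop) hs, measure_preimage_mul_left μ ht, Measure.smul_apply,
    smul_eq_mul]

theorem lintegral_comp_mul_left {t : K} (ht : t ≠ 0) (f : K → ℝ≥0∞) :
    ∫⁻ y, f (t * y) ∂μ = ENNReal.ofReal (normAbs t)⁻¹ * ∫⁻ y, f y ∂μ := by
  have h := (Homeomorph.mulLeft₀ t ht).measurableEmbedding.lintegral_map f (μ := μ)
  have h2 := map_mul_left_measure μ ht
  simp only [Homeomorph.coe_mulLeft₀] at h
  rw [← h, h2, lintegral_smul_measure, smul_eq_mul]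

theorem integral_comp_mul_left' {E : Type*} [NormedAddCommGroup E] [NormedSpace ℝ E]
    {t : K} (ht : t ≠ 0) (f : K → E) :
    ∫ y, f (t * y) ∂μ = (normAbs t)⁻¹ • ∫ y, f y ∂μ := by
  have h := (Homeomorph.mulLeft₀ t ht).measurableEmbedding.integral_map f (μ := μ)
  have h2 := map_mul_left_measure μ ht
  simp only [Homeomorph.coe_mulLeft₀] at h
  rw [← h, h2, integral_smul_measure, ENNReal.toReal_ofReal (inv_nonneg.2 (normAbs_nonneg t))]

theorem integrable_comp_mul_left {E : Type*} [NormedAddCommGroup E]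
    {t : K} (ht : t ≠ 0) {f : K → E} (hf : Integrable f μ) :
    Integrable (fun y => f (t * y)) μ := by
  have h := (Homeomorph.mulLeft₀ t ht).measurableEmbedding.integrable_map_iff (g := f) (μ := μ)
  have h2 := map_mul_left_measure μ ht
  simp only [Homeomorph.coe_mulLeft₀] at h
  rw [h2] at h
  exact h.1 (hf.smul_measure ENNReal.ofReal_ne_top)

variable {μ}

theorem quasiMeasurePreserving_mul_left {t : K} (ht : t ≠ 0) :
    Measure.QuasiMeasurePreserving (fun y => t * y) μ μ :=
  ⟨by fun_prop, by rw [map_mul_left_measure μ ht]; exact Measure.smul_absolutelyContinuous⟩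

/-- If `f` has compact support, then the functions `y ↦ f (t y)`, for `t` in a compact set not
containing `0`, have a common compact support. -/
theorem exists_isCompact_forall_comp_mul_eq_zero {E : Type*} [Zero E] {f : K → E}
    (hf : HasCompactSupport f) {T : Set K} (hT : IsCompact T) (hT0 : (0 : K) ∉ T) :
    ∃ k : Set K, IsCompact k ∧ ∀ t ∈ T, ∀ y ∉ k, f (t * y) = 0 := by
  refine ⟨(fun p : K × K => p.1⁻¹ * p.2) '' (T ×ˢ tsupport f), ?_, ?_⟩
  · refine (hT.prod hf.isCompact).image_of_continuousOn ?_
    refine ContinuousOn.mul (continuousOn_fst.inv₀ ?_) continuousOn_snd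
    rintro ⟨t, y⟩ ⟨ht, -⟩ rfl
    exact hT0 ht
  · intro t ht y hy
    by_contra hne
    have ht0 : t ≠ 0 := fun h => hT0 (h ▸ ht)
    exact hy ⟨(t, t * y), ⟨ht, subset_tsupport f hne⟩, by field_simp⟩

theorem exists_isCompact_mem_nhds_zero_notMem {t : K} (ht : t ≠ 0) :
    ∃ T ∈ 𝓝 t, IsCompact T ∧ (0 : K) ∉ T := by
  obtain ⟨T, hT, hTs, hTc⟩ := local_compact_nhds (isOpen_compl_singleton.mem_nhds ht)
  exact ⟨T, hT, hTc, fun h => hTs h rfl⟩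

/-- For a bump function `f`, `|t|` is the quotient of `∫ f(y) dy` by `∫ f(ty) dy`. The denominator
is continuous in `t`, since near `t₀ ≠ 0` the functions `f(t·)` share a compact support. -/
theorem continuousOn_normAbs : ContinuousOn (normAbs : K → ℝ) {0}ᶜ := by
  let μ : Measure K := Measure.addHaar
  intro t₀ ht₀
  refine ContinuousAt.continuousWithinAt ?_
  obtain ⟨T, hT, hTc, hT0⟩ := exists_isCompact_mem_nhds_zero_notMem ht₀
  obtain ⟨f, hfc, hf0, hf1⟩ := exists_continuous_nonneg_pos (0 : K)
  obtain ⟨k, hk, hkf⟩ := exists_isCompact_forall_comp_mul_eq_zero hfc hTc hT0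
  have hpos : 0 < ∫ y, f y ∂μ :=
    f.continuous.integral_pos_of_hasCompactSupport_nonneg_nonzero hfc hf0 hf1
  have hcont : ContinuousOn (fun t => ∫ y, f (t * y) ∂μ) T :=
    continuousOn_integral_of_compact_support (f := fun t y => f (t * y)) hk
      (f.continuous.comp continuous_mul).continuousOn fun t y ht hy => hkf t ht y hy
  have hval : ∀ t : K, t ≠ 0 → ∫ y, f (t * y) ∂μ = (normAbs t)⁻¹ * ∫ y, f y ∂μ :=
    fun t ht => integral_comp_mul_left' μ ht f
  have h2 : ContinuousAt (fun t => (∫ y, f y ∂μ) / ∫ y, f (t * y) ∂μ) t₀ := by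
    refine ContinuousAt.div continuousAt_const (hcont.continuousAt hT) ?_
    rw [hval _ ht₀]
    exact mul_ne_zero (inv_ne_zero (normAbs_ne_zero ht₀)) hpos.ne'
  refine h2.congr ?_
  filter_upwards [hT] with t ht
  have ht0 : t ≠ 0 := fun h => hT0 (h ▸ ht)
  rw [hval t ht0]
  have := normAbs_ne_zero ht0
  field_simp

@[fun_prop] theorem measurable_normAbs : Measurable (normAbs : K → ℝ) := by
  classical
  have h : (normAbs : K → ℝ) = ({0}ᶜ : Set K).piecewise normAbs (fun _ => 0) := by
    ext y
    rcases eq_or_ne y 0 with rfl | hy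
    · simp
    · simp [hy]
  rw [h]
  exact continuousOn_normAbs.measurable_piecewise continuousOn_const
    (measurableSet_singleton 0).compl

end NormAbs

/-! ### Balls of the absolute value: compactness, and integrability of powers at the origin -/

section NormAbsBall

variable {K : Type*} [Field K] [TopologicalSpace K] [IsLocalField K]

/-- Since `0` is not isolated, Haar measure has no atoms and `{0}` is a null set. -/
instance IsLocalField.neBot_nhdsNE_zero : (𝓝[≠] (0 : K)).NeBot := by
  obtain ⟨a, ha0, ha⟩ := IsLocalField.exists_pow_tendsto_zero K
  exact (tendsto_nhdsWithin_iff.2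
    ⟨ha, Eventually.of_forall fun n => pow_ne_zero n ha0⟩).neBot

variable [MeasurableSpace K] [BorelSpace K]

/-- Outer regularity at the null set `{0}` gives an open `U ∋ 0` with `μ U < μ C`. Some `aⁿC` lies
in `U`, whereas `|a| ≥ 1` would give `μ(aⁿC) ≥ μ C`. -/
theorem normAbs_lt_one_of_tendsto {a : K} (ha : Tendsto (fun n : ℕ => a ^ n) atTop (𝓝 0)) :
    normAbs a < 1 := by
  rcases eq_or_ne a 0 with rfl | ha0
  · simp
  let μ : Measure K := Measure.addHaar
  obtain ⟨C, hC, hC0⟩ := exists_compact_mem_nhds (0 : K)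
  have hCpos : 0 < μ C := Measure.measure_pos_of_mem_nhds μ hC0
  have hCfin : μ C ≠ ∞ := hC.measure_ne_top
  obtain ⟨U, hU0, hU, hUC⟩ := Set.exists_isOpen_lt_of_lt ({0} : Set K) (μ C)
    (by rw [measure_singleton (μ := μ)]; exact hCpos)
  obtain ⟨n, hn⟩ := (IsLocalField.eventually_pow_mul_mem ha hC
    (hU.mem_nhds (hU0 rfl))).exists
  by_contra! hlt
  have h1 : μ C ≤ μ ((fun y => a ^ n * y) ⁻¹' U) := measure_mono fun x hx => hn x hx
  rw [measure_preimage_mul_left μ (pow_ne_zero n ha0)] at h1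
  have h2 : ENNReal.ofReal (normAbs (a ^ n))⁻¹ ≤ 1 := by
    rw [ENNReal.ofReal_le_one, normAbs_pow]
    exact inv_le_one_of_one_le₀ (one_le_pow₀ hlt)
  exact absurd (h1.trans (mul_le_of_le_one_left' h2)) (not_le.2 hUC)

variable (K) in
theorem exists_normAbs_lt_one_and_tendsto : ∃ a : K, a ≠ 0 ∧ 0 < normAbs a ∧ normAbs a < 1 ∧
    Tendsto (fun n : ℕ => a ^ n) atTop (𝓝 0) := by
  obtain ⟨a, ha0, ha⟩ := IsLocalField.exists_pow_tendsto_zero K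
  exact ⟨a, ha0, normAbs_pos ha0, normAbs_lt_one_of_tendsto ha, ha⟩

/-- Multiply `x` by powers of `a` until it first enters `C`. If `n > 0` steps are needed, `aⁿx` lies
in the shell `C \ a·int C`, which is compact and misses `0`, so `|aⁿx| ≥ δ` there. With `|x| ≤ 1`
this bounds `n` by some `N`, and finitely many dilates of `C` suffice. -/
theorem exists_isCompact_normAbs_le_one : ∃ C : Set K, IsCompact C ∧ {x | normAbs x ≤ 1} ⊆ C := by
  obtain ⟨a, ha0, hq0, hq1, ha⟩ := exists_normAbs_lt_one_and_tendsto K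
  obtain ⟨C, hC, hC0⟩ := exists_compact_mem_nhds (0 : K)
  have hop : IsOpen ((fun x => a * x) '' interior C) := by
    have := (Homeomorph.mulLeft₀ a ha0).isOpenMap _ (isOpen_interior (s := C))
    simpa using this
  let S := C \ ((fun x => a * x) '' interior C)
  have hS : IsCompact S := hC.diff hop
  have hS0 : ∀ x ∈ S, x ≠ 0 := by
    rintro x ⟨-, hx⟩ rfl
    exact hx ⟨0, mem_interior_iff_mem_nhds.2 hC0, mul_zero a⟩
  obtain ⟨δ, hδ, hδS⟩ : ∃ δ > 0, ∀ x ∈ S, δ ≤ normAbs x := by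
    rcases S.eq_empty_or_nonempty with h | h
    · exact ⟨1, one_pos, by simp [h]⟩
    · obtain ⟨x, hx, hmin⟩ := hS.exists_isMinOn h
        (continuousOn_normAbs.mono fun x hx => hS0 x hx)
      exact ⟨normAbs x, normAbs_pos (hS0 x hx), fun y hy => hmin hy⟩
  obtain ⟨N, hN⟩ := exists_pow_lt_of_lt_one hδ hq1
  refine ⟨⋃ n ∈ Finset.range (N + 1), (fun x => (a ^ n)⁻¹ * x) '' C,
    (Finset.range (N + 1)).isCompact_biUnion fun n _ => hC.image (by fun_prop), ?_⟩
  intro x hx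
  have hex : ∃ n : ℕ, a ^ n * x ∈ C := by
    obtain ⟨n, hn⟩ := (IsLocalField.eventually_pow_mul_mem ha
      (isCompact_singleton (x := x)) hC0).exists
    exact ⟨n, hn x rfl⟩
  classical
  have hle : Nat.find hex ≤ N := by
    by_contra! hlt
    obtain ⟨m, hm⟩ : ∃ m, Nat.find hex = m + 1 := ⟨Nat.find hex - 1, by omega⟩
    have h1 : a ^ (m + 1) * x ∈ C := hm ▸ Nat.find_spec hex
    have h2 : a ^ m * x ∉ C := Nat.find_min hex (by omega)
    have h3 : a ^ (m + 1) * x ∈ S := by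
      refine ⟨h1, ?_⟩
      rintro ⟨y, hy, hyx⟩
      have : y = a ^ m * x := by
        apply mul_left_cancel₀ ha0
        simp only at hyx
        rw [hyx]; ring
      exact h2 (this ▸ interior_subset hy)
    have h4 := hδS _ h3
    rw [normAbs_mul, normAbs_pow] at h4
    have h5 : normAbs a ^ (m + 1) * normAbs x ≤ normAbs a ^ N * 1 := by
      refine mul_le_mul ?_ hx (normAbs_nonneg x) (by positivity)
      exact pow_le_pow_of_le_one hq0.le hq1.le (by omega)
    linarith
  simp only [Set.mem_iUnion, Finset.mem_range]
  exact ⟨Nat.find hex, by omega, _, Nat.find_spec hex, inv_mul_cancel_left₀ (pow_ne_zero _ ha0) x⟩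

variable (μ : Measure K) [μ.IsAddHaarMeasure]

theorem measure_normAbs_le_lt_top (r : ℝ) : μ {x | normAbs x ≤ r} < ∞ := by
  obtain ⟨a, ha0, hq0, hq1, ha⟩ := exists_normAbs_lt_one_and_tendsto K
  obtain ⟨C, hC, hCb⟩ := exists_isCompact_normAbs_le_one (K := K)
  obtain ⟨n, hn⟩ : ∃ n : ℕ, r ≤ (normAbs a)⁻¹ ^ n :=
    pow_unbounded_of_one_lt r ((one_lt_inv₀ hq0).2 hq1) |>.imp fun n h => h.le
  refine (measure_mono (t := (fun y => a ^ n * y) ⁻¹' C) fun x hx => hCb ?_).trans_lt ?_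
  · simp only [Set.mem_ofPred_eq, normAbs_mul, normAbs_pow] at hx ⊢
    calc normAbs a ^ n * normAbs x ≤ normAbs a ^ n * (normAbs a)⁻¹ ^ n := by gcongr; exact hx.trans hn
      _ = 1 := by rw [← mul_pow, mul_inv_cancel₀ hq0.ne', one_pow]
  · rw [measure_preimage_mul_left μ (pow_ne_zero n ha0)]
    exact ENNReal.mul_lt_top ENNReal.ofReal_lt_top hC.measure_lt_top

/-- The shells `q^{n+1} < |x| ≤ qⁿ`, with `q = |a|`, are the dilates by `aⁿ` of the first one, so
their contributions form a geometric series of ratio `q^{1+s}`. -/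
theorem setLIntegral_normAbs_rpow_lt_top {s : ℝ} (hs : -1 < s) :
    ∫⁻ x in {x : K | x ≠ 0 ∧ normAbs x ≤ 1}, ENNReal.ofReal (normAbs x ^ s) ∂μ < ∞ := by
  obtain ⟨a, ha0, hq0, hq1, ha⟩ := exists_normAbs_lt_one_and_tendsto K
  set q := normAbs a
  let T : ℕ → Set K := fun n => {x | q ^ (n + 1) < normAbs x ∧ normAbs x ≤ q ^ n}
  have hT : ∀ n, MeasurableSet (T n) := fun n =>
    (measurableSet_lt measurable_const measurable_normAbs).inter
      (measurableSet_le measurable_normAbs measurable_const)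
  have hcover : {x : K | x ≠ 0 ∧ normAbs x ≤ 1} ⊆ ⋃ n, T n := by
    rintro x ⟨hx0, hx1⟩
    obtain ⟨n, hn1, hn2⟩ := exists_nat_pow_near_of_lt_one (normAbs_pos hx0) hx1 hq0 hq1
    exact Set.mem_iUnion.2 ⟨n, hn1, hn2⟩
  have hscale : ∀ n, ∫⁻ x in T n, ENNReal.ofReal (normAbs x ^ s) ∂μ =
      ENNReal.ofReal (q ^ (1 + s)) ^ n * ∫⁻ x in T 0, ENNReal.ofReal (normAbs x ^ s) ∂μ := by
    intro n
    have h := lintegral_comp_mul_left μ (pow_ne_zero n ha0)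
      ((T n).indicator fun x => ENNReal.ofReal (normAbs x ^ s))
    have h2 : (fun y => (T n).indicator (fun x => ENNReal.ofReal (normAbs x ^ s)) (a ^ n * y)) =
        fun y => ENNReal.ofReal ((q ^ n) ^ s) *
          (T 0).indicator (fun x => ENNReal.ofReal (normAbs x ^ s)) y := by
      funext y
      have hiff : a ^ n * y ∈ T n ↔ y ∈ T 0 := by
        simp only [T, Set.mem_ofPred_eq, normAbs_mul, normAbs_pow]
        have hqn : 0 < q ^ n := pow_pos hq0 n
        constructor
        · rintro ⟨h1, h2⟩
          refine ⟨?_, ?_⟩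
          · rw [pow_succ] at h1
            simpa using lt_of_mul_lt_mul_left h1 hqn.le
          · have h2' : q ^ n * normAbs y ≤ q ^ n * 1 := by simpa using h2
            simpa using le_of_mul_le_mul_left h2' hqn
        · rintro ⟨h1, h2⟩
          refine ⟨?_, ?_⟩
          · rw [pow_succ]
            simpa using mul_lt_mul_of_pos_left h1 hqn
          · simpa using mul_le_mul_of_nonneg_left h2 hqn.le
      by_cases hy : y ∈ T 0
      · rw [Set.indicator_of_mem (hiff.2 hy), Set.indicator_of_mem hy, normAbs_mul, normAbs_pow,
          Real.mul_rpow (by positivity) (normAbs_nonneg y), ENNReal.ofReal_mul (by positivity)]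
      · rw [Set.indicator_of_notMem (fun h => hy (hiff.1 h)), Set.indicator_of_notMem hy, mul_zero]
    rw [h2, lintegral_const_mul _ ((by fun_prop : Measurable
        fun x : K => ENNReal.ofReal (normAbs x ^ s)).indicator (hT 0)), normAbs_pow,
      lintegral_indicator (hT 0), lintegral_indicator (hT n)] at h
    have hqn : 0 < q ^ n := pow_pos hq0 n
    have h3 : ENNReal.ofReal (q ^ n) * ENNReal.ofReal (q ^ n)⁻¹ = 1 := by
      rw [← ENNReal.ofReal_mul hqn.le, mul_inv_cancel₀ hqn.ne', ENNReal.ofReal_one]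
    calc ∫⁻ x in T n, ENNReal.ofReal (normAbs x ^ s) ∂μ
        = ENNReal.ofReal (q ^ n) * (ENNReal.ofReal (q ^ n)⁻¹ *
            ∫⁻ x in T n, ENNReal.ofReal (normAbs x ^ s) ∂μ) := by
          rw [← mul_assoc, h3, one_mul]
      _ = _ := by
          rw [← h, ← mul_assoc, ← ENNReal.ofReal_mul hqn.le, ← ENNReal.ofReal_pow (by positivity)]
          congr 2
          rw [← Real.rpow_natCast (q ^ (1 + s)), ← Real.rpow_mul hq0.le, ← Real.rpow_natCast q,
            ← Real.rpow_mul hq0.le, ← Real.rpow_add hq0]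
          congr 1; ring
  have h0 : ∫⁻ x in T 0, ENNReal.ofReal (normAbs x ^ s) ∂μ < ∞ := by
    have hbd : ∀ x ∈ T 0, ENNReal.ofReal (normAbs x ^ s) ≤ ENNReal.ofReal (max 1 (q ^ s)) := by
      rintro x ⟨h1, h2⟩
      simp only [zero_add, pow_one, pow_zero] at h1 h2
      apply ENNReal.ofReal_le_ofReal
      rcases le_total 0 s with hs0 | hs0
      · exact le_max_of_le_left (Real.rpow_le_one (normAbs_nonneg x) h2 hs0)
      · exact le_max_of_le_right (Real.rpow_le_rpow_of_nonpos hq0 h1.le hs0)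
    refine (setLIntegral_mono measurable_const hbd).trans_lt ?_
    rw [setLIntegral_const]
    refine ENNReal.mul_lt_top ENNReal.ofReal_lt_top
      ((measure_mono fun x hx => ?_).trans_lt (measure_normAbs_le_lt_top μ 1))
    simpa using hx.2
  calc _ ≤ ∫⁻ x in ⋃ n, T n, ENNReal.ofReal (normAbs x ^ s) ∂μ := lintegral_mono_set hcover
    _ ≤ ∑' n, ∫⁻ x in T n, ENNReal.ofReal (normAbs x ^ s) ∂μ := lintegral_iUnion_le _ _
    _ = (∑' n : ℕ, ENNReal.ofReal (q ^ (1 + s)) ^ n) *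
        ∫⁻ x in T 0, ENNReal.ofReal (normAbs x ^ s) ∂μ := by
      rw [← ENNReal.tsum_mul_right]; exact tsum_congr hscale
    _ < ∞ := by
      refine ENNReal.mul_lt_top ?_ h0
      rw [ENNReal.tsum_geometric, ENNReal.inv_lt_top, tsub_pos_iff_lt, ENNReal.ofReal_lt_one]
      exact Real.rpow_lt_one hq0.le hq1 (by linarith)

end NormAbsBall

/-! ### The multiplicative Haar measure `dy/|y|` and its invariance under inversion -/

noncomputable section MulMeasure

variable {K : Type*} [Field K] [TopologicalSpace K] [IsLocalField K] [MeasurableSpace K]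
  [BorelSpace K]

/-- The multiplicatively invariant measure `dy / |y|` on `K`, for which `0` is a null set. -/
def mulMeasure (μ : Measure K) : Measure K :=
  μ.withDensity fun y => ENNReal.ofReal (normAbs y)⁻¹

variable (μ : Measure K) [μ.IsAddHaarMeasure]

theorem ae_ne_zero : ∀ᵐ y ∂μ, y ≠ 0 := by
  rw [ae_iff]
  simp

theorem mulMeasure_absolutelyContinuous : mulMeasure μ ≪ μ :=
  withDensity_absolutelyContinuous _ _

theorem absolutelyContinuous_mulMeasure : μ ≪ mulMeasure μ := by
  refine withDensity_absolutelyContinuous' (by fun_prop) ?_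
  filter_upwards [ae_ne_zero μ] with y hy
  simpa using normAbs_pos hy

theorem lintegral_mulMeasure (f : K → ℝ≥0∞) :
    ∫⁻ y, f y ∂(mulMeasure μ) = ∫⁻ y, ENNReal.ofReal (normAbs y)⁻¹ * f y ∂μ := by
  rw [mulMeasure, lintegral_withDensity_eq_lintegral_mul_non_measurable _ (by fun_prop)
    (Eventually.of_forall fun _ => ENNReal.ofReal_lt_top)]
  rfl

theorem lintegral_mul_mulMeasure (f : K → ℝ≥0∞) :
    ∫⁻ y, ENNReal.ofReal (normAbs y) * f y ∂(mulMeasure μ) = ∫⁻ y, f y ∂μ := by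
  rw [lintegral_mulMeasure]
  refine lintegral_congr_ae ?_
  filter_upwards [ae_ne_zero μ] with y hy
  rw [← mul_assoc, ← ENNReal.ofReal_mul (inv_nonneg.2 (normAbs_nonneg y)),
    inv_mul_cancel₀ (normAbs_ne_zero hy), ENNReal.ofReal_one, one_mul]

theorem integral_mulMeasure {E : Type*} [NormedAddCommGroup E] [NormedSpace ℝ E] (f : K → E) :
    ∫ y, f y ∂(mulMeasure μ) = ∫ y, (normAbs y)⁻¹ • f y ∂μ := by
  rw [mulMeasure, integral_withDensity_eq_integral_toReal_smul (by fun_prop)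
    (Eventually.of_forall fun _ => ENNReal.ofReal_lt_top)]
  simp_rw [ENNReal.toReal_ofReal (inv_nonneg.2 (normAbs_nonneg _))]

theorem integrable_mulMeasure_iff {E : Type*} [NormedAddCommGroup E] [NormedSpace ℝ E]
    {f : K → E} :
    Integrable f (mulMeasure μ) ↔ Integrable (fun y => (normAbs y)⁻¹ • f y) μ := by
  rw [mulMeasure, integrable_withDensity_iff_integrable_smul' (by fun_prop)
    (Eventually.of_forall fun _ => ENNReal.ofReal_lt_top)]
  simp_rw [ENNReal.toReal_ofReal (inv_nonneg.2 (normAbs_nonneg _))]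

theorem lintegral_mulMeasure_comp_mul_left {t : K} (ht : t ≠ 0) (f : K → ℝ≥0∞) :
    ∫⁻ y, f (t * y) ∂(mulMeasure μ) = ∫⁻ y, f y ∂(mulMeasure μ) := by
  rw [lintegral_mulMeasure, lintegral_mulMeasure]
  have h := lintegral_comp_mul_left μ ht fun y => ENNReal.ofReal (normAbs y)⁻¹ * f y
  have hpos := normAbs_pos ht
  have h1 : ∀ y, ENNReal.ofReal (normAbs y)⁻¹ * f (t * y) = ENNReal.ofReal (normAbs t) *
      (ENNReal.ofReal (normAbs (t * y))⁻¹ * f (t * y)) := by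
    intro y
    rw [← mul_assoc, ← ENNReal.ofReal_mul hpos.le, normAbs_mul]
    congr 2
    field_simp
  simp_rw [h1]
  rw [lintegral_const_mul' _ _ ENNReal.ofReal_ne_top, h, ← mul_assoc, ← ENNReal.ofReal_mul hpos.le,
    mul_inv_cancel₀ hpos.ne', ENNReal.ofReal_one, one_mul]

/-- The uniqueness argument for Haar measure: multiply both sides by `∫ g dν`, then move `f(1/x)
g(xy)` through Fubini twice using dilation invariance. With `g = |y| 1_C` this factor equals `μ C`,
which is neither `0` nor `∞` and can be cancelled. -/
theorem lintegral_mulMeasure_comp_inv {f : K → ℝ≥0∞} (hf : Measurable f) :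
    ∫⁻ y, f y⁻¹ ∂(mulMeasure μ) = ∫⁻ y, f y ∂(mulMeasure μ) := by
  let ν := mulMeasure μ
  change ∫⁻ y, f y⁻¹ ∂ν = ∫⁻ y, f y ∂ν
  have : SigmaFinite ν :=
    inferInstanceAs (SigmaFinite (μ.withDensity fun y => ((normAbs y)⁻¹.toNNReal : ℝ≥0∞)))
  have hne : ∀ᵐ y ∂ν, y ≠ 0 := (mulMeasure_absolutelyContinuous μ).ae_le (ae_ne_zero μ)
  obtain ⟨C, hC, hC0⟩ := exists_compact_mem_nhds (0 : K)
  let g : K → ℝ≥0∞ := fun y => ENNReal.ofReal (normAbs y) * C.indicator 1 y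
  have hg : Measurable g :=
    (by fun_prop : Measurable fun y : K => ENNReal.ofReal (normAbs y)).mul
      (measurable_one.indicator hC.measurableSet)
  have hgC : ∫⁻ y, g y ∂ν = μ C := by
    rw [lintegral_mul_mulMeasure, lintegral_indicator_one hC.measurableSet]
  have hmul : ∀ F : K → ℝ≥0∞, (∫⁻ x, F x ∂ν) * (∫⁻ y, g y ∂ν) = ∫⁻ x, F x * ∫⁻ y, g y ∂ν ∂ν :=
    fun F => (lintegral_mul_const' _ _ (by rw [hgC]; exact hC.measure_ne_top)).symm
  have key : (∫⁻ y, f y⁻¹ ∂ν) * (∫⁻ y, g y ∂ν) = (∫⁻ y, f y ∂ν) * (∫⁻ y, g y ∂ν) := by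
    calc (∫⁻ y, f y⁻¹ ∂ν) * (∫⁻ y, g y ∂ν)
        = ∫⁻ x, f x⁻¹ * ∫⁻ y, g y ∂ν ∂ν := hmul _
      _ = ∫⁻ x, ∫⁻ y, f x⁻¹ * g (x * y) ∂ν ∂ν := by
          refine lintegral_congr_ae ?_
          filter_upwards [hne] with x hx
          rw [← lintegral_mulMeasure_comp_mul_left μ hx g, lintegral_const_mul _ (by fun_prop)]
      _ = ∫⁻ y, ∫⁻ x, f x⁻¹ * g (x * y) ∂ν ∂ν :=
          lintegral_lintegral_swap (by fun_prop)
      _ = ∫⁻ y, ∫⁻ x, f (y * x⁻¹) * g x ∂ν ∂ν := by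
          refine lintegral_congr_ae ?_
          filter_upwards [hne] with y hy
          rw [← lintegral_mulMeasure_comp_mul_left μ (inv_ne_zero hy)]
          refine lintegral_congr fun x => ?_
          rw [mul_inv, inv_inv, mul_comm (y⁻¹ * x) y, mul_inv_cancel_left₀ hy]
      _ = ∫⁻ x, ∫⁻ y, f (y * x⁻¹) * g x ∂ν ∂ν :=
          lintegral_lintegral_swap (by fun_prop)
      _ = ∫⁻ x, (∫⁻ y, f y ∂ν) * g x ∂ν := by
          refine lintegral_congr_ae ?_
          filter_upwards [hne] with x hx
          rw [← lintegral_mulMeasure_comp_mul_left μ (inv_ne_zero hx) f,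
            lintegral_mul_const _ (by fun_prop)]
          simp_rw [mul_comm x⁻¹]
          rfl
      _ = _ := lintegral_const_mul _ hg
  rw [hgC] at key
  exact (ENNReal.mul_left_inj (Measure.measure_pos_of_mem_nhds μ hC0).ne' hC.measure_ne_top).1 key

theorem measurePreserving_inv_mulMeasure :
    MeasurePreserving (fun y : K => y⁻¹) (mulMeasure μ) (mulMeasure μ) := by
  refine ⟨by fun_prop, ?_⟩
  ext s hs
  rw [Measure.map_apply (by fun_prop) hs, ← lintegral_indicator_one hs,
    ← lintegral_indicator_one ((by fun_prop : Measurable fun y : K => y⁻¹) hs),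
    ← lintegral_mulMeasure_comp_inv μ (measurable_one.indicator hs)]
  rfl

theorem quasiMeasurePreserving_inv : Measure.QuasiMeasurePreserving (fun y : K => y⁻¹) μ μ :=
  ((measurePreserving_inv_mulMeasure μ).quasiMeasurePreserving.mono_left
    (absolutelyContinuous_mulMeasure μ)).mono_right (mulMeasure_absolutelyContinuous μ)

end MulMeasure

/-! ### Isometric weighted composition operators on `L²` -/

noncomputable section WeightedComposition

variable {K : Type*} [MeasurableSpace K]

/-- The data of a weighted composition operator `f ↦ w · (f ∘ σ)` which is isometric on `L²`. -/
structure IsIsometricWeight (μ : Measure K) (w : K → ℂ) (σ : K → K) : Prop where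
  measurable_weight : Measurable w
  quasiMeasurePreserving : Measure.QuasiMeasurePreserving σ μ μ
  lintegral_eq : ∀ f : K → ℝ≥0∞, Measurable f → ∫⁻ y, ‖w y‖ₑ ^ 2 * f (σ y) ∂μ = ∫⁻ y, f y ∂μ

variable {μ : Measure K} {w : K → ℂ} {σ : K → K}

theorem eLpNorm_two_eq {f : K → ℂ} : eLpNorm f 2 μ = (∫⁻ y, ‖f y‖ₑ ^ 2 ∂μ) ^ (1 / 2 : ℝ) := by
  rw [eLpNorm_eq_lintegral_rpow_enorm_toReal (by norm_num) (by norm_num)]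
  simp

namespace IsIsometricWeight

theorem eLpNorm_eq (h : IsIsometricWeight μ w σ) (f : Lp ℂ 2 μ) :
    eLpNorm (fun y => w y * f (σ y)) 2 μ = eLpNorm f 2 μ := by
  rw [eLpNorm_two_eq, eLpNorm_two_eq]
  congr 1
  rw [← h.lintegral_eq (fun y => ‖f y‖ₑ ^ 2) ((Lp.stronglyMeasurable f).measurable.enorm.pow_const 2)]
  refine lintegral_congr fun y => ?_
  rw [enorm_mul, mul_pow]

theorem memLp (h : IsIsometricWeight μ w σ) (f : Lp ℂ 2 μ) :
    MemLp (fun y => w y * f (σ y)) 2 μ := by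
  refine ⟨?_, ?_⟩
  · exact (h.measurable_weight.mul ((Lp.stronglyMeasurable f).measurable.comp
      h.quasiMeasurePreserving.measurable)).aestronglyMeasurable
  · rw [h.eLpNorm_eq f]
    exact Lp.eLpNorm_lt_top f

/-- The isometric operator `f ↦ w · (f ∘ σ)` on `L²`. -/
def toIsometry (h : IsIsometricWeight μ w σ) : Lp ℂ 2 μ →ₗᵢ[ℂ] Lp ℂ 2 μ where
  toFun f := (h.memLp f).toLp
  map_add' f g := by
    rw [← MemLp.toLp_add, MemLp.toLp_eq_toLp_iff]
    filter_upwards [h.quasiMeasurePreserving.ae_eq_comp (Lp.coeFn_add f g)] with y hy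
    simp only [Function.comp_apply, Pi.add_apply] at hy
    rw [hy, Pi.add_apply, mul_add]
  map_smul' c f := by
    rw [RingHom.id_apply, ← MemLp.toLp_const_smul, MemLp.toLp_eq_toLp_iff]
    filter_upwards [h.quasiMeasurePreserving.ae_eq_comp (Lp.coeFn_smul c f)] with y hy
    simp only [Function.comp_apply, Pi.smul_apply, smul_eq_mul] at hy
    rw [hy, Pi.smul_apply, smul_eq_mul, mul_left_comm]
  norm_map' f := by
    change ‖(h.memLp f).toLp‖ = ‖f‖
    rw [Lp.norm_toLp, h.eLpNorm_eq f, Lp.norm_def]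

theorem coeFn_toIsometry (h : IsIsometricWeight μ w σ) (f : Lp ℂ 2 μ) :
    h.toIsometry f =ᵐ[μ] fun y => w y * f (σ y) :=
  (h.memLp f).coeFn_toLp

theorem toIsometry_ae_eq (h : IsIsometricWeight μ w σ) {f : Lp ℂ 2 μ} {g : K → ℂ}
    (hg : f =ᵐ[μ] g) : h.toIsometry f =ᵐ[μ] fun y => w y * g (σ y) := by
  filter_upwards [h.coeFn_toIsometry f, h.quasiMeasurePreserving.ae_eq_comp hg] with y hy hy2
  rw [hy]
  exact congrArg _ hy2

end IsIsometricWeight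

end WeightedComposition

/-! ### Dilations and the Inversion as isometries; strong continuity of dilations -/

noncomputable section Dilation

variable {K : Type*} [Field K] [TopologicalSpace K] [IsLocalField K] [MeasurableSpace K]
  [BorelSpace K] (μ : Measure K) [μ.IsAddHaarMeasure]

theorem enorm_sqrt_normAbs_sq (t : K) :
    ‖((√(normAbs t) : ℝ) : ℂ)‖ₑ ^ 2 = ENNReal.ofReal (normAbs t) := by
  rw [← ofReal_norm, ← ENNReal.ofReal_pow (norm_nonneg _), Complex.norm_real,
    Real.norm_of_nonneg (Real.sqrt_nonneg _), Real.sq_sqrt (normAbs_nonneg t)]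

theorem isIsometricWeight_mul_left {t : K} (ht : t ≠ 0) :
    IsIsometricWeight μ (fun _ => ((√(normAbs t) : ℝ) : ℂ)) fun y => t * y where
  measurable_weight := measurable_const
  quasiMeasurePreserving := quasiMeasurePreserving_mul_left ht
  lintegral_eq f _ := by
    rw [lintegral_const_mul' _ _ (by simp), lintegral_comp_mul_left μ ht, enorm_sqrt_normAbs_sq,
      ← mul_assoc, ← ENNReal.ofReal_mul (normAbs_nonneg t), mul_inv_cancel₀ (normAbs_ne_zero ht),
      ENNReal.ofReal_one, one_mul]

theorem isIsometricWeight_inv :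
    IsIsometricWeight μ (fun y => ((normAbs y)⁻¹ : ℂ)) fun y => y⁻¹ where
  measurable_weight := by fun_prop
  quasiMeasurePreserving := quasiMeasurePreserving_inv μ
  lintegral_eq f hf := by
    rw [← lintegral_mul_mulMeasure μ, ← lintegral_mul_mulMeasure μ,
      ← lintegral_mulMeasure_comp_inv μ (by fun_prop)]
    refine lintegral_congr_ae ?_
    filter_upwards [(mulMeasure_absolutelyContinuous μ).ae_le (ae_ne_zero μ)] with y hy
    have h : ‖((normAbs y⁻¹)⁻¹ : ℂ)‖ₑ = ENNReal.ofReal (normAbs y) := by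
      rw [← Complex.ofReal_inv, normAbs_inv, inv_inv, ← ofReal_norm, Complex.norm_real,
        Real.norm_of_nonneg (normAbs_nonneg y)]
    rw [h, inv_inv, ← mul_assoc, ← ENNReal.ofReal_pow (normAbs_nonneg y),
      ← ENNReal.ofReal_mul (normAbs_nonneg _), normAbs_inv]
    congr 2
    have := normAbs_ne_zero hy
    field_simp

/-- The unitary dilation `(D_t f)(y) = |t|^{1/2} f(ty)` on `L²(K, dy)`, for `t ≠ 0`. -/
def dilation (t : K) : Lp ℂ 2 μ →ₗᵢ[ℂ] Lp ℂ 2 μ :=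
  open scoped Classical in
  -- The value at `t = 0` never matters, as `{0}` is null for `dt/|t|`. The identity keeps the
  -- family isometric and commuting for all `t`.
  if ht : t = 0 then LinearIsometry.id else (isIsometricWeight_mul_left μ ht).toIsometry

theorem dilation_of_ne_zero {t : K} (ht : t ≠ 0) :
    dilation μ t = (isIsometricWeight_mul_left μ ht).toIsometry := dif_neg ht

/-- The Inversion as an isometric operator. -/
def inversionIsometry : Lp ℂ 2 μ →ₗᵢ[ℂ] Lp ℂ 2 μ := (isIsometricWeight_inv μ).toIsometry

theorem inversion_eq (f : Lp ℂ 2 μ) : inversion μ f = inversionIsometry μ f :=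
  dif_pos ((isIsometricWeight_inv μ).memLp f)

variable {μ}

theorem coeFn_dilation {t : K} (ht : t ≠ 0) (f : Lp ℂ 2 μ) :
    dilation μ t f =ᵐ[μ] fun y => ((√(normAbs t) : ℝ) : ℂ) * f (t * y) := by
  rw [dilation_of_ne_zero μ ht]
  exact (isIsometricWeight_mul_left μ ht).coeFn_toIsometry f

theorem dilation_ae_eq {t : K} (ht : t ≠ 0) {f : Lp ℂ 2 μ} {g : K → ℂ} (hg : f =ᵐ[μ] g) :
    dilation μ t f =ᵐ[μ] fun y => ((√(normAbs t) : ℝ) : ℂ) * g (t * y) := by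
  rw [dilation_of_ne_zero μ ht]
  exact (isIsometricWeight_mul_left μ ht).toIsometry_ae_eq hg

theorem coeFn_inversionIsometry (f : Lp ℂ 2 μ) :
    inversionIsometry μ f =ᵐ[μ] fun y => ((normAbs y)⁻¹ : ℂ) * f y⁻¹ :=
  (isIsometricWeight_inv μ).coeFn_toIsometry f

theorem inversionIsometry_ae_eq {f : Lp ℂ 2 μ} {g : K → ℂ} (hg : f =ᵐ[μ] g) :
    inversionIsometry μ f =ᵐ[μ] fun y => ((normAbs y)⁻¹ : ℂ) * g y⁻¹ :=
  (isIsometricWeight_inv μ).toIsometry_ae_eq hg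

theorem dilation_dilation {s t : K} (hs : s ≠ 0) (ht : t ≠ 0) (f : Lp ℂ 2 μ) :
    dilation μ s (dilation μ t f) = dilation μ (s * t) f := by
  apply Lp.ext
  filter_upwards [dilation_ae_eq hs (coeFn_dilation ht f), coeFn_dilation (mul_ne_zero hs ht) f]
    with y h1 h2
  rw [h1, h2, normAbs_mul, Real.sqrt_mul (normAbs_nonneg s), Complex.ofReal_mul, mul_assoc,
    ← mul_assoc t s y, mul_comm t s]

theorem dilation_one (f : Lp ℂ 2 μ) : dilation μ 1 f = f := by
  apply Lp.ext
  filter_upwards [coeFn_dilation one_ne_zero f] with y h1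
  rw [h1]
  simp

theorem dilation_comm (s t : K) (f : Lp ℂ 2 μ) :
    dilation μ s (dilation μ t f) = dilation μ t (dilation μ s f) := by
  rcases eq_or_ne s 0 with rfl | hs
  · simp [dilation]
  rcases eq_or_ne t 0 with rfl | ht
  · simp [dilation]
  rw [dilation_dilation hs ht, dilation_dilation ht hs, mul_comm]

theorem inversionIsometry_inversionIsometry (f : Lp ℂ 2 μ) :
    inversionIsometry μ (inversionIsometry μ f) = f := by
  apply Lp.ext
  filter_upwards [inversionIsometry_ae_eq (coeFn_inversionIsometry f), ae_ne_zero μ] with y h1 hy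
  rw [h1, normAbs_inv, inv_inv]
  have : (normAbs y : ℂ) ≠ 0 := Complex.ofReal_ne_zero.2 (normAbs_ne_zero hy)
  push_cast
  field_simp

theorem inversionIsometry_dilation {t : K} (ht : t ≠ 0) (f : Lp ℂ 2 μ) :
    inversionIsometry μ (dilation μ t f) = dilation μ t⁻¹ (inversionIsometry μ f) := by
  apply Lp.ext
  filter_upwards [inversionIsometry_ae_eq (coeFn_dilation ht f),
    dilation_ae_eq (inv_ne_zero ht) (coeFn_inversionIsometry f)] with y h1 h2
  rw [h1, h2, mul_inv, inv_inv, normAbs_mul, normAbs_inv, Real.sqrt_inv]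
  have h : (normAbs t : ℂ) = ((√(normAbs t) : ℝ) : ℂ) * ((√(normAbs t) : ℝ) : ℂ) := by
    rw [← Complex.ofReal_mul, Real.mul_self_sqrt (normAbs_nonneg t)]
  have h0 : ((√(normAbs t) : ℝ) : ℂ) ≠ 0 :=
    Complex.ofReal_ne_zero.2 (Real.sqrt_ne_zero'.2 (normAbs_pos ht))
  push_cast
  rw [h]
  field_simp

theorem norm_sq_eq_integral_of_ae_eq {f : Lp ℂ 2 μ} {g : K → ℂ} (hg : f =ᵐ[μ] g) :
    ‖f‖ ^ 2 = ∫ y, ‖g y‖ ^ 2 ∂μ := by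
  have h1 : ((‖f‖ ^ 2 : ℝ) : ℂ) = inner ℂ f f := by
    rw [inner_self_eq_norm_sq_to_K]; simp
  have h2 : ((∫ y, ‖g y‖ ^ 2 ∂μ : ℝ) : ℂ) = ∫ y, ((‖g y‖ ^ 2 : ℝ) : ℂ) ∂μ := integral_ofReal.symm
  rw [← Complex.ofReal_inj, h1, h2, L2.inner_def]
  refine integral_congr_ae ?_
  filter_upwards [hg] with y hy
  rw [hy, inner_self_eq_norm_sq_to_K]
  simp

/-- `‖D_t f - D_{t₀} f‖²` is a parameter integral whose integrand vanishes outside one compact set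
for `t` near `t₀`, hence is continuous in `t` and vanishes at `t₀`. -/
theorem continuousOn_dilation_of_hasCompactSupport {f : Lp ℂ 2 μ} {g : K → ℂ} (hfg : f =ᵐ[μ] g)
    (hg : Continuous g) (hgc : HasCompactSupport g) :
    ContinuousOn (fun t => dilation μ t f) {0}ᶜ := by
  intro t₀ ht₀
  refine ContinuousAt.continuousWithinAt ?_
  obtain ⟨T, hT, hTc, hT0⟩ := exists_isCompact_mem_nhds_zero_notMem ht₀
  obtain ⟨k, hk, hkg⟩ := exists_isCompact_forall_comp_mul_eq_zero hgc hTc hT0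
  have hne : ∀ t ∈ T, t ≠ 0 := fun t ht h => hT0 (h ▸ ht)
  have hcont : ContinuousOn (fun t => ∫ y, ‖((√(normAbs t) : ℝ) : ℂ) * g (t * y) -
      ((√(normAbs t₀) : ℝ) : ℂ) * g (t₀ * y)‖ ^ 2 ∂μ) T := by
    refine continuousOn_integral_of_compact_support (f := fun t y => ‖((√(normAbs t) : ℝ) : ℂ) *
      g (t * y) - ((√(normAbs t₀) : ℝ) : ℂ) * g (t₀ * y)‖ ^ 2) hk ?_ ?_
    · have h1 : ContinuousOn (fun p : K × K => normAbs p.1) (T ×ˢ Set.univ) :=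
        continuousOn_normAbs.comp continuousOn_fst fun p hp => hne _ hp.1
      have h2 : ContinuousOn (fun p : K × K => ((√(normAbs p.1) : ℝ) : ℂ)) (T ×ˢ Set.univ) :=
        Complex.continuous_ofReal.comp_continuousOn h1.sqrt
      have h3 : Continuous fun p : K × K => g (p.1 * p.2) := by fun_prop
      have h4 : Continuous fun p : K × K => ((√(normAbs t₀) : ℝ) : ℂ) * g (t₀ * p.2) := by fun_prop
      exact ((h2.mul h3.continuousOn).sub h4.continuousOn).norm.pow 2
    · intro t y ht hy
      rw [hkg t ht y hy, hkg t₀ (mem_of_mem_nhds hT) y hy]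
      simp
  have hval : ∀ t ∈ T, ∫ y, ‖((√(normAbs t) : ℝ) : ℂ) * g (t * y) -
      ((√(normAbs t₀) : ℝ) : ℂ) * g (t₀ * y)‖ ^ 2 ∂μ = ‖dilation μ t f - dilation μ t₀ f‖ ^ 2 := by
    intro t ht
    refine (norm_sq_eq_integral_of_ae_eq ?_).symm
    filter_upwards [Lp.coeFn_sub (dilation μ t f) (dilation μ t₀ f), dilation_ae_eq (hne t ht) hfg,
      dilation_ae_eq ht₀ hfg] with y h1 h2 h3
    rw [h1, Pi.sub_apply, h2, h3]
  have hlim : Tendsto (fun t => ‖dilation μ t f - dilation μ t₀ f‖ ^ 2) (𝓝 t₀) (𝓝 0) := by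
    have h := (hcont.continuousAt hT).tendsto
    rw [hval t₀ (mem_of_mem_nhds hT), sub_self, norm_zero, zero_pow two_ne_zero] at h
    refine h.congr' ?_
    filter_upwards [hT] with t ht
    exact hval t ht
  have hlim2 := hlim.sqrt
  simp only [Real.sqrt_sq (norm_nonneg _), Real.sqrt_zero] at hlim2
  exact tendsto_iff_norm_sub_tendsto_zero.2 hlim2

theorem exists_hasCompactSupport_norm_sub_le (f : Lp ℂ 2 μ) {ε : ℝ} (hε : 0 < ε) :
    ∃ (g : K → ℂ) (hg : MemLp g 2 μ), Continuous g ∧ HasCompactSupport g ∧ ‖f - hg.toLp‖ ≤ ε := by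
  obtain ⟨g, hgc, hgf, hgcont, hg⟩ := (Lp.memLp f).exists_hasCompactSupport_eLpNorm_sub_le
    (by norm_num) (ENNReal.ofReal_pos.2 hε).ne'
  refine ⟨g, hg, hgcont, hgc, ?_⟩
  rw [Lp.norm_def]
  refine ENNReal.toReal_le_of_le_ofReal hε.le (le_of_eq_of_le (eLpNorm_congr_ae ?_) hgf)
  filter_upwards [Lp.coeFn_sub f hg.toLp, hg.coeFn_toLp] with y h1 h2
  rw [h1, Pi.sub_apply, Pi.sub_apply, h2]

/-- Dilations are isometric, so approximating `f` by a compactly supported continuous function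
approximates `t ↦ D_t f` uniformly in `t`. -/
theorem continuousOn_dilation (f : Lp ℂ 2 μ) : ContinuousOn (fun t => dilation μ t f) {0}ᶜ := by
  refine continuousOn_of_uniform_approx_of_continuousOn fun u hu => ?_
  obtain ⟨ε, hε, hεu⟩ := Metric.mem_uniformity_dist.1 hu
  obtain ⟨g, hg, hgcont, hgc, hfg⟩ := exists_hasCompactSupport_norm_sub_le f (half_pos hε)
  refine ⟨fun t => dilation μ t hg.toLp,
    continuousOn_dilation_of_hasCompactSupport hg.coeFn_toLp hgcont hgc, fun t _ => hεu ?_⟩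
  rw [dist_eq_norm, ← map_sub, LinearIsometry.norm_map]
  linarith

end Dilation

/-! ### Averages of dilations: multiplicative convolution -/

section ClosedSubmodule

/-- The image of the integral in the quotient `E ⧸ V` is the integral of `0`. With `V` a closed
graph, this lets closed operators pass through Bochner integrals. In the non-integrable case the
default value `0` lies in `V`. -/
theorem integral_mem_of_isClosed {X E : Type*} [MeasurableSpace X] {ν : Measure X}
    [NormedAddCommGroup E] [NormedSpace ℂ E] [CompleteSpace E] {V : Submodule ℂ E}
    (hV : IsClosed (V : Set E)) {u : X → E} (hu : ∀ᵐ x ∂ν, u x ∈ V) : ∫ x, u x ∂ν ∈ V := by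
  by_cases hi : Integrable u ν
  swap
  · rw [integral_undef hi]
    exact V.zero_mem
  have : IsClosed (V : Set E) := hV
  have h := V.mkQL.integral_comp_comm hi
  have h0 : ∫ x, V.mkQL (u x) ∂ν = 0 := by
    rw [← integral_zero X (E ⧸ V) (μ := ν)]
    refine integral_congr_ae ?_
    filter_upwards [hu] with x hx
    simpa using hx
  rw [h0] at h
  simpa using h.symm

end ClosedSubmodule

noncomputable section MulConv

variable {K : Type*} [Field K] [TopologicalSpace K] [IsLocalField K] [MeasurableSpace K]
  [BorelSpace K] (μ : Measure K) [μ.IsAddHaarMeasure]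

theorem ae_ne_zero_mulMeasure : ∀ᵐ y ∂(mulMeasure μ), y ≠ 0 :=
  (mulMeasure_absolutelyContinuous μ).ae_le (ae_ne_zero μ)

variable {μ}

theorem aestronglyMeasurable_dilation (f : Lp ℂ 2 μ) :
    AEStronglyMeasurable (fun t => dilation μ t f) (mulMeasure μ) := by
  have h : (mulMeasure μ).restrict {0}ᶜ = mulMeasure μ :=
    Measure.restrict_eq_self_of_ae_mem (ae_ne_zero_mulMeasure μ)
  rw [← h]
  exact (continuousOn_dilation f).aestronglyMeasurable (measurableSet_singleton 0).compl

theorem integrable_smul_dilation {k : K → ℂ} (hk : Integrable k (mulMeasure μ)) (f : Lp ℂ 2 μ) :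
    Integrable (fun t => k t • dilation μ t f) (mulMeasure μ) := by
  refine (hk.norm.mul_const ‖f‖).mono' (hk.1.smul (aestronglyMeasurable_dilation f)) ?_
  refine Eventually.of_forall fun t => ?_
  rw [norm_smul, LinearIsometry.norm_map]

variable (μ)

/-- The operator `∫ k(t) D_t dt / |t|` of multiplicative convolution. -/
def mulConv (k : K → ℂ) : Lp ℂ 2 μ →L[ℂ] Lp ℂ 2 μ :=
  open scoped Classical in
  if hk : Integrable k (mulMeasure μ) then
    LinearMap.mkContinuous
      { toFun := fun f => ∫ t, k t • dilation μ t f ∂(mulMeasure μ)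
        map_add' := fun f g => by
          simp_rw [map_add, smul_add]
          exact integral_add (integrable_smul_dilation hk f) (integrable_smul_dilation hk g)
        map_smul' := fun c f => by
          simp_rw [map_smul, smul_comm _ c, integral_smul, RingHom.id_apply] }
      (∫ t, ‖k t‖ ∂(mulMeasure μ)) fun f => by
        refine (norm_integral_le_integral_norm _).trans (le_of_eq ?_)
        simp_rw [norm_smul, LinearIsometry.norm_map, integral_mul_const]
  else 0

variable {μ}

theorem mulConv_apply {k : K → ℂ} (hk : Integrable k (mulMeasure μ)) (f : Lp ℂ 2 μ) :
    mulConv μ k f = ∫ t, k t • dilation μ t f ∂(mulMeasure μ) := by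
  rw [mulConv, dif_pos hk]
  rfl

theorem integrable_comp_inv {E : Type*} [NormedAddCommGroup E] {k : K → E}
    (hk : Integrable k (mulMeasure μ)) : Integrable (fun t => k t⁻¹) (mulMeasure μ) :=
  (measurePreserving_inv_mulMeasure μ).integrable_comp_of_integrable hk

theorem integral_comp_inv_mulMeasure {E : Type*} [NormedAddCommGroup E] [NormedSpace ℝ E]
    (u : K → E) : ∫ t, u t⁻¹ ∂(mulMeasure μ) = ∫ t, u t ∂(mulMeasure μ) :=
  (measurePreserving_inv_mulMeasure μ).integral_comp (MeasurableEquiv.inv K).measurableEmbedding u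

/-- An operator which intertwines `D_t` and `D_{1/t}` intertwines the multiplicative convolutions
with `k` and with `t ↦ k (1/t)`. -/
theorem map_mulConv_of_map_dilation {L : Lp ℂ 2 μ →L[ℂ] Lp ℂ 2 μ}
    (hL : ∀ t ≠ 0, ∀ f, L (dilation μ t f) = dilation μ t⁻¹ (L f)) (k : K → ℂ) (f : Lp ℂ 2 μ) :
    L (mulConv μ k f) = mulConv μ (fun t => k t⁻¹) (L f) := by
  by_cases hk : Integrable k (mulMeasure μ)
  · rw [mulConv_apply hk, mulConv_apply (integrable_comp_inv hk),
      ← L.integral_comp_comm (integrable_smul_dilation hk f),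
      ← integral_comp_inv_mulMeasure fun t => k t⁻¹ • dilation μ t (L f)]
    refine integral_congr_ae ?_
    filter_upwards [ae_ne_zero_mulMeasure μ] with t ht
    rw [map_smul, hL t ht, inv_inv]
  · have hk' : ¬Integrable (fun t => k t⁻¹) (mulMeasure μ) := fun h =>
      hk (by simpa using integrable_comp_inv h)
    rw [mulConv, dif_neg hk, mulConv, dif_neg hk']
    simp

theorem mulConv_comm_of_map_dilation {L : Lp ℂ 2 μ →L[ℂ] Lp ℂ 2 μ}
    (hL : ∀ t f, L (dilation μ t f) = dilation μ t (L f)) (k : K → ℂ) (f : Lp ℂ 2 μ) :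
    L (mulConv μ k f) = mulConv μ k (L f) := by
  by_cases hk : Integrable k (mulMeasure μ)
  · rw [mulConv_apply hk, mulConv_apply hk, ← L.integral_comp_comm (integrable_smul_dilation hk f)]
    simp_rw [map_smul, hL]
  · rw [mulConv, dif_neg hk]
    simp

theorem mulConv_dilation (k : K → ℂ) (t : K) (f : Lp ℂ 2 μ) :
    mulConv μ k (dilation μ t f) = dilation μ t (mulConv μ k f) :=
  (mulConv_comm_of_map_dilation (L := (dilation μ t).toContinuousLinearMap)
    (fun s f => dilation_comm t s f) k f).symm

/-- The group `Kˣ` is commutative, so each convolution commutes with all dilations and hence with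
their averages. -/
theorem mulConv_comm (k l : K → ℂ) (f : Lp ℂ 2 μ) :
    mulConv μ k (mulConv μ l f) = mulConv μ l (mulConv μ k f) :=
  mulConv_comm_of_map_dilation (fun t f => mulConv_dilation k t f) l f

theorem inversionIsometry_mulConv (k : K → ℂ) (f : Lp ℂ 2 μ) :
    inversionIsometry μ (mulConv μ k f) =
      mulConv μ (fun t => k t⁻¹) (inversionIsometry μ f) :=
  map_mulConv_of_map_dilation (L := (inversionIsometry μ).toContinuousLinearMap)
    (fun _ ht f => inversionIsometry_dilation ht f) k f

/-- Kernels of mass one which are supported close to `1` are approximate identities. -/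
theorem exists_nhds_norm_mulConv_sub_le (f : Lp ℂ 2 μ) {ε : ℝ} (hε : 0 < ε) :
    ∃ N ∈ 𝓝 (1 : K), ∀ k : K → ℂ, Integrable k (mulMeasure μ) → (∀ t ∉ N, k t = 0) →
      ∫ t, k t ∂(mulMeasure μ) = 1 → ∫ t, ‖k t‖ ∂(mulMeasure μ) ≤ 1 →
      ‖mulConv μ k f - f‖ ≤ ε := by
  have hc : ContinuousAt (fun t => dilation μ t f) 1 :=
    (continuousOn_dilation f).continuousAt (isOpen_compl_singleton.mem_nhds one_ne_zero)
  have hN : ∀ᶠ t in 𝓝 (1 : K), ‖dilation μ t f - f‖ ≤ ε := by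
    have h := Metric.tendsto_nhds.1 hc.tendsto ε hε
    filter_upwards [h] with t ht
    rw [dilation_one, dist_eq_norm] at ht
    exact ht.le
  refine ⟨_, hN, fun k hk hkN hk1 hkn => ?_⟩
  have h1 : mulConv μ k f - f = ∫ t, k t • (dilation μ t f - f) ∂(mulMeasure μ) := by
    simp_rw [smul_sub]
    rw [integral_sub (integrable_smul_dilation hk f) (hk.smul_const f), integral_smul_const, hk1,
      one_smul, mulConv_apply hk]
  rw [h1]
  calc ‖∫ t, k t • (dilation μ t f - f) ∂(mulMeasure μ)‖
      ≤ ∫ t, ‖k t‖ * ε ∂(mulMeasure μ) := by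
        refine norm_integral_le_of_norm_le (hk.norm.mul_const ε) (Eventually.of_forall fun t => ?_)
        rw [norm_smul]
        by_cases ht : ‖dilation μ t f - f‖ ≤ ε
        · gcongr
        · rw [hkN t ht]; simp
    _ ≤ ε := by
        rw [integral_mul_const]
        exact mul_le_of_le_one_left hε.le hkn

/-- The pair `(C_k p.1, C_k p.2)` is an average of the pairs `(D_t p.1, D_t p.2)`, all of which lie
in the closed subspace `V`. It will be applied to the closed graph of the commutator. -/
theorem mulConv_mem_of_dilation_mem {V : Submodule ℂ (Lp ℂ 2 μ × Lp ℂ 2 μ)}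
    (hV : IsClosed (V : Set (Lp ℂ 2 μ × Lp ℂ 2 μ)))
    (hD : ∀ t ≠ 0, ∀ p ∈ V, (dilation μ t p.1, dilation μ t p.2) ∈ V) (k : K → ℂ)
    {p : Lp ℂ 2 μ × Lp ℂ 2 μ} (hp : p ∈ V) : (mulConv μ k p.1, mulConv μ k p.2) ∈ V := by
  by_cases hk : Integrable k (mulMeasure μ)
  · rw [mulConv_apply hk, mulConv_apply hk, ← integral_pair (integrable_smul_dilation hk _)
      (integrable_smul_dilation hk _)]
    refine integral_mem_of_isClosed hV ?_
    filter_upwards [ae_ne_zero_mulMeasure μ] with t ht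
    exact V.smul_mem (k t) (hD t ht p hp)
  · rw [mulConv, dif_neg hk]
    exact V.zero_mem

end MulConv

/-! ### The operator `A`: closedness, and its relations with dilation, inversion and convolution -/

noncomputable section OpA

variable {K : Type*} [Field K] [TopologicalSpace K] [IsLocalField K] [MeasurableSpace K]
  [BorelSpace K] {μ : Measure K} [μ.IsAddHaarMeasure]

/-- The domain condition is automatic here, since `g` itself is in `L²`. All unbounded operators are
handled through their graphs, which keeps the domains implicit. -/
theorem mem_graph_opA_iff {f g : Lp ℂ 2 μ} :
    (f, g) ∈ (opA μ).graph ↔ g =ᵐ[μ] fun y => (Real.log (normAbs y) : ℂ) * f y := by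
  rw [LinearPMap.mem_graph_iff]
  constructor
  · rintro ⟨⟨h, hh⟩, rfl, rfl⟩
    exact MemLp.coeFn_toLp hh
  · intro hg
    have hf : MemLp (fun y => (Real.log (normAbs y) : ℂ) * f y) 2 μ :=
      (memLp_congr_ae hg).1 (Lp.memLp g)
    refine ⟨⟨f, hf⟩, rfl, ?_⟩
    apply Lp.ext
    exact (MemLp.coeFn_toLp hf).trans hg.symm

/-- Two successive extractions give a subsequence along which both coordinates converge almost
everywhere, and the pointwise relation passes to the limit. -/
theorem isClosed_graph_opA : IsClosed ((opA μ).graph : Set (Lp ℂ 2 μ × Lp ℂ 2 μ)) := by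
  refine isSeqClosed_iff_isClosed.1 fun u p hu hp => ?_
  obtain ⟨f, g⟩ := p
  have hf : Tendsto (fun n => (u n).1) atTop (𝓝 f) := (continuous_fst.tendsto _).comp hp
  have hg : Tendsto (fun n => (u n).2) atTop (𝓝 g) := (continuous_snd.tendsto _).comp hp
  obtain ⟨φ, hφ, hφf⟩ := (tendstoInMeasure_of_tendsto_Lp hf).exists_seq_tendsto_ae
  obtain ⟨θ, hθ, hθg⟩ := (tendstoInMeasure_of_tendsto_Lp
    (hg.comp hφ.tendsto_atTop)).exists_seq_tendsto_ae
  change (f, g) ∈ (opA μ).graph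
  rw [mem_graph_opA_iff]
  have hall : ∀ᵐ y ∂μ, ∀ n, (u n).2 y = (Real.log (normAbs y) : ℂ) * (u n).1 y :=
    ae_all_iff.2 fun n => mem_graph_opA_iff.1 (hu n)
  filter_upwards [hall, hφf, hθg] with y h1 h2 h3
  refine tendsto_nhds_unique h3 ?_
  have h4 := (h2.comp hθ.tendsto_atTop).const_mul (Real.log (normAbs y) : ℂ)
  refine h4.congr fun n => ?_
  simp only [Function.comp_apply]
  exact (h1 _).symm

/-- This is `log|y| = log|ty| - log|t|`: a dilation shifts `A` by a scalar. -/
theorem opA_graph_dilation {f g : Lp ℂ 2 μ} (h : (f, g) ∈ (opA μ).graph) {t : K} (ht : t ≠ 0) :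
    (dilation μ t f, dilation μ t g - (Real.log (normAbs t) : ℂ) • dilation μ t f) ∈
      (opA μ).graph := by
  rw [mem_graph_opA_iff] at h ⊢
  filter_upwards [Lp.coeFn_sub (dilation μ t g) ((Real.log (normAbs t) : ℂ) • dilation μ t f),
    Lp.coeFn_smul (Real.log (normAbs t) : ℂ) (dilation μ t f), dilation_ae_eq ht h,
    coeFn_dilation ht f, ae_ne_zero μ] with y h1 h2 h3 h4 hy
  rw [h1, Pi.sub_apply, h2, Pi.smul_apply, h3, h4, log_normAbs_mul ht hy, smul_eq_mul]
  push_cast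
  ring

theorem opA_graph_inversion {f g : Lp ℂ 2 μ} (h : (f, g) ∈ (opA μ).graph) :
    (inversionIsometry μ f, -inversionIsometry μ g) ∈ (opA μ).graph := by
  rw [mem_graph_opA_iff] at h ⊢
  filter_upwards [Lp.coeFn_neg (inversionIsometry μ g), inversionIsometry_ae_eq h,
    coeFn_inversionIsometry f] with y h1 h2 h3
  rw [h1, Pi.neg_apply, h2, h3, log_normAbs_inv]
  push_cast
  ring

/-- A Leibniz rule, obtained by integrating the relation for `D_t` against `k(t) dt/|t|` inside the
closed graph of `A`. -/
theorem opA_graph_mulConv {f g : Lp ℂ 2 μ} (h : (f, g) ∈ (opA μ).graph) {k : K → ℂ}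
    (hk : Integrable k (mulMeasure μ))
    (hkl : Integrable (fun t => (Real.log (normAbs t) : ℂ) * k t) (mulMeasure μ)) :
    (mulConv μ k f,
      mulConv μ k g - mulConv μ (fun t => (Real.log (normAbs t) : ℂ) * k t) f) ∈
      (opA μ).graph := by
  rw [mulConv_apply hk, mulConv_apply hk, mulConv_apply hkl,
    ← integral_sub (integrable_smul_dilation hk g) (integrable_smul_dilation hkl f),
    ← integral_pair (g := fun t => k t • dilation μ t g -
        ((Real.log (normAbs t) : ℂ) * k t) • dilation μ t f) (integrable_smul_dilation hk f)
      ((integrable_smul_dilation hk g).sub (integrable_smul_dilation hkl f))]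
  refine integral_mem_of_isClosed isClosed_graph_opA ?_
  filter_upwards [ae_ne_zero_mulMeasure μ] with t ht
  have := (opA μ).graph.smul_mem (k t) (opA_graph_dilation h ht)
  rwa [Prod.smul_mk, smul_sub, smul_smul, mul_comm (k t)] at this

end OpA

/-! ### Elementary identities for the Fourier integral -/

noncomputable section FourierIntegral

variable {K : Type*} [Field K] [TopologicalSpace K] [IsLocalField K] [MeasurableSpace K]
  [BorelSpace K] {μ : Measure K} [μ.IsAddHaarMeasure] {ψ : AddChar K Circle}

theorem continuous_mul_apply : Continuous fun p : K × K => LinearMap.mul K K p.1 p.2 := by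
  simpa using continuous_mul

theorem continuous_fourierIntegral (hψ : Continuous ψ) {f : K → ℂ} (hf : Integrable f μ) :
    Continuous (Fourier.fourierIntegral ψ μ f) :=
  VectorFourier.fourierIntegral_continuous hψ continuous_mul_apply hf

theorem integrable_char_smul (hψ : Continuous ψ) {f : K → ℂ} (hf : Integrable f μ) (x : K) :
    Integrable (fun y => ψ (-(y * x)) • f y) μ :=
  (VectorFourier.fourierIntegral_convergent_iff hψ continuous_mul_apply x).2 hf

theorem fourierIntegral_congr_ae {f g : K → ℂ} (h : f =ᵐ[μ] g) :
    Fourier.fourierIntegral ψ μ f = Fourier.fourierIntegral ψ μ g :=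
  VectorFourier.fourierIntegral_congr_ae ψ μ _ h

theorem fourierIntegral_zero_apply (f : K → ℂ) :
    Fourier.fourierIntegral ψ μ f 0 = ∫ y, f y ∂μ := by
  simp [Fourier.fourierIntegral_def]

theorem fourierIntegral_comp_mul_left {t : K} (ht : t ≠ 0) (f : K → ℂ) (x : K) :
    Fourier.fourierIntegral ψ μ (fun y => f (t * y)) x =
      ((normAbs t)⁻¹ : ℝ) • Fourier.fourierIntegral ψ μ f (t⁻¹ * x) := by
  rw [Fourier.fourierIntegral_def, Fourier.fourierIntegral_def, ← integral_comp_mul_left' μ ht]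
  refine integral_congr_ae (Eventually.of_forall fun y => ?_)
  simp only
  congr 3
  field_simp

theorem integral_fourierIntegral_mul (hψ : Continuous ψ) {f g : K → ℂ} (hf : Integrable f μ)
    (hg : Integrable g μ) : ∫ x, Fourier.fourierIntegral ψ μ f x * g x ∂μ =
      ∫ y, f y * Fourier.fourierIntegral ψ μ g y ∂μ := by
  have h := VectorFourier.integral_fourierIntegral_smul_eq_flip (μ := μ) (ν := μ) hψ
    continuous_mul_apply hf hg
  rw [LinearMap.flip_mul] at h
  exact h

theorem integral_conj_fourierIntegral_mul (hψ : Continuous ψ) {f g : K → ℂ} (hf : Integrable f μ)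
    (hg : Integrable g μ) :
    ∫ x, (starRingEnd ℂ) (Fourier.fourierIntegral ψ μ f x) * g x ∂μ =
      ∫ y, (starRingEnd ℂ) (f y) * Fourier.fourierIntegral ψ μ g (-y) ∂μ := by
  have h := VectorFourier.integral_sesq_fourierIntegral_eq_neg_flip (μ := μ) (ν := μ)
    (innerSL ℂ (E := ℂ)) hψ continuous_mul_apply hf hg
  have h1 : ∀ x, VectorFourier.fourierIntegral ψ μ (-(LinearMap.mul K K).flip) g x =
      Fourier.fourierIntegral ψ μ g (-x) := by
    intro x
    rw [LinearMap.flip_mul]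
    simp [VectorFourier.fourierIntegral, Fourier.fourierIntegral_def]
  simp only [innerSL_apply_apply, h1, RCLike.inner_apply'] at h
  exact h

theorem fourierIntegral_conj_neg (f : K → ℂ) (x : K) :
    Fourier.fourierIntegral ψ μ (fun y => (starRingEnd ℂ) (f (-y))) x =
      (starRingEnd ℂ) (Fourier.fourierIntegral ψ μ f x) := by
  rw [Fourier.fourierIntegral_def, Fourier.fourierIntegral_def, ← integral_conj,
    ← integral_neg_eq_self]
  refine integral_congr_ae (Eventually.of_forall fun y => ?_)
  simp only [neg_neg, Circle.smul_def, smul_eq_mul, map_mul]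
  rw [← Circle.coe_inv_eq_conj, ← AddChar.map_neg_eq_inv]
  simp

theorem fourierIntegral_convolution (hψ : Continuous ψ) {f g : K → ℂ} (hf : Integrable f μ)
    (hg : Integrable g μ) (x : K) :
    Fourier.fourierIntegral ψ μ (convolution f g (ContinuousLinearMap.mul ℂ ℂ) μ) x =
      Fourier.fourierIntegral ψ μ f x * Fourier.fourierIntegral ψ μ g x := by
  have h := integral_convolution (ContinuousLinearMap.mul ℂ ℂ) (integrable_char_smul hψ hf x)
    (integrable_char_smul hψ hg x)
  rw [ContinuousLinearMap.mul_apply'] at h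
  rw [Fourier.fourierIntegral_def, Fourier.fourierIntegral_def, Fourier.fourierIntegral_def, ← h]
  refine integral_congr_ae (Eventually.of_forall fun y => ?_)
  simp only [convolution_def, ContinuousLinearMap.mul_apply', Circle.smul_def, smul_eq_mul]
  rw [← integral_const_mul]
  refine integral_congr_ae (Eventually.of_forall fun s => ?_)
  simp only
  have : ψ (-(y * x)) = ψ (-(s * x)) * ψ (-((y - s) * x)) := by
    rw [← AddChar.map_add_eq_mul]
    congr 1; ring
  rw [this, Circle.coe_mul]
  ring

end FourierIntegral

/-! ### Plancherel's theorem up to a constant, by a summability kernel -/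

noncomputable section Plancherel

variable {K : Type*} [Field K] [TopologicalSpace K] [IsLocalField K] [MeasurableSpace K]
  [BorelSpace K] {μ : Measure K} [μ.IsAddHaarMeasure] {ψ : AddChar K Circle}

/-- The autocorrelation of a function in `L² (K)`. -/
def autocorrelation (f : Lp ℂ 2 μ) (v : K) : ℂ :=
  inner ℂ (DomAddAct.mk (-v) +ᵥ f) f

theorem continuous_autocorrelation (f : Lp ℂ 2 μ) : Continuous (autocorrelation f) := by
  have : Fact ((2 : ℝ≥0∞) ≠ ∞) := ⟨by norm_num⟩
  have h : Continuous fun v : K => DomAddAct.mk (-v) +ᵥ f :=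
    (DomAddAct.continuous_mk.comp continuous_neg).vadd continuous_const
  exact h.inner continuous_const

theorem norm_autocorrelation_le (f : Lp ℂ 2 μ) (v : K) : ‖autocorrelation f v‖ ≤ ‖f‖ ^ 2 := by
  refine (norm_inner_le_norm _ _).trans (le_of_eq ?_)
  rw [DomAddAct.norm_vadd_Lp, sq]

theorem autocorrelation_zero (f : Lp ℂ 2 μ) : autocorrelation f 0 = ((‖f‖ ^ 2 : ℝ) : ℂ) := by
  rw [autocorrelation, neg_zero, DomAddAct.mk_zero, zero_vadd, inner_self_eq_norm_sq_to_K]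
  simp

/-- The inner product form makes the autocorrelation of an `L²` function continuous and bounded; the
convolution form shows that, for integrable `f`, its Fourier integral is `|f̂|²`. -/
theorem autocorrelation_eq_convolution (f : Lp ℂ 2 μ) : autocorrelation f =
    convolution f (fun y => (starRingEnd ℂ) (f (-y))) (ContinuousLinearMap.mul ℂ ℂ) μ := by
  funext v
  rw [autocorrelation, L2.inner_def, convolution_def]
  refine integral_congr_ae ?_
  filter_upwards [DomAddAct.vadd_Lp_ae_eq (DomAddAct.mk (-v)) f] with y hy
  rw [hy, RCLike.inner_apply, ContinuousLinearMap.mul_apply']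
  simp [sub_eq_add_neg, add_comm]

/-- A continuous positive function of total mass and Fourier integral of finite mass. -/
structure IsSummabilityKernel (ψ : AddChar K Circle) (μ : Measure K) (Φ : K → ℝ) : Prop where
  continuous : Continuous Φ
  nonneg : ∀ x, 0 ≤ Φ x
  le_one : ∀ x, Φ x ≤ 1
  map_zero : Φ 0 = 1
  integrable : Integrable Φ μ
  integrable_fourierIntegral : Integrable (Fourier.fourierIntegral ψ μ fun x => (Φ x : ℂ)) μ

variable {Φ : K → ℝ}

/-- Let `h` be the autocorrelation of `f`. Since `ĥ = |f̂|²`, the multiplication formula and a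
change of variables turn the integral into `∫ h(aⁿu) Φ̂(u) du`. Dominated convergence applies
because `h` is bounded and continuous with `h(0) = ‖f‖²`. -/
theorem tendsto_integral_summabilityKernel (hψ : Continuous ψ) (hΦ : IsSummabilityKernel ψ μ Φ)
    {a : K} (ha0 : a ≠ 0) (ha : Tendsto (fun n : ℕ => a ^ n) atTop (𝓝 0))
    {f : Lp ℂ 2 μ} (hf : Integrable f μ) :
    Tendsto (fun n : ℕ => ∫ x, Φ (a ^ n * x) * ‖Fourier.fourierIntegral ψ μ f x‖ ^ 2 ∂μ) atTop
      (𝓝 (‖f‖ ^ 2 * (∫ u, Fourier.fourierIntegral ψ μ (fun x => (Φ x : ℂ)) u ∂μ).re)) := by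
  set Φh := Fourier.fourierIntegral ψ μ fun x => (Φ x : ℂ) with hΦh
  have hf' : Integrable (fun y => (starRingEnd ℂ) (f (-y))) μ :=
    (Complex.conjCLE : ℂ →L[ℝ] ℂ).integrable_comp hf.comp_neg
  have hhi : Integrable (autocorrelation f) μ := by
    rw [autocorrelation_eq_convolution]
    exact hf.integrable_convolution _ hf'
  have hhF : ∀ x, Fourier.fourierIntegral ψ μ (autocorrelation f) x =
      ((‖Fourier.fourierIntegral ψ μ f x‖ ^ 2 : ℝ) : ℂ) := by
    intro x
    rw [autocorrelation_eq_convolution, fourierIntegral_convolution hψ hf hf',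
      fourierIntegral_conj_neg, Complex.mul_conj, Complex.normSq_eq_norm_sq]
  have hval : ∀ n : ℕ, ((∫ x, Φ (a ^ n * x) * ‖Fourier.fourierIntegral ψ μ f x‖ ^ 2 ∂μ : ℝ) : ℂ) =
      ∫ u, autocorrelation f (a ^ n * u) * Φh u ∂μ := by
    intro n
    have han : a ^ n ≠ 0 := pow_ne_zero n ha0
    have hΦn : Integrable (fun x => (Φ (a ^ n * x) : ℂ)) μ :=
      integrable_comp_mul_left μ han (f := fun x => (Φ x : ℂ)) hΦ.integrable.ofReal
    calc ((∫ x, Φ (a ^ n * x) * ‖Fourier.fourierIntegral ψ μ f x‖ ^ 2 ∂μ : ℝ) : ℂ)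
        = ∫ x, Fourier.fourierIntegral ψ μ (autocorrelation f) x * (Φ (a ^ n * x) : ℂ) ∂μ := by
          rw [← integral_complex_ofReal]
          refine integral_congr_ae (Eventually.of_forall fun x => ?_)
          simp only
          rw [hhF, Complex.ofReal_mul, mul_comm]
      _ = ∫ v, autocorrelation f v *
            Fourier.fourierIntegral ψ μ (fun x => (Φ (a ^ n * x) : ℂ)) v ∂μ :=
          integral_fourierIntegral_mul hψ hhi hΦn
      _ = ((normAbs (a ^ n))⁻¹ : ℝ) • ∫ v, autocorrelation f v * Φh ((a ^ n)⁻¹ * v) ∂μ := by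
          rw [← integral_smul]
          refine integral_congr_ae (Eventually.of_forall fun v => ?_)
          simp only
          rw [fourierIntegral_comp_mul_left han (fun x => (Φ x : ℂ)), mul_smul_comm]
      _ = _ := by
          rw [← integral_comp_mul_left' μ han]
          simp_rw [inv_mul_cancel_left₀ han]
  have hlim : Tendsto (fun n : ℕ => ∫ u, autocorrelation f (a ^ n * u) * Φh u ∂μ) atTop
      (𝓝 (∫ u, autocorrelation f 0 * Φh u ∂μ)) := by
    refine tendsto_integral_of_dominated_convergence (fun u => ‖f‖ ^ 2 * ‖Φh u‖) ?_
      (hΦ.integrable_fourierIntegral.norm.const_mul _) ?_ ?_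
    · intro n
      exact ((continuous_autocorrelation f).comp (by fun_prop)).aestronglyMeasurable.mul
        hΦ.integrable_fourierIntegral.1
    · intro n
      refine Eventually.of_forall fun u => ?_
      rw [norm_mul]
      gcongr
      exact norm_autocorrelation_le f _
    · refine Eventually.of_forall fun u => ?_
      refine Tendsto.mul_const _ ?_
      have : Tendsto (fun n : ℕ => a ^ n * u) atTop (𝓝 0) := by
        simpa using ha.mul_const u
      exact ((continuous_autocorrelation f).tendsto 0).comp this
  simp_rw [← hval] at hlim
  rw [integral_const_mul, autocorrelation_zero] at hlim
  have h := (Complex.continuous_re.tendsto _).comp hlim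
  rw [Complex.re_ofReal_mul] at h
  exact h

/-- As `Φ(aⁿx) → 1`, Fatou's lemma first gives `f̂ ∈ L²`. Then `|f̂|²` is a dominating function, and
the limit is identified with `∫ |f̂|²`. -/
theorem memLp_fourierIntegral_and_integral_eq (hψ : Continuous ψ)
    (hΦ : IsSummabilityKernel ψ μ Φ) {f : Lp ℂ 2 μ} (hf : Integrable f μ) :
    MemLp (Fourier.fourierIntegral ψ μ f) 2 μ ∧
      ∫ x, ‖Fourier.fourierIntegral ψ μ f x‖ ^ 2 ∂μ =
        ‖f‖ ^ 2 * (∫ u, Fourier.fourierIntegral ψ μ (fun x => (Φ x : ℂ)) u ∂μ).re := by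
  obtain ⟨a, ha0, -, -, ha⟩ := exists_normAbs_lt_one_and_tendsto K
  have hlim := tendsto_integral_summabilityKernel hψ hΦ ha0 ha hf
  set c := ‖f‖ ^ 2 * (∫ u, Fourier.fourierIntegral ψ μ (fun x => (Φ x : ℂ)) u ∂μ).re
  set fh := Fourier.fourierIntegral ψ μ f
  have hfhc : Continuous fh := continuous_fourierIntegral hψ hf
  have hΦlim : ∀ x : K, Tendsto (fun n : ℕ => Φ (a ^ n * x)) atTop (𝓝 1) := by
    intro x
    have : Tendsto (fun n : ℕ => a ^ n * x) atTop (𝓝 0) := by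
      simpa using ha.mul_const x
    rw [← hΦ.map_zero]
    exact (hΦ.continuous.tendsto 0).comp this
  have hint : ∀ n : ℕ, Integrable (fun x => Φ (a ^ n * x) * ‖fh x‖ ^ 2) μ := by
    intro n
    refine (integrable_comp_mul_left μ (pow_ne_zero n ha0) hΦ.integrable).mul_bdd
      (c := (∫ y, ‖f y‖ ∂μ) ^ 2) (hfhc.norm.pow 2).aestronglyMeasurable
      (Eventually.of_forall fun x => ?_)
    rw [norm_pow, norm_norm]
    gcongr
    exact Fourier.norm_fourierIntegral_le_integral_norm ψ μ f x
  have hfatou : ∫⁻ x, ENNReal.ofReal (‖fh x‖ ^ 2) ∂μ ≤ ENNReal.ofReal c := by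
    calc ∫⁻ x, ENNReal.ofReal (‖fh x‖ ^ 2) ∂μ
        = ∫⁻ x, liminf (fun n : ℕ => ENNReal.ofReal (Φ (a ^ n * x) * ‖fh x‖ ^ 2)) atTop ∂μ := by
          refine lintegral_congr fun x => (Tendsto.liminf_eq ?_).symm
          refine ENNReal.tendsto_ofReal ?_
          simpa using (hΦlim x).mul_const (‖fh x‖ ^ 2)
      _ ≤ liminf (fun n : ℕ => ∫⁻ x, ENNReal.ofReal (Φ (a ^ n * x) * ‖fh x‖ ^ 2) ∂μ) atTop :=
          lintegral_liminf_le fun n => by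
            have := hΦ.continuous
            fun_prop
      _ = ENNReal.ofReal c := by
          refine Tendsto.liminf_eq ((ENNReal.tendsto_ofReal hlim).congr fun n => ?_)
          exact ofReal_integral_eq_lintegral_ofReal (hint n)
            (Eventually.of_forall fun x => mul_nonneg (hΦ.nonneg _) (sq_nonneg _))
  have hsq : Integrable (fun x => ‖fh x‖ ^ 2) μ := by
    refine ⟨(hfhc.norm.pow 2).aestronglyMeasurable, ?_⟩
    rw [hasFiniteIntegral_iff_ofReal (Eventually.of_forall fun x => sq_nonneg _)]
    exact hfatou.trans_lt ENNReal.ofReal_lt_top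
  refine ⟨(memLp_two_iff_integrable_sq_norm hfhc.aestronglyMeasurable).2 hsq, ?_⟩
  refine tendsto_nhds_unique ?_ hlim
  refine tendsto_integral_of_dominated_convergence (fun x => ‖fh x‖ ^ 2)
    (fun n => (hint n).1) hsq (fun n => Eventually.of_forall fun x => ?_)
    (Eventually.of_forall fun x => ?_)
  · rw [Real.norm_of_nonneg (mul_nonneg (hΦ.nonneg _) (sq_nonneg _))]
    exact mul_le_of_le_one_left (sq_nonneg _) (hΦ.le_one _)
  · simpa using (hΦlim x).mul_const (‖fh x‖ ^ 2)

/-- The Plancherel theorem, up to the normalization of the measure. -/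
theorem exists_plancherel_constant (hψ : Continuous ψ) (hΦ : IsSummabilityKernel ψ μ Φ) :
    ∃ c : ℝ, 0 < c ∧ ∀ f : Lp ℂ 2 μ, Integrable f μ →
      MemLp (Fourier.fourierIntegral ψ μ f) 2 μ ∧
      ∫ x, ‖Fourier.fourierIntegral ψ μ f x‖ ^ 2 ∂μ = c * ‖f‖ ^ 2 := by
  refine ⟨(∫ u, Fourier.fourierIntegral ψ μ (fun x => (Φ x : ℂ)) u ∂μ).re, ?_, fun f hf => ?_⟩
  swap
  · rw [mul_comm]
    exact memLp_fourierIntegral_and_integral_eq hψ hΦ hf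
  have hΦ2 : MemLp (fun x => (Φ x : ℂ)) 2 μ := by
    have hcont : Continuous fun x => (Φ x : ℂ) := Complex.continuous_ofReal.comp hΦ.continuous
    rw [memLp_two_iff_integrable_sq_norm hcont.aestronglyMeasurable]
    refine hΦ.integrable.mono' (hcont.norm.pow 2).aestronglyMeasurable
      (Eventually.of_forall fun x => ?_)
    rw [norm_pow, norm_norm, Complex.norm_real, Real.norm_of_nonneg (hΦ.nonneg x)]
    exact pow_le_of_le_one (hΦ.nonneg x) (hΦ.le_one x) two_ne_zero
  have hae := hΦ2.coeFn_toLp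
  have hi : Integrable hΦ2.toLp μ := (integrable_congr hae).2 hΦ.integrable.ofReal
  obtain ⟨h1, h2⟩ := memLp_fourierIntegral_and_integral_eq hψ hΦ hi
  have hc := continuous_fourierIntegral hψ hi
  -- Positivity of the constant comes from applying the identity to `Φ` itself: `Φ̂` is continuous
  -- and `Φ̂(0) = ∫ Φ > 0`.
  have hpos : 0 < ∫ x, ‖Fourier.fourierIntegral ψ μ hΦ2.toLp x‖ ^ 2 ∂μ := by
    have h0 : Fourier.fourierIntegral ψ μ hΦ2.toLp 0 ≠ 0 := by
      rw [fourierIntegral_congr_ae hae, fourierIntegral_zero_apply, integral_complex_ofReal]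
      have hΦpos : 0 < ∫ x, Φ x ∂μ := integral_pos_of_integrable_nonneg_nonzero
        (x := 0) hΦ.continuous hΦ.integrable hΦ.nonneg (by rw [hΦ.map_zero]; exact one_ne_zero)
      exact_mod_cast hΦpos.ne'
    exact integral_pos_of_integrable_nonneg_nonzero (x := 0) (hc.norm.pow 2)
      ((memLp_two_iff_integrable_sq_norm hc.aestronglyMeasurable).1 h1) (fun x => sq_nonneg _)
      (by simpa using h0)
  rw [h2] at hpos
  exact pos_of_mul_pos_right hpos (sq_nonneg _)

end Plancherel

/-! ### Characters of real vector spaces and Fourier transforms of Gaussians -/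

section ContinuousCharacters

/-- Integrating the functional equation over an interval with `∫₀^δ g ≠ 0` expresses `g` through its
primitive. A merely continuous `g` is therefore differentiable, with `g' = b g`. -/
theorem exists_eq_cexp_mul {g : ℝ → ℂ} (hg : Continuous g) (hadd : ∀ s t, g (s + t) = g s * g t)
    (h0 : g 0 = 1) : ∃ b : ℂ, ∀ t : ℝ, g t = Complex.exp (b * t) := by
  let G : ℝ → ℂ := fun t => ∫ s in (0 : ℝ)..t, g s
  have hG : ∀ t, HasDerivAt G (g t) t := fun t =>
    intervalIntegral.integral_hasDerivAt_right (hg.intervalIntegrable _ _)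
      (hg.stronglyMeasurableAtFilter _ _) hg.continuousAt
  obtain ⟨δ, hδ⟩ : ∃ δ, G δ ≠ 0 := by
    by_contra! h
    have h1 : HasDerivAt G 0 0 := by
      have : G = fun _ => 0 := funext h
      rw [this]
      exact hasDerivAt_const _ _
    exact one_ne_zero (h0 ▸ (hG 0).unique h1)
  have hshift : ∀ t, g t = (G (t + δ) - G t) / G δ := by
    intro t
    rw [eq_div_iff hδ]
    simp only [G]
    rw [intervalIntegral.integral_interval_sub_left (hg.intervalIntegrable _ _)
      (hg.intervalIntegrable _ _), ← intervalIntegral.integral_const_mul]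
    simp_rw [← hadd]
    rw [intervalIntegral.integral_comp_add_left, add_zero]
  let b : ℂ := (g δ - 1) / G δ
  have hderiv : ∀ t, HasDerivAt g (g t * b) t := by
    intro t
    have h1 : HasDerivAt (fun t => (G (t + δ) - G t) / G δ) ((g (t + δ) - g t) / G δ) t :=
      (((hG (t + δ)).comp_add_const t δ).sub (hG t)).div_const _
    have h2 : (fun t => (G (t + δ) - G t) / G δ) = g := funext fun t => (hshift t).symm
    rw [h2] at h1
    convert h1 using 1
    rw [hadd]
    simp only [b]
    ring
  refine ⟨b, fun t => ?_⟩
  have hexp : ∀ s : ℝ, HasDerivAt (fun s : ℝ => Complex.exp (-(b * s))) (Complex.exp (-(b * s)) * -b) s := by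
    intro s
    have h1 : HasDerivAt (fun s : ℝ => -(b * (s : ℂ))) (-b) s := by
      have h2 := ((Complex.ofRealCLM.hasDerivAt (x := s)).const_mul b).neg
      simp only [Complex.ofRealCLM_apply, Complex.ofReal_one, mul_one] at h2
      exact h2
    exact h1.cexp
  have hconst : ∀ s : ℝ, HasDerivAt (fun s : ℝ => g s * Complex.exp (-(b * s))) 0 s := by
    intro s
    have h1 := (hderiv s).mul (hexp s)
    rwa [show g s * b * Complex.exp (-(b * s)) + g s * (Complex.exp (-(b * s)) * -b) = 0 by
      ring] at h1
  have h := is_const_of_deriv_eq_zero (fun s => (hconst s).differentiableAt)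
    (fun s => (hconst s).deriv) t 0
  simp only [h0, Complex.ofReal_zero, mul_zero, neg_zero, Complex.exp_zero, mul_one] at h
  rw [Complex.exp_neg] at h
  have hne := Complex.exp_ne_zero (b * t)
  field_simp at h
  exact h

/-- A continuous unitary character of a real vector space is the exponential of a linear form. -/
theorem exists_eq_cexp_inner {V : Type*} [NormedAddCommGroup V] [InnerProductSpace ℝ V]
    [FiniteDimensional ℝ V] {χ : AddChar V Circle} (hχ : Continuous χ) :
    ∃ w : V, ∀ v, (χ v : ℂ) = Complex.exp ((inner ℝ w v : ℝ) * Complex.I) := by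
  have h1 : ∀ v : V, ∃ r : ℝ, ∀ t : ℝ, (χ (t • v) : ℂ) = Complex.exp ((t * r : ℝ) * Complex.I) := by
    intro v
    obtain ⟨b, hb⟩ := exists_eq_cexp_mul (g := fun t : ℝ => (χ (t • v) : ℂ))
      (by fun_prop) (fun s t => by simp [add_smul, AddChar.map_add_eq_mul]) (by simp)
    have hre : b.re = 0 := by
      have h := congrArg norm (hb 1)
      rw [Circle.norm_coe, Complex.norm_exp] at h
      simpa using h.symm
    refine ⟨b.im, fun t => ?_⟩
    rw [hb t]
    congr 1
    apply Complex.ext <;> simp [hre, mul_comm]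
  choose r hr using h1
  -- The slope is determined by the derivative at `0`. This uniqueness makes the chosen slopes
  -- additive and homogeneous in `v`.
  have huniq : ∀ x y : ℝ, (∀ t : ℝ, Complex.exp ((t * x : ℝ) * Complex.I) =
      Complex.exp ((t * y : ℝ) * Complex.I)) → x = y := by
    intro x y h
    have hd : ∀ z : ℝ, HasDerivAt (fun t : ℝ => Complex.exp ((t * z : ℝ) * Complex.I))
        (z * Complex.I) 0 := by
      intro z
      have h1 : HasDerivAt (fun t : ℝ => ((t * z : ℝ) : ℂ) * Complex.I) (z * Complex.I) 0 := by
        have h2 : HasDerivAt (fun t : ℝ => t * z) z 0 := by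
          simpa using (hasDerivAt_id (0 : ℝ)).mul_const z
        exact h2.ofReal_comp.mul_const _
      simpa using h1.cexp
    have h3 := hd x
    rw [funext h] at h3
    have h4 := h3.unique (hd y)
    exact_mod_cast mul_right_cancel₀ Complex.I_ne_zero h4
  let ℓ : V →ₗ[ℝ] ℝ :=
    { toFun := r
      map_add' := fun v w => huniq _ _ fun t => by
        rw [← hr, smul_add, AddChar.map_add_eq_mul, Circle.coe_mul, hr, hr, ← Complex.exp_add]
        congr 1; push_cast; ring
      map_smul' := fun c v => huniq _ _ fun t => by
        rw [← hr, smul_smul, hr]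
        congr 1; simp only [RingHom.id_apply, smul_eq_mul]; push_cast; ring }
  refine ⟨(InnerProductSpace.toDual ℝ V).symm ℓ.toContinuousLinearMap, fun v => ?_⟩
  rw [InnerProductSpace.toDual_symm_apply]
  have h := hr v 1
  rw [one_smul, one_mul] at h
  exact h

/-- The Fourier transform of a Gaussian depends only on the norm of the frequency. Thus `Λ` need
only scale norms, and the result is again a Gaussian in `w`. -/
theorem integrable_fourier_gaussian {V : Type*} [NormedAddCommGroup V] [InnerProductSpace ℝ V]
    [FiniteDimensional ℝ V] [MeasurableSpace V] [BorelSpace V] (ν : Measure V) [ν.IsAddHaarMeasure]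
    {m : ℝ} (hm : 0 < m) {Λ : V → V} (hΛ : ∀ w, ‖Λ w‖ = m * ‖w‖) :
    Integrable (fun w => ∫ v, Complex.exp ((inner ℝ (Λ w) v : ℝ) * Complex.I) *
      (Real.exp (-‖v‖ ^ 2) : ℂ) ∂ν) ν := by
  obtain ⟨c, hc⟩ : ∃ c : ℝ≥0∞, c ≠ ∞ ∧ ν = c • (volume : Measure V) :=
    ⟨_, ENNReal.coe_ne_top, Measure.isAddLeftInvariant_eq_smul ν volume⟩
  have h1 : ∀ w, ∫ v, Complex.exp ((inner ℝ (Λ w) v : ℝ) * Complex.I) *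
      (Real.exp (-‖v‖ ^ 2) : ℂ) ∂(volume : Measure V) =
      (Real.pi / (1 : ℂ)) ^ (Module.finrank ℝ V / 2 : ℂ) *
        Complex.exp (-((m ^ 2 / 4 : ℝ) : ℂ) * ‖w‖ ^ 2 + 0 * (inner ℝ (0 : V) w : ℝ)) := by
    intro w
    have h := GaussianFourier.integral_cexp_neg_mul_sq_norm_add (b := 1) (by simp) Complex.I (Λ w)
    have h2 : Complex.exp (-((m ^ 2 / 4 : ℝ) : ℂ) * ‖w‖ ^ 2 + 0 * (inner ℝ (0 : V) w : ℝ)) =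
        Complex.exp (Complex.I ^ 2 * ‖Λ w‖ ^ 2 / (4 * 1)) := by
      rw [hΛ, Complex.I_sq]
      congr 1; push_cast; ring
    rw [h2, ← h]
    refine integral_congr_ae (Eventually.of_forall fun v => ?_)
    simp only
    rw [Complex.ofReal_exp, ← Complex.exp_add]
    congr 1; push_cast; ring
  rw [hc.2]
  simp_rw [integral_smul_measure, h1]
  refine Integrable.smul _ (Integrable.smul_measure (Integrable.const_mul ?_ _) hc.1)
  exact GaussianFourier.integrable_cexp_neg_mul_sq_norm_add (by rw [Complex.ofReal_re]; positivity) 0 0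

end ContinuousCharacters

/-! ### Summability kernels: Gaussians, and indicators of compact open subgroups -/

section SummabilityKernel

variable {K : Type*} [Field K] [TopologicalSpace K] [IsLocalField K] [MeasurableSpace K]
  [BorelSpace K] (μ : Measure K) [μ.IsAddHaarMeasure] {ψ : AddChar K Circle}

/-- The kernel is the Gaussian. The character is `exp(i⟨w₀, ·⟩)`, and `hR` rewrites `⟨w₀, ux⟩` as
the inner product of `u` with a vector of norm `‖w₀‖‖x‖` (`w₀x` over `ℝ`, `w₀x̄` over `ℂ`), so `Φ̂`
is a Gaussian too. -/
theorem exists_isSummabilityKernel_of_ringEquiv {R : Type*} [NormedField R] [InnerProductSpace ℝ R]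
    [FiniteDimensional ℝ R] [MeasurableSpace R] [BorelSpace R]
    (hR : ∀ w x : R, ∃ y : R, ‖y‖ = ‖w‖ * ‖x‖ ∧ ∀ u : R, inner ℝ w (u * x) = inner ℝ y u)
    (hψ : Continuous ψ) (hψ1 : ψ ≠ 1) (e : K ≃+* R) (he : IsHomeomorph e) :
    ∃ Φ : K → ℝ, IsSummabilityKernel ψ μ Φ := by
  let eh : K ≃ₜ R := he.homeomorph e
  have heh : ∀ x, eh x = e x := fun x => rfl
  have hsymm : Continuous e.symm := by
    have h : (eh.symm : R → K) = e.symm := by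
      funext v
      exact eh.symm_apply_eq.2 (e.apply_symm_apply v).symm
    exact h ▸ eh.symm.continuous
  let ν : Measure R := μ.map eh
  have hν : ν.IsAddHaarMeasure :=
    AddEquiv.isAddHaarMeasure_map μ e.toAddEquiv eh.continuous hsymm
  have hme : MeasurableEmbedding eh := eh.measurableEmbedding
  let χ : AddChar R Circle := ψ.compAddMonoidHom (e.symm : R →+ K)
  have hχv : ∀ v, χ v = ψ (e.symm v) := fun v => rfl
  have hχ : Continuous χ := hψ.comp hsymm
  obtain ⟨w₀, hw₀⟩ := exists_eq_cexp_inner hχ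
  have hw₀0 : w₀ ≠ 0 := by
    rintro rfl
    apply hψ1
    ext x
    have := hw₀ (e x)
    rw [hχv, RingEquiv.symm_apply_apply] at this
    simpa using this
  choose y hy1 hy2 using hR w₀
  have hgi : Integrable (fun v : R => Real.exp (-‖v‖ ^ 2)) ν := by
    obtain ⟨c, hc⟩ : ∃ c : ℝ≥0∞, c ≠ ∞ ∧ ν = c • (volume : Measure R) :=
      ⟨_, ENNReal.coe_ne_top, Measure.isAddLeftInvariant_eq_smul ν volume⟩
    rw [hc.2]
    refine Integrable.smul_measure ?_ hc.1
    have h := (GaussianFourier.integrable_cexp_neg_mul_sq_norm_add (V := R) (b := 1) (by simp) 0 0).re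
    refine h.congr (Eventually.of_forall fun v => ?_)
    have : (-1 * (‖v‖ : ℂ) ^ 2 + 0 * ((inner ℝ (0 : R) v : ℝ) : ℂ)) = ((-‖v‖ ^ 2 : ℝ) : ℂ) := by
      push_cast; ring
    simp only
    rw [this, ← Complex.ofReal_exp]
    rfl
  refine ⟨fun x => Real.exp (-‖eh x‖ ^ 2), ⟨?_, ?_, ?_, ?_, ?_, ?_⟩⟩
  · have := eh.continuous
    fun_prop
  · intro x; positivity
  · intro x
    rw [Real.exp_le_one_iff]
    exact neg_nonpos.2 (sq_nonneg _)
  · simp [heh]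
  · exact (hme.integrable_map_iff (μ := μ)).1 hgi
  · have hΛ : ∀ w : R, ‖-(y w)‖ = ‖w₀‖ * ‖w‖ := fun w => by rw [norm_neg, hy1]
    have h := integrable_fourier_gaussian ν (norm_pos_iff.2 hw₀0) hΛ
    refine ((hme.integrable_map_iff (μ := μ)).1 h).congr (Eventually.of_forall fun x => ?_)
    rw [Function.comp_apply, Fourier.fourierIntegral_def, hme.integral_map]
    refine integral_congr_ae (Eventually.of_forall fun v => ?_)
    simp only [Circle.smul_def, smul_eq_mul]
    congr 1
    have h2 := hw₀ (-(e v * e x))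
    rw [hχv, map_neg, map_mul, RingEquiv.symm_apply_apply, RingEquiv.symm_apply_apply] at h2
    rw [h2, inner_neg_right, hy2, inner_neg_left]
    rfl

/-- On the compact part of a large ball outside an open `V ∋ 0` the absolute value has a positive
minimum, so small balls lie in `V`. -/
theorem exists_forall_normAbs_lt_mem {U : Set K} (hU : U ∈ 𝓝 0) :
    ∃ δ > 0, ∀ x : K, normAbs x < δ → x ∈ U := by
  obtain ⟨C, hC, hCb⟩ := exists_isCompact_normAbs_le_one (K := K)
  obtain ⟨V, hVU, hV, hV0⟩ := mem_nhds_iff.1 hU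
  rcases (C \ V).eq_empty_or_nonempty with h | h
  · refine ⟨1, one_pos, fun x hx => hVU ?_⟩
    exact Set.sdiff_eq_empty.1 h (hCb hx.le)
  · obtain ⟨x, hx, hmin⟩ := (hC.diff hV).exists_isMinOn h
      (continuousOn_normAbs.mono fun x hx h0 => hx.2 (by rwa [Set.mem_singleton_iff.1 h0]))
    have hx0 : x ≠ 0 := fun h0 => hx.2 (h0 ▸ hV0)
    refine ⟨min 1 (normAbs x), lt_min one_pos (normAbs_pos hx0), fun z hz => hVU ?_⟩
    by_contra hzV
    have h1 : z ∈ C \ V := ⟨hCb ((hz.trans_le (min_le_left _ _)).le), hzV⟩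
    exact absurd (hmin h1) (not_le.2 (hz.trans_le (min_le_right _ _)))

/-- Take `Φ = 1_O`. Translation by `y ∈ O` fixes `Φ` and multiplies `Φ̂(x)` by `ψ(yx)`. If `ψ(z) ≠
1` and `|x|` is so large that `z/x ∈ O`, then `Φ̂(x) = 0`. Hence `Φ̂` is bounded and supported in a
ball, which has finite measure. -/
theorem exists_isSummabilityKernel_of_addSubgroup (hψ : Continuous ψ) (hψ1 : ψ ≠ 1)
    (O : AddSubgroup K) (hO : IsOpen (O : Set K)) (hOc : IsCompact (O : Set K)) :
    ∃ Φ : K → ℝ, IsSummabilityKernel ψ μ Φ := by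
  let Φ : K → ℝ := (O : Set K).indicator 1
  have hcont : Continuous Φ := IsClopen.continuous_indicator ⟨hOc.isClosed, hO⟩ continuous_one
  have hint : Integrable Φ μ :=
    (integrable_indicator_iff hO.measurableSet).2 (integrableOn_const hOc.measure_ne_top)
  have hle : ∀ x, Φ x ≤ 1 := Set.indicator_le' (fun _ _ => le_rfl) fun _ _ => zero_le_one
  have hge : ∀ x, 0 ≤ Φ x := Set.indicator_nonneg fun _ _ => zero_le_one
  refine ⟨Φ, hcont, hge, hle, Set.indicator_of_mem O.zero_mem _, hint, ?_⟩
  obtain ⟨z, hz⟩ : ∃ z, ψ z ≠ 1 := by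
    by_contra! h
    exact hψ1 (by ext x; simp [h])
  obtain ⟨δ, hδ, hδO⟩ := exists_forall_normAbs_lt_mem (hO.mem_nhds O.zero_mem)
  have hvanish : ∀ x, x ∉ {x : K | normAbs x ≤ normAbs z / δ} →
      Fourier.fourierIntegral ψ μ (fun x => (Φ x : ℂ)) x = 0 := by
    intro x hx
    simp only [Set.mem_ofPred_eq, not_le] at hx
    have hx0 : x ≠ 0 := by
      rintro rfl
      rw [normAbs_zero] at hx
      exact absurd hx (not_lt.2 (div_nonneg (normAbs_nonneg z) hδ.le))
    have hy : z / x ∈ O := by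
      apply hδO
      rw [div_eq_mul_inv, normAbs_mul, normAbs_inv, ← div_eq_mul_inv, div_lt_iff₀ (normAbs_pos hx0)]
      rw [div_lt_iff₀ hδ] at hx
      linarith
    have hshift : (fun y => (Φ y : ℂ)) ∘ (fun y => y + z / x) = fun y => (Φ y : ℂ) := by
      funext y
      simp only [Function.comp_apply, Φ]
      congr 1
      by_cases hyO : y ∈ O
      · rw [Set.indicator_of_mem (O.add_mem hyO hy), Set.indicator_of_mem hyO]
        rfl
      · rw [Set.indicator_of_notMem (fun h => hyO ((O.add_mem_cancel_right hy).1 h)),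
          Set.indicator_of_notMem hyO]
    have h := congrFun (Fourier.fourierIntegral_comp_add_right ψ μ (fun y => (Φ y : ℂ)) (z / x)) x
    rw [hshift, div_mul_cancel₀ z hx0, Circle.smul_def, smul_eq_mul] at h
    by_contra hne
    refine hz (Circle.ext ?_)
    rw [Circle.coe_one]
    exact (mul_right_cancel₀ hne ((one_mul _).trans h)).symm
  rw [← integrableOn_iff_integrable_of_support_subset (s := {x : K | normAbs x ≤ normAbs z / δ})
    fun x hx => not_imp_comm.1 (hvanish x) hx]
  refine Measure.integrableOn_of_bounded (measure_normAbs_le_lt_top μ _).ne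
    (continuous_fourierIntegral hψ hint.ofReal).aestronglyMeasurable
    (Eventually.of_forall fun x => Fourier.norm_fourierIntegral_le_integral_norm ψ μ _ x)

theorem exists_isSummabilityKernel (hψ : Continuous ψ) (hψ1 : ψ ≠ 1) :
    ∃ Φ : K → ℝ, IsSummabilityKernel ψ μ Φ := by
  obtain ⟨e, he⟩ | ⟨e, he⟩ | ⟨_, _⟩ :=
    IsLocalField.real_or_complex_or_nonarchimedean (K := K)
  · refine exists_isSummabilityKernel_of_ringEquiv μ (fun w x => ⟨w * x, norm_mul w x, fun u => ?_⟩)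
      hψ hψ1 e he
    simp only [RCLike.inner_apply, conj_trivial]
    ring
  · refine exists_isSummabilityKernel_of_ringEquiv μ
      (fun w x => ⟨w * (starRingEnd ℂ) x, by simp, fun u => ?_⟩) hψ hψ1 e he
    simp only [Complex.inner, map_mul, Complex.conj_conj]
    congr 1
    ring
  · let O : AddSubgroup K := (ValuativeRel.valuation K).integer.toAddSubgroup
    have hO : (O : Set K) = {x | ValuativeRel.valuation K x ≤ 1} := rfl
    refine exists_isSummabilityKernel_of_addSubgroup μ hψ hψ1 O
      (AddSubgroup.isOpen_of_mem_nhds O (g := 0) ?_) ?_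
    · rw [hO]
      exact (IsValuativeTopology.hasBasis_nhds_zero' K).mem_iff.2
        ⟨1, one_ne_zero, fun x hx => (show ValuativeRel.valuation K x < 1 from hx).le⟩
    · rw [hO]
      exact IsNonarchimedeanLocalField.isCompact_closedBall K 1

end SummabilityKernel

/-! ### The Fourier transform as a bounded operator on `L²` -/

noncomputable section FourierOperator

variable {K : Type*} [Field K] [TopologicalSpace K] [IsLocalField K] [MeasurableSpace K]
  [BorelSpace K] {μ : Measure K} [μ.IsAddHaarMeasure] {ψ : AddChar K Circle}

theorem dense_integrable : Dense {f : Lp ℂ 2 μ | Integrable f μ} := by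
  intro f
  rw [Metric.mem_closure_iff]
  intro ε hε
  obtain ⟨g, hg, hgcont, hgc, hfg⟩ := exists_hasCompactSupport_norm_sub_le f (half_pos hε)
  refine ⟨hg.toLp, (integrable_congr hg.coeFn_toLp).2 (hgcont.integrable_of_hasCompactSupport hgc),
    ?_⟩
  rw [dist_eq_norm]
  linarith

theorem integrable_coe_dilation {f : Lp ℂ 2 μ} (hf : Integrable f μ) {t : K} (ht : t ≠ 0) :
    Integrable (dilation μ t f) μ :=
  (integrable_congr (coeFn_dilation ht f)).2 ((integrable_comp_mul_left μ ht hf).const_mul _)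

/-- `F` is the bounded operator on `L²` which is given by the Fourier integral on `L¹ ∩ L²`, and
multiplies norms by `√c`. -/
structure IsFourierOperator (ψ : AddChar K Circle) (μ : Measure K) [μ.IsAddHaarMeasure] (c : ℝ)
    (F : Lp ℂ 2 μ →L[ℂ] Lp ℂ 2 μ) : Prop where
  pos : 0 < c
  memLp : ∀ f : Lp ℂ 2 μ, Integrable f μ → MemLp (Fourier.fourierIntegral ψ μ f) 2 μ
  ae_eq : ∀ f : Lp ℂ 2 μ, Integrable f μ → F f =ᵐ[μ] Fourier.fourierIntegral ψ μ f
  norm_sq : ∀ f : Lp ℂ 2 μ, ‖F f‖ ^ 2 = c * ‖f‖ ^ 2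

/-- Plancherel makes the Fourier integral bounded by `√c` on the dense subspace `L¹ ∩ L²`, so it
extends by continuity. -/
theorem exists_isFourierOperator (hψ : Continuous ψ) (hψ1 : ψ ≠ 1) :
    ∃ (c : ℝ) (F : Lp ℂ 2 μ →L[ℂ] Lp ℂ 2 μ), IsFourierOperator ψ μ c F := by
  obtain ⟨Φ, hΦ⟩ := exists_isSummabilityKernel μ hψ hψ1
  obtain ⟨c, hc, hP⟩ := exists_plancherel_constant hψ hΦ
  let T := fourierL1L2 ψ hψ μ
  have hT : ∀ f : Lp ℂ 2 μ, Integrable f μ → f ∈ T.domain := fun f hf => ⟨hf, (hP f hf).1⟩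
  have hTae : ∀ f : T.domain, T f =ᵐ[μ] Fourier.fourierIntegral ψ μ (f : Lp ℂ 2 μ) :=
    fun f => f.2.2.coeFn_toLp
  have hnormsq : ∀ f : T.domain, ‖T f‖ ^ 2 = c * ‖(f : Lp ℂ 2 μ)‖ ^ 2 := fun f => by
    rw [norm_sq_eq_integral_of_ae_eq (hTae f), (hP f f.2.1).2]
  have hnorm : ∀ f : T.domain, ‖T.toFun f‖ ≤ √c * ‖T.domain.subtype f‖ := fun f => by
    refine abs_le_of_sq_le_sq' ?_ (by positivity) |>.2
    rw [mul_pow, Real.sq_sqrt hc.le]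
    exact (hnormsq f).le
  have hdense : DenseRange T.domain.subtype := by
    rw [DenseRange]
    refine dense_integrable.mono fun f hf => ⟨⟨f, hT f hf⟩, rfl⟩
  let F := T.toFun.extendOfNorm T.domain.subtype
  have hF : ∀ f : T.domain, F f = T f := LinearMap.extendOfNorm_eq hdense ⟨_, hnorm⟩
  refine ⟨c, F, hc, fun f hf => (hP f hf).1, fun f hf => ?_, fun f => ?_⟩
  · rw [hF ⟨f, hT f hf⟩]
    exact hTae ⟨f, hT f hf⟩
  · have hcl : IsClosed {f : Lp ℂ 2 μ | ‖F f‖ ^ 2 = c * ‖f‖ ^ 2} :=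
      isClosed_eq (by fun_prop) (by fun_prop)
    refine hdense.induction_on (p := fun f => ‖F f‖ ^ 2 = c * ‖f‖ ^ 2) f hcl fun g => ?_
    exact (congrArg (fun h => ‖h‖ ^ 2) (hF g)).trans (hnormsq g)

namespace IsFourierOperator

variable {c : ℝ} {F : Lp ℂ 2 μ →L[ℂ] Lp ℂ 2 μ} (hF : IsFourierOperator ψ μ c F)
include hF

theorem inner_map_map (f g : Lp ℂ 2 μ) : inner ℂ (F f) (F g) = (c : ℂ) * inner ℂ f g := by
  have hs : √c ≠ 0 := (Real.sqrt_pos.2 hF.pos).ne'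
  have hs2 : ((√c : ℝ) : ℂ) ≠ 0 := Complex.ofReal_ne_zero.2 hs
  let U : Lp ℂ 2 μ →ₗᵢ[ℂ] Lp ℂ 2 μ :=
    ⟨(((√c : ℝ) : ℂ)⁻¹ • F : Lp ℂ 2 μ →L[ℂ] Lp ℂ 2 μ).toLinearMap, fun f => by
      have h : ‖F f‖ = √c * ‖f‖ := by
        rw [← Real.sqrt_sq (norm_nonneg (F f)), hF.norm_sq, Real.sqrt_mul hF.pos.le,
          Real.sqrt_sq (norm_nonneg f)]
      change ‖((√c : ℝ) : ℂ)⁻¹ • F f‖ = ‖f‖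
      rw [norm_smul, h, norm_inv, Complex.norm_real, Real.norm_of_nonneg (Real.sqrt_nonneg c)]
      field_simp⟩
  have hU : ∀ f, F f = ((√c : ℝ) : ℂ) • U f := fun f => by
    change F f = ((√c : ℝ) : ℂ) • (((√c : ℝ) : ℂ)⁻¹ • F f)
    rw [smul_smul, mul_inv_cancel₀ hs2, one_smul]
  rw [hU f, hU g, inner_smul_left, inner_smul_right, U.inner_map_map, ← mul_assoc,
    Complex.conj_ofReal, ← Complex.ofReal_mul, Real.mul_self_sqrt hF.pos.le]

theorem map_dilation {t : K} (ht : t ≠ 0) (f : Lp ℂ 2 μ) :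
    F (dilation μ t f) = dilation μ t⁻¹ (F f) := by
  have hcl : IsClosed {f : Lp ℂ 2 μ | F (dilation μ t f) = dilation μ t⁻¹ (F f)} :=
    isClosed_eq (by fun_prop) (by fun_prop)
  refine hcl.closure_subset_iff.2 ?_ (dense_integrable f)
  intro f hf
  apply Lp.ext
  filter_upwards [hF.ae_eq _ (integrable_coe_dilation hf ht),
    dilation_ae_eq (inv_ne_zero ht) (hF.ae_eq f hf)] with x h1 h2
  rw [h1, h2, fourierIntegral_congr_ae (coeFn_dilation ht f)]
  have h3 := congrFun (Fourier.fourierIntegral_const_smul ψ μ (fun y => f (t * y))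
    ((√(normAbs t) : ℝ) : ℂ)) x
  refine (show _ = _ from h3).trans ?_
  rw [Pi.smul_apply, fourierIntegral_comp_mul_left ht, normAbs_inv, Real.sqrt_inv, smul_eq_mul,
    Complex.real_smul, ← mul_assoc, ← Complex.ofReal_mul]
  congr 2
  have hs := Real.mul_self_sqrt (normAbs_nonneg t)
  have hs0 := Real.sqrt_ne_zero'.2 (normAbs_pos ht)
  have h0 := normAbs_ne_zero ht
  refine eq_inv_of_mul_eq_one_left ?_
  rw [mul_right_comm, hs, mul_inv_cancel₀ h0]

/-- This identifies the adjoint of `F` as `D_{-1} F`. For integrable functions it is Fubini; density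
then removes integrability from each argument in turn. -/
theorem inner_map_left (hψ : Continuous ψ) (f g : Lp ℂ 2 μ) :
    inner ℂ (F f) g = inner ℂ f (dilation μ (-1) (F g)) := by
  have hint : ∀ f g : Lp ℂ 2 μ, Integrable f μ → Integrable g μ →
      inner ℂ (F f) g = inner ℂ f (dilation μ (-1) (F g)) := by
    intro f g hf hg
    rw [L2.inner_def, L2.inner_def]
    have h := integral_conj_fourierIntegral_mul (μ := μ) hψ hf hg
    refine Eq.trans (integral_congr_ae ?_) (h.trans (integral_congr_ae ?_))
    · filter_upwards [hF.ae_eq f hf] with x hx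
      rw [hx, RCLike.inner_apply']
    · filter_upwards [dilation_ae_eq (neg_ne_zero.2 one_ne_zero) (hF.ae_eq g hg)] with x hx
      rw [hx, RCLike.inner_apply']
      simp
  have h1 : ∀ f g : Lp ℂ 2 μ, Integrable g μ →
      inner ℂ (F f) g = inner ℂ f (dilation μ (-1) (F g)) := by
    intro f g hg
    have hcl : IsClosed {f : Lp ℂ 2 μ | inner ℂ (F f) g = inner ℂ f (dilation μ (-1) (F g))} :=
      isClosed_eq (by fun_prop) (by fun_prop)
    exact hcl.closure_subset_iff.2 (fun f hf => hint f g hf hg) (dense_integrable f)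
  have hcl : IsClosed {g : Lp ℂ 2 μ | inner ℂ (F f) g = inner ℂ f (dilation μ (-1) (F g))} :=
    isClosed_eq (by fun_prop) (by fun_prop)
  exact hcl.closure_subset_iff.2 (fun g hg => h1 f g hg) (dense_integrable g)

/-- Fourier inversion for free: `F*F = c` since `F/√c` is isometric, and `F* = D_{-1}F`. -/
theorem dilation_map_map (hψ : Continuous ψ) (f : Lp ℂ 2 μ) :
    dilation μ (-1) (F (F f)) = (c : ℂ) • f := by
  refine ext_inner_left ℂ fun g => ?_
  rw [← hF.inner_map_left hψ, hF.inner_map_map, inner_smul_right]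

theorem dilation_neg_one_map (f : Lp ℂ 2 μ) :
    F (dilation μ (-1) f) = dilation μ (-1) (F f) := by
  rw [hF.map_dilation (neg_ne_zero.2 one_ne_zero), inv_neg, inv_one]

theorem dilation_neg_one_dilation_neg_one (f : Lp ℂ 2 μ) :
    dilation μ (-1) (dilation μ (-1) f) = f := by
  rw [dilation_dilation (neg_ne_zero.2 one_ne_zero) (neg_ne_zero.2 one_ne_zero), neg_mul_neg,
    one_mul, dilation_one]

theorem coe_ne_zero : (c : ℂ) ≠ 0 := Complex.ofReal_ne_zero.2 hF.pos.ne'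

theorem injective : Function.Injective F := by
  refine (injective_iff_map_eq_zero F).2 fun f hf => ?_
  have h := hF.norm_sq f
  rw [hf, norm_zero, zero_pow two_ne_zero, eq_comm, mul_eq_zero] at h
  simpa using h.resolve_left hF.pos.ne'

/-- A right inverse of `F`. -/
theorem map_inverse (hψ : Continuous ψ) (f : Lp ℂ 2 μ) :
    F ((c : ℂ)⁻¹ • dilation μ (-1) (F f)) = f := by
  rw [map_smul, hF.dilation_neg_one_map, hF.dilation_map_map hψ, smul_smul,
    inv_mul_cancel₀ hF.coe_ne_zero, one_smul]

/-- The Fourier integral is a restriction of `F` to a dense domain and the graph of `F` is closed,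
so the closure in `opF` is exactly `F`, everywhere defined. -/
theorem mem_graph_opF_iff {hψ : Continuous ψ} {f g : Lp ℂ 2 μ} :
    (f, g) ∈ (opF ψ hψ μ).graph ↔ g = F f := by
  let T := fourierL1L2 ψ hψ μ
  have hT : ∀ f : T.domain, T f = F f := fun f => Lp.ext
    (f.2.2.coeFn_toLp.trans (hF.ae_eq f f.2.1).symm)
  have hTF : T.graph.topologicalClosure = (F.toLinearMap.toPMap ⊤).graph := by
    apply le_antisymm
    · refine Submodule.topologicalClosure_minimal _ ?_ ?_
      · rintro ⟨f, g⟩ h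
        obtain ⟨x, rfl, rfl⟩ := (LinearPMap.mem_graph_iff T).1 h
        exact (LinearPMap.mem_graph_iff _).2 ⟨⟨x, trivial⟩, rfl, (hT x).symm⟩
      · have : ((F.toLinearMap.toPMap ⊤).graph : Set (Lp ℂ 2 μ × Lp ℂ 2 μ)) =
            {p | p.2 = F p.1} := by
          ext p
          constructor
          · intro h
            obtain ⟨x, h1, h2⟩ := (LinearPMap.mem_graph_iff _).1 h
            change p.2 = F p.1
            rw [← h1, ← h2]
            rfl
          · intro h
            exact (LinearPMap.mem_graph_iff _).2 ⟨⟨p.1, trivial⟩, rfl, h.symm⟩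
        rw [this]
        exact isClosed_eq (by fun_prop) (by fun_prop)
    · rintro ⟨f, g⟩ h
      obtain ⟨x, rfl, rfl⟩ := (LinearPMap.mem_graph_iff _).1 h
      have hmap : ∀ f : Lp ℂ 2 μ, (f, F f) ∈ T.graph.topologicalClosure := by
        intro f
        have hcl : IsClosed {f : Lp ℂ 2 μ | (f, F f) ∈ T.graph.topologicalClosure} :=
          T.graph.isClosed_topologicalClosure.preimage (by fun_prop)
        refine hcl.closure_subset_iff.2 ?_ (dense_integrable f)
        intro f hf
        refine T.graph.le_topologicalClosure ?_
        exact (LinearPMap.mem_graph_iff _).2 ⟨⟨f, hf, hF.memLp f hf⟩, rfl, hT _⟩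
      exact hmap x
  have hcl : T.IsClosable := ⟨_, hTF⟩
  have hgraph : (opF ψ hψ μ).graph = (F.toLinearMap.toPMap ⊤).graph := by
    rw [← hTF, hcl.graph_closure_eq_closure_graph]
    rfl
  rw [hgraph, LinearPMap.mem_graph_iff]
  constructor
  · rintro ⟨x, rfl, rfl⟩
    rfl
  · rintro rfl
    exact ⟨⟨f, trivial⟩, rfl, rfl⟩

end IsFourierOperator

end FourierOperator

/-! ### Integrability of kernels with logarithmic weights -/

theorem Real.one_add_log_sq_le_rpow {s : ℝ} (h0 : 0 < s) (h1 : s ≤ 1) :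
    1 + Real.log s ^ 2 ≤ 65 * s ^ (-(1 / 4) : ℝ) := by
  -- The bound is `|log s| s^{1/8} < 8`. Squaring gives `64`, and `s^{1/4} ≤ 1` adds the last `1` of
  -- `65`.
  have h := (Real.abs_log_mul_self_rpow_lt s (1 / 8) h0 h1 (by norm_num)).le
  have h2 : (Real.log s * s ^ (1 / 8 : ℝ)) ^ 2 ≤ 64 := by
    rw [← sq_abs]
    refine (pow_le_pow_left₀ (abs_nonneg _) h 2).trans (by norm_num)
  have h3 : (s ^ (1 / 8 : ℝ)) ^ 2 = s ^ (1 / 4 : ℝ) := by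
    rw [← Real.rpow_natCast, ← Real.rpow_mul h0.le]
    norm_num
  rw [mul_pow, h3] at h2
  have h4 : s ^ (1 / 4 : ℝ) ≤ 1 := Real.rpow_le_one h0.le h1 (by norm_num)
  have h5 : 0 < s ^ (1 / 4 : ℝ) := Real.rpow_pos_of_pos h0 _
  rw [Real.rpow_neg h0.le, ← div_eq_mul_inv, le_div_iff₀ h5]
  linarith

noncomputable section MulKernel

variable {K : Type*} [Field K] [TopologicalSpace K] [IsLocalField K] [MeasurableSpace K]
  [BorelSpace K]

/-- The kernel `k` is integrable for `dt / |t|`, together with `log |t| k` and `log² |t| k`. -/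
def LogIntegrable (μ : Measure K) (k : K → ℂ) : Prop :=
  ∀ m ≤ 2, Integrable (fun t => (Real.log (normAbs t) : ℂ) ^ m * k t) (mulMeasure μ)

variable {μ : Measure K} [μ.IsAddHaarMeasure]

/-- The density contributes `|t|^{-1}|t|^{1/2} = |t|^{-1/2}`, and the logarithms cost at most
`|t|^{∓1/4}`. For `|t| ≤ 1` there remains `|t|^{-3/4}`, integrable since `-3/4 > -1`, against the
bound `M`; for `|t| > 1` the weight is bounded and integrability of `a` takes over. -/
theorem abs_log_pow_mul_le {m : ℕ} (hm : m ≤ 2) {t : K} (ht : t ≠ 0) {a M : ℝ} (ha : 0 ≤ a)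
    (haM : a ≤ M) :
    (normAbs t)⁻¹ * (|Real.log (normAbs t)| ^ m * (√(normAbs t) * a)) ≤ 65 * a +
      65 * M * Set.indicator {x : K | x ≠ 0 ∧ normAbs x ≤ 1}
        (fun x => normAbs x ^ (-(3 / 4) : ℝ)) t := by
  have hs := normAbs_pos ht
  set s := normAbs t with hsdef
  have hlog : |Real.log s| ^ m ≤ 1 + Real.log s ^ 2 := by
    rw [← sq_abs]
    have := abs_nonneg (Real.log s)
    interval_cases m <;> nlinarith
  have hsq : s⁻¹ * √s = s ^ (-(1 / 2) : ℝ) := by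
    rw [Real.sqrt_eq_rpow, ← Real.rpow_neg_one, ← Real.rpow_add hs]
    norm_num
  have h1 : s⁻¹ * (|Real.log s| ^ m * (√s * a)) ≤ (1 + Real.log s ^ 2) * s ^ (-(1 / 2) : ℝ) * a := by
    rw [← hsq]
    calc s⁻¹ * (|Real.log s| ^ m * (√s * a)) = |Real.log s| ^ m * (s⁻¹ * √s) * a := by ring
      _ ≤ _ := by gcongr
  refine h1.trans ?_
  have hM := ha.trans haM
  have hp : 0 ≤ s ^ (-(1 / 2) : ℝ) := Real.rpow_nonneg hs.le _
  by_cases hs1 : s ≤ 1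
  · rw [Set.indicator_of_mem (show t ∈ {x : K | x ≠ 0 ∧ normAbs x ≤ 1} from ⟨ht, hs1⟩), ← hsdef]
    have h2 := Real.one_add_log_sq_le_rpow hs hs1
    have h3 : s ^ (-(1 / 4) : ℝ) * s ^ (-(1 / 2) : ℝ) = s ^ (-(3 / 4) : ℝ) := by
      rw [← Real.rpow_add hs]
      norm_num
    calc (1 + Real.log s ^ 2) * s ^ (-(1 / 2) : ℝ) * a
        ≤ 65 * s ^ (-(1 / 4) : ℝ) * s ^ (-(1 / 2) : ℝ) * M := by gcongr
      _ = 65 * M * s ^ (-(3 / 4) : ℝ) := by rw [mul_assoc 65, h3]; ring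
      _ ≤ _ := le_add_of_nonneg_left (by positivity)
  · rw [Set.indicator_of_notMem (fun h => hs1 h.2), mul_zero, add_zero]
    have hs1' := (not_le.1 hs1).le
    have h2 := Real.one_add_log_sq_le_rpow (inv_pos.2 hs) (inv_le_one_of_one_le₀ hs1')
    rw [Real.log_inv, neg_sq, Real.inv_rpow hs.le, ← Real.rpow_neg hs.le, neg_neg] at h2
    have h3 : s ^ (1 / 4 : ℝ) * s ^ (-(1 / 2) : ℝ) ≤ 1 := by
      rw [← Real.rpow_add hs]
      exact Real.rpow_le_one_of_one_le_of_nonpos hs1' (by norm_num)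
    calc (1 + Real.log s ^ 2) * s ^ (-(1 / 2) : ℝ) * a
        ≤ 65 * s ^ (1 / 4 : ℝ) * s ^ (-(1 / 2) : ℝ) * a := by gcongr
      _ = 65 * (s ^ (1 / 4 : ℝ) * s ^ (-(1 / 2) : ℝ)) * a := by ring
      _ ≤ 65 * 1 * a := by gcongr
      _ = 65 * a := by ring

theorem logIntegrable_sqrt_mul {φ : K → ℂ} (hφ : Integrable φ μ) {M : ℝ} (hM : ∀ t, ‖φ t‖ ≤ M) :
    LogIntegrable μ fun t => (√(normAbs t) : ℂ) * φ t := by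
  intro m hm
  rw [integrable_mulMeasure_iff]
  have hms : MeasurableSet {x : K | x ≠ 0 ∧ normAbs x ≤ 1} :=
    (measurableSet_singleton 0).compl.inter (measurableSet_le measurable_normAbs measurable_const)
  have hw : Integrable (Set.indicator {x : K | x ≠ 0 ∧ normAbs x ≤ 1}
      fun x => normAbs x ^ (-(3 / 4) : ℝ)) μ := by
    rw [integrable_indicator_iff hms]
    refine ⟨(measurable_normAbs.pow_const _).aestronglyMeasurable, ?_⟩
    rw [hasFiniteIntegral_iff_ofReal (Eventually.of_forall fun x =>
      Real.rpow_nonneg (normAbs_nonneg x) _)]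
    exact setLIntegral_normAbs_rpow_lt_top μ (by norm_num)
  refine ((hφ.norm.const_mul 65).add (hw.const_mul (65 * M))).mono' ?_ ?_
  · have h1 : Measurable fun t : K => (Real.log (normAbs t) : ℂ) ^ m * (√(normAbs t) : ℂ) := by
      fun_prop
    have h2 : Measurable fun t : K => (normAbs t)⁻¹ := by fun_prop
    refine h2.aestronglyMeasurable.smul ?_
    refine (h1.aestronglyMeasurable.mul hφ.1).congr (Eventually.of_forall fun t => ?_)
    simp only [Pi.mul_apply]
    ring
  · filter_upwards [ae_ne_zero μ] with t ht
    have h := abs_log_pow_mul_le hm ht (norm_nonneg (φ t)) (hM t)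
    refine le_trans (le_of_eq ?_) h
    rw [norm_smul, norm_mul, norm_pow, norm_mul, Complex.norm_real, Complex.norm_real,
      Real.norm_of_nonneg (inv_nonneg.2 (normAbs_nonneg t)),
      Real.norm_of_nonneg (Real.sqrt_nonneg _), Real.norm_eq_abs]

theorem LogIntegrable.integrable {k : K → ℂ} (hk : LogIntegrable μ k) :
    Integrable k (mulMeasure μ) := by
  simpa using hk 0 (by norm_num)

theorem LogIntegrable.comp_inv {k : K → ℂ} (hk : LogIntegrable μ k) :
    LogIntegrable μ fun t => k t⁻¹ := by
  intro m hm
  refine ((integrable_comp_inv (hk m hm)).const_mul ((-1) ^ m)).congr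
    (Eventually.of_forall fun t => ?_)
  simp only [log_normAbs_inv, Complex.ofReal_neg]
  rw [← mul_assoc, ← mul_pow, neg_one_mul, neg_neg]

end MulKernel

/-! ### The intertwining relation `C_k F = I C_r` -/

noncomputable section FourierMulConv

variable {K : Type*} [Field K] [TopologicalSpace K] [IsLocalField K] [MeasurableSpace K]
  [BorelSpace K] {μ : Measure K} [μ.IsAddHaarMeasure] {ψ : AddChar K Circle}

theorem norm_fourierIntegral_le (f : K → ℂ) (x : K) :
    ‖Fourier.fourierIntegral ψ μ f x‖ ≤ ∫ y, ‖f y‖ ∂μ :=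
  VectorFourier.norm_fourierIntegral_le_integral_norm ψ μ _ f x

theorem integral_mul_fourierIntegral_comp_mul (hψ : Continuous ψ) {φ f : K → ℂ}
    (hφ : Integrable φ μ) (hf : Integrable f μ) {x : K} (hx : x ≠ 0) :
    ∫ t, φ t * Fourier.fourierIntegral ψ μ f (x * t) ∂μ =
      ∫ y, Fourier.fourierIntegral ψ μ φ (x * y) * f y ∂μ := by
  have h0 := normAbs_ne_zero hx
  have h1 : ∀ t, Fourier.fourierIntegral ψ μ f (x * t) =
      ((normAbs x)⁻¹ : ℝ) • Fourier.fourierIntegral ψ μ (fun y => f (x⁻¹ * y)) t := by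
    intro t
    rw [fourierIntegral_comp_mul_left (inv_ne_zero hx), inv_inv, normAbs_inv, inv_inv, smul_smul,
      inv_mul_cancel₀ h0, one_smul]
  simp_rw [h1, mul_smul_comm]
  rw [integral_smul, ← integral_fourierIntegral_mul hψ hφ
    (integrable_comp_mul_left μ (inv_ne_zero hx) hf), ← integral_comp_mul_left' μ hx]
  simp_rw [inv_mul_cancel_left₀ hx]

theorem inner_eq_integral_of_ae_eq {h g : Lp ℂ 2 μ} {u : K → ℂ} (hg : g =ᵐ[μ] u) :
    inner ℂ h g = ∫ x, (starRingEnd ℂ) (h x) * u x ∂μ := by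
  rw [L2.inner_def]
  refine integral_congr_ae ?_
  filter_upwards [hg] with x hx
  rw [hx, RCLike.inner_apply, mul_comm]

theorem inner_mulConv {k : K → ℂ} (hk : Integrable k (mulMeasure μ)) (h f : Lp ℂ 2 μ) :
    inner ℂ h (mulConv μ k f) = ∫ t, k t * inner ℂ h (dilation μ t f) ∂(mulMeasure μ) := by
  rw [mulConv_apply hk, ← integral_inner (integrable_smul_dilation hk f)]
  simp_rw [inner_smul_right]

namespace IsFourierOperator

variable {c : ℝ} {F : Lp ℂ 2 μ →L[ℂ] Lp ℂ 2 μ}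

/-- Pointwise, `C_k F f(x) = ∫ φ(t) f̂(tx) dt = ∫ φ̂(xy) f(y) dy`. Pairing with an integrable `h`
makes the exchange of integrals absolutely convergent. -/
theorem inner_mulConv_map (hF : IsFourierOperator ψ μ c F) (hψ : Continuous ψ) {φ : K → ℂ}
    (hφ : Integrable φ μ)
    (hk : Integrable (fun t => (√(normAbs t) : ℂ) * φ t) (mulMeasure μ)) {h f : Lp ℂ 2 μ}
    (hh : Integrable h μ) (hf : Integrable f μ) :
    inner ℂ h (mulConv μ (fun t => (√(normAbs t) : ℂ) * φ t) (F f)) =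
      ∫ x, (starRingEnd ℂ) (h x) * ∫ y, Fourier.fourierIntegral ψ μ φ (x * y) * f y ∂μ ∂μ := by
  have hh' : Integrable (fun x => (starRingEnd ℂ) (h x)) μ :=
    (Complex.conjCLE : ℂ →L[ℝ] ℂ).integrable_comp hh
  have h1 : ∫ t, (√(normAbs t) : ℂ) * φ t * inner ℂ h (dilation μ t (F f)) ∂(mulMeasure μ) =
      ∫ t, ∫ x, φ t * ((starRingEnd ℂ) (h x) * Fourier.fourierIntegral ψ μ f (t * x)) ∂μ ∂μ := by
    rw [integral_mulMeasure]
    refine integral_congr_ae ?_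
    filter_upwards [ae_ne_zero μ] with t ht
    have h2 : ((√(normAbs t) : ℝ) : ℂ) * (√(normAbs t) : ℝ) = normAbs t := by
      rw [← Complex.ofReal_mul, Real.mul_self_sqrt (normAbs_nonneg t)]
    rw [inner_eq_integral_of_ae_eq (dilation_ae_eq ht (hF.ae_eq f hf)), ← integral_const_mul,
      ← integral_smul]
    refine integral_congr_ae (Eventually.of_forall fun x => ?_)
    simp only [Complex.real_smul]
    have h3 : ((normAbs t : ℝ) : ℂ) ≠ 0 := Complex.ofReal_ne_zero.2 (normAbs_ne_zero ht)
    push_cast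
    calc _ = ((normAbs t : ℝ) : ℂ)⁻¹ * (((√(normAbs t) : ℝ) : ℂ) * (√(normAbs t) : ℝ)) *
          (φ t * ((starRingEnd ℂ) (h x) * Fourier.fourierIntegral ψ μ f (t * x))) := by ring
      _ = _ := by rw [h2, inv_mul_cancel₀ h3, one_mul]
  have hcont := continuous_fourierIntegral hψ hf
  have hint : Integrable (Function.uncurry fun t x =>
      φ t * ((starRingEnd ℂ) (h x) * Fourier.fourierIntegral ψ μ f (t * x))) (μ.prod μ) := by
    have h3 := (hφ.mul_prod hh').mul_bdd (g := fun p : K × K =>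
      Fourier.fourierIntegral ψ μ f (p.1 * p.2)) (c := ∫ y, ‖f y‖ ∂μ)
      (by exact (hcont.comp continuous_mul).aestronglyMeasurable)
      (Eventually.of_forall fun p => norm_fourierIntegral_le _ _)
    refine h3.congr (Eventually.of_forall fun p => ?_)
    simp only [Function.uncurry, mul_assoc]
  rw [inner_mulConv hk, h1, integral_integral_swap hint]
  refine integral_congr_ae ?_
  filter_upwards [ae_ne_zero μ] with x hx
  rw [← integral_mul_fourierIntegral_comp_mul hψ hφ hf hx, ← integral_const_mul]
  refine integral_congr_ae (Eventually.of_forall fun t => ?_)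
  simp only [mul_comm t x]
  ring

end IsFourierOperator

/-- The other half of the intertwining: `I C_r f(x) = |x|⁻¹ ∫ u(t) f(t/x) dt`, and `t = xy` brings
it to the same shape with kernel `u(xy)`. -/
theorem inner_inversionIsometry_mulConv {u : K → ℂ} (hu : Continuous u) {M : ℝ}
    (hM : ∀ t, ‖u t‖ ≤ M)
    (hr : Integrable (fun t => (√(normAbs t) : ℂ) * u t) (mulMeasure μ)) {h f : Lp ℂ 2 μ}
    (hh : Integrable h μ) (hf : Integrable f μ) :
    inner ℂ h (inversionIsometry μ (mulConv μ (fun t => (√(normAbs t) : ℂ) * u t) f)) =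
      ∫ x, (starRingEnd ℂ) (h x) * ∫ y, u (x * y) * f y ∂μ ∂μ := by
  have hh' : Integrable (fun x => (starRingEnd ℂ) (h x)) μ :=
    (Complex.conjCLE : ℂ →L[ℝ] ℂ).integrable_comp hh
  have h1 : inner ℂ h (inversionIsometry μ (mulConv μ (fun t => (√(normAbs t) : ℂ) * u t) f)) =
      ∫ t, ∫ x, u t * ((starRingEnd ℂ) (h x) * (((normAbs x)⁻¹ : ℝ) * f (t * x⁻¹))) ∂μ ∂μ := by
    have hI : Integrable (fun t => inversionIsometry μ
        (((√(normAbs t) : ℂ) * u t) • dilation μ t f)) (mulMeasure μ) :=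
      (inversionIsometry μ).toContinuousLinearMap.integrable_comp (integrable_smul_dilation hr f)
    rw [mulConv_apply hr, ← (inversionIsometry μ).integral_comp_comm, ← integral_inner hI,
      integral_mulMeasure]
    refine integral_congr_ae ?_
    filter_upwards [ae_ne_zero μ] with t ht
    have h2 : ((√(normAbs t) : ℝ) : ℂ) * (√(normAbs t) : ℝ) = normAbs t := by
      rw [← Complex.ofReal_mul, Real.mul_self_sqrt (normAbs_nonneg t)]
    have h3 : ((normAbs t : ℝ) : ℂ) ≠ 0 := Complex.ofReal_ne_zero.2 (normAbs_ne_zero ht)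
    rw [map_smul, inner_smul_right,
      inner_eq_integral_of_ae_eq (inversionIsometry_ae_eq (coeFn_dilation ht f)),
      ← integral_const_mul, ← integral_smul]
    refine integral_congr_ae (Eventually.of_forall fun x => ?_)
    simp only [Complex.real_smul]
    push_cast
    calc _ = ((normAbs t : ℝ) : ℂ)⁻¹ * (((√(normAbs t) : ℝ) : ℂ) * (√(normAbs t) : ℝ)) *
          (u t * ((starRingEnd ℂ) (h x) * (((normAbs x : ℝ) : ℂ)⁻¹ * f (t * x⁻¹)))) := by ring
      _ = _ := by rw [h2, inv_mul_cancel₀ h3, one_mul]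
  have hmeas : Measurable f := (Lp.stronglyMeasurable f).measurable
  have hint : Integrable (Function.uncurry fun t x =>
      u t * ((starRingEnd ℂ) (h x) * (((normAbs x)⁻¹ : ℝ) * f (t * x⁻¹)))) (μ.prod μ) := by
    have hm : Measurable fun p : K × K =>
        (starRingEnd ℂ) (h p.2) * (((normAbs p.2)⁻¹ : ℝ) * f (p.1 * p.2⁻¹) : ℂ) := by
      have := (Lp.stronglyMeasurable h).measurable
      have h5 : Measurable fun p : K × K => (starRingEnd ℂ) (h p.2) :=
        Complex.continuous_conj.measurable.comp (this.comp measurable_snd)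
      refine h5.mul ?_
      have h6 : Measurable fun p : K × K => f (p.1 * p.2⁻¹) := hmeas.comp (by fun_prop)
      have h7 : Measurable fun p : K × K => (((normAbs p.2)⁻¹ : ℝ) : ℂ) := by fun_prop
      exact h7.mul h6
    have h4 : Integrable (fun p : K × K =>
        (starRingEnd ℂ) (h p.2) * (((normAbs p.2)⁻¹ : ℝ) * f (p.1 * p.2⁻¹) : ℂ)) (μ.prod μ) := by
      rw [integrable_prod_iff' hm.aestronglyMeasurable]
      have h8 : ∀ x : K, x ≠ 0 → Integrable (fun t => f (t * x⁻¹)) μ := fun x hx => by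
        simpa only [mul_comm] using integrable_comp_mul_left μ (inv_ne_zero hx) hf
      refine ⟨?_, ?_⟩
      · filter_upwards [ae_ne_zero μ] with x hx
        exact ((h8 x hx).const_mul _).const_mul _
      · refine (hh.norm.mul_const (∫ y, ‖f y‖ ∂μ)).congr ?_
        filter_upwards [ae_ne_zero μ] with x hx
        simp only [norm_mul, RCLike.norm_conj]
        rw [integral_const_mul, integral_const_mul]
        have h9 := integral_comp_mul_left' μ (inv_ne_zero hx) fun y => ‖f y‖
        rw [normAbs_inv, inv_inv] at h9
        simp_rw [mul_comm _ x⁻¹]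
        rw [h9, Complex.norm_real, Real.norm_of_nonneg (inv_nonneg.2 (normAbs_nonneg x)),
          smul_eq_mul, inv_mul_cancel_left₀ (normAbs_ne_zero hx)]
    have h3 := h4.bdd_mul (f := fun p : K × K => u p.1) (c := M)
      (by exact (hu.comp continuous_fst).aestronglyMeasurable)
      (Eventually.of_forall fun p => hM _)
    exact h3
  rw [h1, integral_integral_swap hint]
  refine integral_congr_ae ?_
  filter_upwards [ae_ne_zero μ] with x hx
  have h9 := integral_comp_mul_left' μ hx fun t =>
    u t * ((starRingEnd ℂ) (h x) * (((normAbs x)⁻¹ : ℝ) * f (t * x⁻¹)))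
  have h10 : ∫ t, u t * ((starRingEnd ℂ) (h x) * (((normAbs x)⁻¹ : ℝ) * f (t * x⁻¹))) ∂μ =
      normAbs x • ∫ t, u (x * t) * ((starRingEnd ℂ) (h x) *
        (((normAbs x)⁻¹ : ℝ) * f (x * t * x⁻¹))) ∂μ := by
    rw [h9, smul_smul, mul_inv_cancel₀ (normAbs_ne_zero hx), one_smul]
  rw [h10, ← integral_smul, ← integral_const_mul]
  refine integral_congr_ae (Eventually.of_forall fun t => ?_)
  have h3 : ((normAbs x : ℝ) : ℂ) ≠ 0 := Complex.ofReal_ne_zero.2 (normAbs_ne_zero hx)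
  simp only [Complex.real_smul, mul_comm x t, mul_inv_cancel_right₀ hx]
  push_cast
  calc _ = ((normAbs x : ℝ) : ℂ) * ((normAbs x : ℝ) : ℂ)⁻¹ *
        (u (t * x) * ((starRingEnd ℂ) (h x) * f t)) := by ring
    _ = _ := by rw [mul_inv_cancel₀ h3]; ring

/-- Both sides have the kernel `φ̂(xy)`. It suffices to compare them on integrable `f`, tested
against integrable `h`. -/
theorem IsFourierOperator.mulConv_map {c : ℝ} {F : Lp ℂ 2 μ →L[ℂ] Lp ℂ 2 μ}
    (hF : IsFourierOperator ψ μ c F) (hψ : Continuous ψ) {φ : K → ℂ} (hφ : Integrable φ μ)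
    (hk : Integrable (fun t => (√(normAbs t) : ℂ) * φ t) (mulMeasure μ))
    (hr : Integrable (fun t => (√(normAbs t) : ℂ) * Fourier.fourierIntegral ψ μ φ t)
      (mulMeasure μ)) (f : Lp ℂ 2 μ) :
    mulConv μ (fun t => (√(normAbs t) : ℂ) * φ t) (F f) = inversionIsometry μ
      (mulConv μ (fun t => (√(normAbs t) : ℂ) * Fourier.fourierIntegral ψ μ φ t) f) := by
  have hcl : IsClosed {f : Lp ℂ 2 μ | mulConv μ (fun t => (√(normAbs t) : ℂ) * φ t) (F f) =
      inversionIsometry μ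
        (mulConv μ (fun t => (√(normAbs t) : ℂ) * Fourier.fourierIntegral ψ μ φ t) f)} :=
    isClosed_eq (by fun_prop) (by fun_prop)
  refine hcl.closure_subset_iff.2 (fun g hg => ?_) (dense_integrable f)
  refine dense_integrable.eq_of_inner_right ℂ fun h hh => ?_
  rw [hF.inner_mulConv_map hψ hφ hk hh hg, inner_inversionIsometry_mulConv
    (continuous_fourierIntegral hψ hφ) (norm_fourierIntegral_le φ) hr hh hg]

end FourierMulConv

/-! ### Approximate identities with integrable Fourier integral -/

noncomputable section ApproximateIdentity

variable {K : Type*} [Field K] [TopologicalSpace K] [IsLocalField K] [MeasurableSpace K]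
  [BorelSpace K] {μ : Measure K} [μ.IsAddHaarMeasure] {ψ : AddChar K Circle} {c : ℝ}
  {F : Lp ℂ 2 μ →L[ℂ] Lp ℂ 2 μ}

/-- Take `φ = 1_W * 1_{1+W}` with `W` a small open set around `0`. Its support lies in `1 + W + W ⊆
N`, and `φ̂` is a product of two `L²` functions, hence integrable. No smoothness is needed, so the
archimedean and nonarchimedean cases are treated alike. -/
theorem IsFourierOperator.exists_bump (hF : IsFourierOperator ψ μ c F) (hψ : Continuous ψ)
    {N : Set K} (hN : N ∈ 𝓝 (1 : K)) :
    ∃ (φ : K → ℝ) (M : ℝ), (∀ t, 0 ≤ φ t) ∧ (∀ t, φ t ≤ M) ∧ (∀ t ∉ N, φ t = 0) ∧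
      Integrable φ μ ∧ 0 < ∫ t, φ t ∂μ ∧
      Integrable (Fourier.fourierIntegral ψ μ fun t => (φ t : ℂ)) μ := by
  have hN' : (fun x : K => 1 + x) ⁻¹' N ∈ 𝓝 (0 : K) := by
    refine (by fun_prop : Continuous fun x : K => 1 + x).continuousAt.preimage_mem_nhds ?_
    rwa [add_zero]
  obtain ⟨V, hV, hVN⟩ := exists_nhds_zero_half hN'
  obtain ⟨O, h0O, hO, hOfin⟩ := μ.exists_isOpen_measure_lt_top (0 : K)
  let W := interior V ∩ O
  have hWo : IsOpen W := isOpen_interior.inter hO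
  have hW0 : (0 : K) ∈ W := ⟨mem_interior_iff_mem_nhds.2 hV, h0O⟩
  have hWfin : μ W ≠ ∞ := ((measure_mono Set.inter_subset_right).trans_lt hOfin).ne
  have hWV : ∀ x ∈ W, x ∈ V := fun x hx => interior_subset hx.1
  have hcont : Continuous fun y : K => -1 + y := by fun_prop
  let W' := (fun y : K => -1 + y) ⁻¹' W
  have hW'o : IsOpen W' := hWo.preimage hcont
  have hW'fin : μ W' ≠ ∞ := by rwa [measure_preimage_add]
  have hind : ∀ s : Set K, IsOpen s → μ s ≠ ∞ → Integrable (s.indicator fun _ => (1 : ℝ)) μ ∧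
      Integrable (fun x => ((s.indicator (fun _ => (1 : ℝ)) x : ℝ) : ℂ)) μ ∧
      MemLp (Fourier.fourierIntegral ψ μ
        fun x => ((s.indicator (fun _ => (1 : ℝ)) x : ℝ) : ℂ)) 2 μ := by
    intro s hs hfin
    have h1 : Integrable (s.indicator fun _ => (1 : ℝ)) μ :=
      (integrable_indicator_iff hs.measurableSet).2 (integrableOn_const hfin)
    have h2 : MemLp (fun x => ((s.indicator (fun _ => (1 : ℝ)) x : ℝ) : ℂ)) 2 μ :=
      (memLp_indicator_const 2 hs.measurableSet (1 : ℝ) (Or.inr hfin)).ofReal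
    refine ⟨h1, h1.ofReal, ?_⟩
    have h3 := hF.memLp h2.toLp ((integrable_congr h2.coeFn_toLp).2 h1.ofReal)
    rwa [fourierIntegral_congr_ae h2.coeFn_toLp] at h3
  obtain ⟨h1, h1c, h1F⟩ := hind W hWo hWfin
  obtain ⟨h2, h2c, h2F⟩ := hind W' hW'o hW'fin
  set g₁ := W.indicator fun _ => (1 : ℝ) with hg₁
  set g₂ := W'.indicator fun _ => (1 : ℝ) with hg₂
  have hg₁0 : ∀ x, 0 ≤ g₁ x := fun x => Set.indicator_nonneg (fun _ _ => zero_le_one) x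
  have hg₂0 : ∀ x, 0 ≤ g₂ x := fun x => Set.indicator_nonneg (fun _ _ => zero_le_one) x
  have hg₂1 : ∀ x, g₂ x ≤ 1 := fun x => Set.indicator_le_self' (fun _ _ => zero_le_one) x
  let φ := convolution g₁ g₂ (ContinuousLinearMap.mul ℝ ℝ) μ
  have hφ : ∀ t, φ t = ∫ y, g₁ y * g₂ (t - y) ∂μ := fun t => rfl
  have hφint : Integrable φ μ := h1.integrable_convolution (ContinuousLinearMap.mul ℝ ℝ) h2
  have hφc : (fun t => (φ t : ℂ)) = convolution (fun x => (g₁ x : ℂ)) (fun x => (g₂ x : ℂ))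
      (ContinuousLinearMap.mul ℂ ℂ) μ := by
    funext t
    rw [hφ, ← integral_complex_ofReal, convolution_def]
    simp
  refine ⟨φ, ∫ y, g₁ y ∂μ, fun t => ?_, fun t => ?_, fun t ht => ?_, hφint, ?_, ?_⟩
  · exact integral_nonneg fun y => mul_nonneg (hg₁0 y) (hg₂0 _)
  · refine integral_mono_of_nonneg (Eventually.of_forall fun y => mul_nonneg (hg₁0 y) (hg₂0 _)) h1
      (Eventually.of_forall fun y => ?_)
    exact mul_le_of_le_one_right (hg₁0 y) (hg₂1 _)
  · rw [hφ]
    refine integral_eq_zero_of_ae (Eventually.of_forall fun y => ?_)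
    by_contra hne
    obtain ⟨hy1, hy2⟩ := mul_ne_zero_iff.1 hne
    have hy1' : y ∈ W := Set.mem_of_indicator_ne_zero hy1
    have hy2' : t - y ∈ W' := Set.mem_of_indicator_ne_zero hy2
    have h := hVN y (hWV _ hy1') (-1 + (t - y)) (hWV _ hy2')
    refine ht ?_
    rw [Set.mem_preimage] at h
    convert h using 1
    ring
  · have h := integral_convolution (ContinuousLinearMap.mul ℝ ℝ) h1 h2 (μ := μ) (ν := μ)
    rw [show ∫ t, φ t ∂μ = _ from h, ContinuousLinearMap.mul_apply', hg₁, hg₂,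
      integral_indicator_const _ hWo.measurableSet, integral_indicator_const _ hW'o.measurableSet]
    have hp : 0 < μ.real W := ENNReal.toReal_pos (hWo.measure_pos μ ⟨0, hW0⟩).ne' hWfin
    have hp' : 0 < μ.real W' := by
      rw [measureReal_def, measure_preimage_add]
      exact hp
    simpa using mul_pos hp hp'
  · rw [hφc]
    refine (h1F.integrable_mul h2F).congr (Eventually.of_forall fun x => ?_)
    exact (fourierIntegral_convolution hψ h1c h2c x).symm

/-- The bump `φ₀` is divided by the mass `a` of `|t|^{1/2} φ₀` for `dt/|t|`. Both `φ` and `φ̂` are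
bounded and integrable, which is what makes both kernels `LogIntegrable`. -/
theorem IsFourierOperator.exists_mulConv_map (hF : IsFourierOperator ψ μ c F) (hψ : Continuous ψ)
    {N : Set K} (hN : N ∈ 𝓝 (1 : K)) :
    ∃ k r : K → ℂ, LogIntegrable μ k ∧ LogIntegrable μ r ∧ (∀ t ∉ N, k t = 0) ∧
      ∫ t, k t ∂(mulMeasure μ) = 1 ∧ ∫ t, ‖k t‖ ∂(mulMeasure μ) ≤ 1 ∧
      ∀ f, mulConv μ k (F f) = inversionIsometry μ (mulConv μ r f) := by
  obtain ⟨φ₀, M, hφ0, hφM, hφN, hφint, hφpos, hφF⟩ := hF.exists_bump hψ hN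
  have hφM' : ∀ t, ‖(φ₀ t : ℂ)‖ ≤ M := fun t => by
    rw [Complex.norm_real, Real.norm_of_nonneg (hφ0 t)]
    exact hφM t
  have hk₀ := (logIntegrable_sqrt_mul hφint.ofReal hφM').integrable
  have hk₀' : Integrable (fun t => √(normAbs t) * φ₀ t) (mulMeasure μ) := by
    refine hk₀.re.congr (Eventually.of_forall fun t => ?_)
    simp
  set a := ∫ t, √(normAbs t) * φ₀ t ∂(mulMeasure μ) with ha
  have hnn : ∀ t, 0 ≤ √(normAbs t) * φ₀ t := fun t => mul_nonneg (Real.sqrt_nonneg _) (hφ0 t)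
  have ha0 : 0 ≤ a := integral_nonneg hnn
  have ha1 : a ≠ 0 := by
    intro h
    rw [ha, integral_eq_zero_iff_of_nonneg hnn hk₀'] at h
    refine hφpos.ne' (integral_eq_zero_of_ae ?_)
    filter_upwards [(absolutelyContinuous_mulMeasure μ).ae_le h, ae_ne_zero μ] with t ht ht0
    exact (mul_eq_zero.1 ht).resolve_left (Real.sqrt_ne_zero'.2 (normAbs_pos ht0))
  let φ : K → ℂ := (a⁻¹ : ℂ) • fun t => (φ₀ t : ℂ)
  have hφ : Integrable φ μ := hφint.ofReal.smul _
  have hFφ : Fourier.fourierIntegral ψ μ φ =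
      (a⁻¹ : ℂ) • Fourier.fourierIntegral ψ μ fun t => (φ₀ t : ℂ) :=
    VectorFourier.fourierIntegral_const_smul ψ μ _ _ _
  have hφb : ∀ t, ‖φ t‖ ≤ a⁻¹ * M := fun t => by
    change ‖(a⁻¹ : ℂ) • (φ₀ t : ℂ)‖ ≤ a⁻¹ * M
    rw [norm_smul, norm_inv, Complex.norm_real, Real.norm_of_nonneg ha0]
    gcongr
    exact hφM' t
  have hk := logIntegrable_sqrt_mul hφ hφb
  have hr := logIntegrable_sqrt_mul (φ := Fourier.fourierIntegral ψ μ φ) (μ := μ)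
    (by rw [hFφ]; exact hφF.smul _) (norm_fourierIntegral_le φ)
  have hkeq : ∀ t, (√(normAbs t) : ℂ) * φ t = ((a⁻¹ * (√(normAbs t) * φ₀ t) : ℝ) : ℂ) :=
    fun t => by
      simp only [φ, Pi.smul_apply, smul_eq_mul]
      push_cast
      ring
  refine ⟨_, _, hk, hr, fun t ht => ?_, ?_, ?_, hF.mulConv_map hψ hφ hk.integrable hr.integrable⟩
  · simp [φ, hφN t ht]
  · simp_rw [hkeq]
    rw [integral_complex_ofReal, integral_const_mul, ← ha, inv_mul_cancel₀ ha1, Complex.ofReal_one]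
  · simp_rw [hkeq, Complex.norm_real,
      fun t => Real.norm_of_nonneg (mul_nonneg (inv_nonneg.2 ha0) (hnn t))]
    rw [integral_const_mul, ← ha, inv_mul_cancel₀ ha1]

end ApproximateIdentity

/-! ### Graphs of composites, inverses, differences and multiples -/

theorem LinearPMap.mem_graph_naturalComp_iff {H : Type*} [AddCommGroup H] [Module ℂ H]
    {g f : H →ₗ.[ℂ] H} {x z : H} :
    (x, z) ∈ (g.naturalComp f).graph ↔ ∃ y, (x, y) ∈ f.graph ∧ (y, z) ∈ g.graph := by
  have key : ∀ (w : (g.naturalComp f).domain) (v : f.domain) (hv : f v ∈ g.domain),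
      (w : H) = v → g.naturalComp f w = g ⟨f v, hv⟩ := by
    intro w v hv hwv
    change g _ = g _
    congr 1
    exact Subtype.ext (LinearPMap.domRestrict_apply (f := f) hwv)
  constructor
  · intro h
    obtain ⟨w, rfl, rfl⟩ := (LinearPMap.mem_graph_iff _).1 h
    obtain ⟨v, hv, hvw⟩ := w.2.1
    rw [key w v hv hvw.symm]
    refine ⟨f v, ?_, LinearPMap.mem_graph g ⟨f v, hv⟩⟩
    rw [← hvw]
    exact LinearPMap.mem_graph f v
  · rintro ⟨y, hxy, hyz⟩
    obtain ⟨v, rfl, rfl⟩ := (LinearPMap.mem_graph_iff _).1 hxy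
    obtain ⟨u, hu, rfl⟩ := (LinearPMap.mem_graph_iff _).1 hyz
    have hu : (u : H) = f v := hu
    have hv : f v ∈ g.domain := hu ▸ u.2
    refine (LinearPMap.mem_graph_iff _).2 ⟨⟨v, ⟨v, hv, rfl⟩, v.2⟩, rfl, ?_⟩
    rw [key _ v hv rfl]
    congr 1
    exact Subtype.ext hu.symm

theorem LinearPMap.mem_graph_inverse_iff {H : Type*} [AddCommGroup H] [Module ℂ H]
    {f : H →ₗ.[ℂ] H} (hf : LinearMap.ker f.toFun = ⊥) {x y : H} :
    (x, y) ∈ f.inverse.graph ↔ (y, x) ∈ f.graph := by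
  rw [LinearPMap.inverse_graph hf]
  simp

theorem LinearPMap.mem_graph_sub_iff {H : Type*} [AddCommGroup H] [Module ℂ H]
    {f g : H →ₗ.[ℂ] H} {x z : H} :
    (x, z) ∈ (f - g).graph ↔ ∃ u v, (x, u) ∈ f.graph ∧ (x, v) ∈ g.graph ∧ z = u - v := by
  constructor
  · intro h
    obtain ⟨w, rfl, rfl⟩ := (LinearPMap.mem_graph_iff _).1 h
    exact ⟨f ⟨w, w.2.1⟩, g ⟨w, w.2.2⟩, LinearPMap.mem_graph f ⟨w, w.2.1⟩,
      LinearPMap.mem_graph g ⟨w, w.2.2⟩, rfl⟩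
  · rintro ⟨u, v, hu, hv, rfl⟩
    obtain ⟨a, rfl, rfl⟩ := (LinearPMap.mem_graph_iff _).1 hu
    obtain ⟨b, hb, rfl⟩ := (LinearPMap.mem_graph_iff _).1 hv
    have hb : (b : H) = a := hb
    refine (LinearPMap.mem_graph_iff _).2 ⟨⟨a, a.2, hb ▸ b.2⟩, rfl, ?_⟩
    rw [LinearPMap.sub_apply]
    congr 2
    exact Subtype.ext hb.symm

theorem LinearPMap.mem_graph_smul_iff {H : Type*} [AddCommGroup H] [Module ℂ H]
    {f : H →ₗ.[ℂ] H} {a : ℂ} {x z : H} :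
    (x, z) ∈ (a • f).graph ↔ ∃ u, (x, u) ∈ f.graph ∧ z = a • u := by
  constructor
  · intro h
    obtain ⟨w, rfl, rfl⟩ := (LinearPMap.mem_graph_iff _).1 h
    exact ⟨f w, LinearPMap.mem_graph f w, rfl⟩
  · rintro ⟨u, hu, rfl⟩
    obtain ⟨b, rfl, rfl⟩ := (LinearPMap.mem_graph_iff _).1 hu
    exact (LinearPMap.mem_graph_iff _).2 ⟨b, rfl, rfl⟩

/-! ### Symmetries of `A`, `B` and the commutator under dilations and the Fourier transform -/

noncomputable section OperatorGraphs

variable {K : Type*} [Field K] [TopologicalSpace K] [IsLocalField K] [MeasurableSpace K]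
  [BorelSpace K] {μ : Measure K} [μ.IsAddHaarMeasure] {ψ : AddChar K Circle} {c : ℝ}
  {F : Lp ℂ 2 μ →L[ℂ] Lp ℂ 2 μ}

theorem opA_graph_dilation_neg_one {f g : Lp ℂ 2 μ} (h : (f, g) ∈ (opA μ).graph) :
    (dilation μ (-1) f, dilation μ (-1) g) ∈ (opA μ).graph := by
  simpa using opA_graph_dilation h (neg_ne_zero.2 one_ne_zero : (-1 : K) ≠ 0)

theorem inner_opA_graph {f f' g g' : Lp ℂ 2 μ} (hf : (f, f') ∈ (opA μ).graph)
    (hg : (g, g') ∈ (opA μ).graph) : inner ℂ f' g = inner ℂ f g' := by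
  rw [mem_graph_opA_iff] at hf hg
  rw [L2.inner_def, L2.inner_def]
  refine integral_congr_ae ?_
  filter_upwards [hf, hg] with x hx hx'
  rw [hx, hx', RCLike.inner_apply, RCLike.inner_apply, map_mul]
  erw [Complex.conj_ofReal]
  ring

theorem mem_graph_commutatorOp_iff {hψ : Continuous ψ} {f h : Lp ℂ 2 μ} :
    (f, h) ∈ (commutatorOp ψ hψ μ).graph ↔ ∃ p q r s, (f, p) ∈ (opA μ).graph ∧
      (f, q) ∈ (opB ψ hψ μ).graph ∧ (p, r) ∈ (opB ψ hψ μ).graph ∧ (q, s) ∈ (opA μ).graph ∧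
      h = Complex.I • (r - s) := by
  simp only [commutatorOp, LinearPMap.mem_graph_smul_iff, LinearPMap.mem_graph_sub_iff,
    LinearPMap.mem_graph_naturalComp_iff]
  constructor
  · rintro ⟨_, ⟨r, s, ⟨p, hp, hr⟩, ⟨q, hq, hs⟩, rfl⟩, rfl⟩
    exact ⟨p, q, r, s, hp, hq, hr, hs, rfl⟩
  · rintro ⟨p, q, r, s, hp, hq, hr, hs, rfl⟩
    exact ⟨_, ⟨r, s, ⟨p, hp, hr⟩, ⟨q, hq, hs⟩, rfl⟩, rfl⟩

namespace IsFourierOperator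

theorem mem_graph_opB_iff (hF : IsFourierOperator ψ μ c F) {hψ : Continuous ψ} {f g : Lp ℂ 2 μ} :
    (f, g) ∈ (opB ψ hψ μ).graph ↔ (F f, F g) ∈ (opA μ).graph := by
  have hker : LinearMap.ker (opF ψ hψ μ).toFun = ⊥ := by
    rw [LinearMap.ker_eq_bot]
    intro x y hxy
    have hx := hF.mem_graph_opF_iff.1 (LinearPMap.mem_graph (opF ψ hψ μ) x)
    have hy := hF.mem_graph_opF_iff.1 (LinearPMap.mem_graph (opF ψ hψ μ) y)
    exact Subtype.ext (hF.injective (hx.symm.trans (Eq.trans hxy hy)))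
  simp only [opB, LinearPMap.mem_graph_naturalComp_iff, LinearPMap.mem_graph_inverse_iff hker,
    hF.mem_graph_opF_iff]
  constructor
  · rintro ⟨_, ⟨_, rfl, h⟩, rfl⟩
    exact h
  · intro h
    exact ⟨_, ⟨_, rfl, h⟩, rfl⟩

theorem map_map (hF : IsFourierOperator ψ μ c F) (hψ : Continuous ψ) (f : Lp ℂ 2 μ) :
    F (F f) = (c : ℂ) • dilation μ (-1) f := by
  rw [← map_smul, ← hF.dilation_map_map hψ f, hF.dilation_neg_one_dilation_neg_one]

/-- Since `F² = c D_{-1}` and `|-1| = 1`, `F²` commutes with `A`; thus `F` carries `A` to `B`, just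
as it carries `B` to `A`. -/
theorem opB_graph_map (hF : IsFourierOperator ψ μ c F) {hψ : Continuous ψ} {f g : Lp ℂ 2 μ}
    (h : (f, g) ∈ (opA μ).graph) : (F f, F g) ∈ (opB ψ hψ μ).graph := by
  rw [hF.mem_graph_opB_iff, hF.map_map hψ, hF.map_map hψ]
  exact (opA μ).graph.smul_mem (c : ℂ) (opA_graph_dilation_neg_one h)

theorem opB_graph_dilation (hF : IsFourierOperator ψ μ c F) {hψ : Continuous ψ} {f g : Lp ℂ 2 μ}
    (h : (f, g) ∈ (opB ψ hψ μ).graph) {t : K} (ht : t ≠ 0) :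
    (dilation μ t f, dilation μ t g + (Real.log (normAbs t) : ℂ) • dilation μ t f) ∈
      (opB ψ hψ μ).graph := by
  rw [hF.mem_graph_opB_iff] at h ⊢
  have h' := opA_graph_dilation h (inv_ne_zero ht)
  rw [log_normAbs_inv, Complex.ofReal_neg, neg_smul, sub_neg_eq_add] at h'
  rwa [map_add, map_smul, hF.map_dilation ht, hF.map_dilation ht]

/-- Dilation replaces `A` by `A - l` and `B` by `B + l`. The scalars preserve the domains and cancel
in the commutator. -/
theorem commutatorOp_graph_dilation (hF : IsFourierOperator ψ μ c F) {hψ : Continuous ψ}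
    {f h : Lp ℂ 2 μ} (hfh : (f, h) ∈ (commutatorOp ψ hψ μ).graph) {t : K} (ht : t ≠ 0) :
    (dilation μ t f, dilation μ t h) ∈ (commutatorOp ψ hψ μ).graph := by
  rw [mem_graph_commutatorOp_iff] at hfh ⊢
  obtain ⟨p, q, r, s, hp, hq, hr, hs, rfl⟩ := hfh
  have hp' := opA_graph_dilation hp ht
  have hq' := hF.opB_graph_dilation hq ht
  set l : ℂ := (Real.log (normAbs t) : ℂ)
  have hr' : (dilation μ t p - l • dilation μ t f, dilation μ t r + l • dilation μ t p -
      l • (dilation μ t q + l • dilation μ t f)) ∈ (opB ψ hψ μ).graph :=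
    (opB ψ hψ μ).graph.sub_mem (hF.opB_graph_dilation hr ht)
      ((opB ψ hψ μ).graph.smul_mem l hq')
  have hs' : (dilation μ t q + l • dilation μ t f, dilation μ t s - l • dilation μ t q +
      l • (dilation μ t p - l • dilation μ t f)) ∈ (opA μ).graph :=
    (opA μ).graph.add_mem (opA_graph_dilation hs ht) ((opA μ).graph.smul_mem l hp')
  refine ⟨_, _, _, _, hp', hq', hr', hs', ?_⟩
  rw [map_smul, map_sub]
  congr 1
  module

/-- `F` exchanges the roles of `A` and `B`, which reverses the sign of `BA - AB`. -/
theorem commutatorOp_graph_map (hF : IsFourierOperator ψ μ c F) {hψ : Continuous ψ}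
    {f h : Lp ℂ 2 μ} (hfh : (f, h) ∈ (commutatorOp ψ hψ μ).graph) :
    (F f, -F h) ∈ (commutatorOp ψ hψ μ).graph := by
  rw [mem_graph_commutatorOp_iff] at hfh ⊢
  obtain ⟨p, q, r, s, hp, hq, hr, hs, rfl⟩ := hfh
  refine ⟨_, _, _, _, hF.mem_graph_opB_iff.1 hq, hF.opB_graph_map hp, hF.opB_graph_map hs,
    hF.mem_graph_opB_iff.1 hr, ?_⟩
  rw [map_smul, map_sub, ← smul_neg, neg_sub]

theorem inner_opB_graph (hF : IsFourierOperator ψ μ c F) {hψ : Continuous ψ}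
    {f f' g g' : Lp ℂ 2 μ} (hf : (f, f') ∈ (opB ψ hψ μ).graph)
    (hg : (g, g') ∈ (opB ψ hψ μ).graph) : inner ℂ f' g = inner ℂ f g' := by
  have h := inner_opA_graph (hF.mem_graph_opB_iff.1 hf) (hF.mem_graph_opB_iff.1 hg)
  rw [hF.inner_map_map, hF.inner_map_map] at h
  exact mul_left_cancel₀ hF.coe_ne_zero h

theorem inner_commutatorOp_graph (hF : IsFourierOperator ψ μ c F) {hψ : Continuous ψ}
    {f f' g g' : Lp ℂ 2 μ} (hf : (f, f') ∈ (commutatorOp ψ hψ μ).graph)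
    (hg : (g, g') ∈ (commutatorOp ψ hψ μ).graph) : inner ℂ f' g = inner ℂ f g' := by
  rw [mem_graph_commutatorOp_iff] at hf hg
  obtain ⟨p, q, r, s, hp, hq, hr, hs, rfl⟩ := hf
  obtain ⟨p', q', r', s', hp', hq', hr', hs', rfl⟩ := hg
  rw [inner_smul_left, inner_smul_right, Complex.conj_I, inner_sub_left, inner_sub_right,
    hF.inner_opB_graph hr hq', inner_opA_graph hp hs', inner_opA_graph hs hp',
    hF.inner_opB_graph hq hr']
  ring

/-- `A` and `B` are symmetric, so `i[B, A]` is too; being densely defined, it is contained in its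
adjoint, which is closed. -/
theorem isClosable_commutatorOp (hF : IsFourierOperator ψ μ c F) {hψ : Continuous ψ}
    (hd : Dense ((commutatorOp ψ hψ μ).domain : Set (Lp ℂ 2 μ))) :
    (commutatorOp ψ hψ μ).IsClosable := by
  have h : (commutatorOp ψ hψ μ).IsFormalAdjoint (commutatorOp ψ hψ μ) := fun x y =>
    hF.inner_commutatorOp_graph (LinearPMap.mem_graph _ x) (LinearPMap.mem_graph _ y)
  exact (LinearPMap.adjoint_isClosed hd).isClosable.leIsClosable (h.le_adjoint hd)

end IsFourierOperator

end OperatorGraphs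

/-! ### Density of the commutator domain, and the action of the Inversion on the closed graph -/

noncomputable section CommutatorDomain

variable {K : Type*} [Field K] [TopologicalSpace K] [IsLocalField K] [MeasurableSpace K]
  [BorelSpace K] {μ : Measure K} [μ.IsAddHaarMeasure] {ψ : AddChar K Circle} {c : ℝ}
  {F : Lp ℂ 2 μ →L[ℂ] Lp ℂ 2 μ}

theorem LogIntegrable.log_mul {k : K → ℂ} (hk : LogIntegrable μ k) :
    Integrable (fun t => (Real.log (normAbs t) : ℂ) * k t) (mulMeasure μ) := by
  simpa using hk 1 (by norm_num)

theorem LogIntegrable.log_mul_log_mul {k : K → ℂ} (hk : LogIntegrable μ k) :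
    Integrable (fun t => (Real.log (normAbs t) : ℂ) * ((Real.log (normAbs t) : ℂ) * k t))
      (mulMeasure μ) := by
  simpa only [pow_two, mul_assoc] using hk 2 le_rfl

theorem LogIntegrable.opA_graph {k : K → ℂ} (hk : LogIntegrable μ k) {f g : Lp ℂ 2 μ}
    (h : (f, g) ∈ (opA μ).graph) : (mulConv μ k f, mulConv μ k g -
      mulConv μ (fun t => (Real.log (normAbs t) : ℂ) * k t) f) ∈ (opA μ).graph :=
  opA_graph_mulConv h hk.integrable hk.log_mul

/-- The domain of `A²`. -/
def domASq (μ : Measure K) [μ.IsAddHaarMeasure] : Submodule ℂ (Lp ℂ 2 μ) :=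
  ((opA μ).naturalComp (opA μ)).domain

theorem mem_domASq_iff {f : Lp ℂ 2 μ} : f ∈ domASq μ ↔
    ∃ g h, (f, g) ∈ (opA μ).graph ∧ (g, h) ∈ (opA μ).graph := by
  simp only [domASq, LinearPMap.mem_domain_iff, LinearPMap.mem_graph_naturalComp_iff]
  exact exists_comm

/-- The Leibniz rule is used twice; the second use meets `log|t| k(t)` and so requires `log²|t|
k(t)` to be integrable. -/
theorem LogIntegrable.mulConv_mem_domASq {k : K → ℂ} (hk : LogIntegrable μ k) {f : Lp ℂ 2 μ}
    (hf : f ∈ domASq μ) : mulConv μ k f ∈ domASq μ := by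
  rw [mem_domASq_iff] at hf ⊢
  obtain ⟨g, h, hfg, hgh⟩ := hf
  exact ⟨_, _, hk.opA_graph hfg, (opA μ).graph.sub_mem (hk.opA_graph hgh)
    (opA_graph_mulConv hfg hk.log_mul hk.log_mul_log_mul)⟩

theorem inversionIsometry_mem_domASq {f : Lp ℂ 2 μ} (hf : f ∈ domASq μ) :
    inversionIsometry μ f ∈ domASq μ := by
  rw [mem_domASq_iff] at hf ⊢
  obtain ⟨g, h, hfg, hgh⟩ := hf
  exact ⟨_, _, opA_graph_inversion hfg, (opA μ).graph.neg_mem (opA_graph_inversion hgh)⟩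

/-- A vector `h` orthogonal to the domain of `A²` is tested against `h/(1 + log²|x|)`, which lies in
this domain. The resulting integral of `|h|²/(1 + log²|x|)` vanishes, so `h = 0`. -/
theorem dense_domASq : Dense (domASq μ : Set (Lp ℂ 2 μ)) := by
  rw [Submodule.dense_iff_topologicalClosure_eq_top, Submodule.topologicalClosure_eq_top_iff,
    Submodule.eq_bot_iff]
  intro h hh
  let l : K → ℝ := fun x => Real.log (normAbs x)
  have hbdd : ∀ m : K → ℝ, Measurable m → (∀ x, |m x| ≤ 1) →
      MemLp (fun x => (m x : ℂ) * h x) 2 μ := by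
    intro m hm hm1
    refine (Lp.memLp h).of_le ?_ (Eventually.of_forall fun x => ?_)
    · exact (by fun_prop : Measurable fun x => (m x : ℂ)).aestronglyMeasurable.mul
        (Lp.aestronglyMeasurable h)
    · rw [norm_mul, Complex.norm_real, Real.norm_eq_abs]
      exact mul_le_of_le_one_left (norm_nonneg _) (hm1 x)
  have hl : Measurable l := Real.measurable_log.comp measurable_normAbs
  have hpos : ∀ x, 0 < 1 + l x ^ 2 := fun x => by positivity
  have h0 := hbdd (fun x => 1 / (1 + l x ^ 2)) (by fun_prop) fun x => by
    rw [abs_div, abs_of_pos (hpos x), div_le_one (hpos x), abs_one]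
    nlinarith [sq_nonneg (l x)]
  have h1 := hbdd (fun x => l x / (1 + l x ^ 2)) (by fun_prop) fun x => by
    rw [abs_div, abs_of_pos (hpos x), div_le_one (hpos x), ← sq_abs]
    nlinarith [sq_nonneg (|l x| - 1)]
  have h2 := hbdd (fun x => l x ^ 2 / (1 + l x ^ 2)) (by fun_prop) fun x => by
    rw [abs_div, abs_of_pos (hpos x), div_le_one (hpos x), abs_of_nonneg (sq_nonneg _)]
    linarith
  have hmem : h0.toLp ∈ domASq μ := by
    refine mem_domASq_iff.2 ⟨h1.toLp, h2.toLp, ?_, ?_⟩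
    · rw [mem_graph_opA_iff]
      filter_upwards [h0.coeFn_toLp, h1.coeFn_toLp] with x hx0 hx1
      rw [hx0, hx1]
      push_cast
      ring
    · rw [mem_graph_opA_iff]
      filter_upwards [h1.coeFn_toLp, h2.coeFn_toLp] with x hx0 hx1
      rw [hx0, hx1]
      push_cast
      ring
  have hinner : inner ℂ h h0.toLp = 0 := (Submodule.mem_orthogonal' _ _).1 hh _ hmem
  have heq : ∫ x, 1 / (1 + l x ^ 2) * ‖h x‖ ^ 2 ∂μ = 0 := by
    rw [inner_eq_integral_of_ae_eq h0.coeFn_toLp] at hinner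
    have h3 : ∀ x, (starRingEnd ℂ) (h x) * (((1 / (1 + l x ^ 2) : ℝ) : ℂ) * h x) =
        ((1 / (1 + l x ^ 2) * ‖h x‖ ^ 2 : ℝ) : ℂ) := fun x => by
      rw [mul_left_comm, Complex.conj_mul']
      push_cast
      ring
    simp_rw [h3] at hinner
    rw [integral_complex_ofReal] at hinner
    exact_mod_cast hinner
  have hnn : ∀ x, 0 ≤ 1 / (1 + l x ^ 2) * ‖h x‖ ^ 2 := fun x =>
    mul_nonneg (one_div_nonneg.2 (hpos x).le) (sq_nonneg _)
  have hint : Integrable (fun x => 1 / (1 + l x ^ 2) * ‖h x‖ ^ 2) μ := by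
    refine ((Lp.memLp h).integrable_norm_pow two_ne_zero).mono' ?_
      (Eventually.of_forall fun x => ?_)
    · exact (by fun_prop : Measurable fun x => 1 / (1 + l x ^ 2)).aestronglyMeasurable.mul
        ((Lp.aestronglyMeasurable h).norm.pow 2)
    · rw [Real.norm_of_nonneg (hnn x)]
      refine mul_le_of_le_one_left (sq_nonneg _) ?_
      rw [div_le_one (hpos x)]
      nlinarith [sq_nonneg (l x)]
  rw [integral_eq_zero_iff_of_nonneg hnn hint] at heq
  refine Lp.ext ?_
  filter_upwards [heq, Lp.coeFn_zero ℂ 2 μ] with x hx hx0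
  rw [hx0]
  have h4 := (mul_eq_zero.1 hx).resolve_left (one_div_ne_zero (hpos x).ne')
  simpa using h4

theorem mulConv_comp_inv (k : K → ℂ) (f : Lp ℂ 2 μ) : mulConv μ (fun t => k t⁻¹) f =
    inversionIsometry μ (mulConv μ k (inversionIsometry μ f)) := by
  rw [inversionIsometry_mulConv, inversionIsometry_inversionIsometry]

theorem norm_mulConv_le {k : K → ℂ} (hk : Integrable k (mulMeasure μ))
    (hk1 : ∫ t, ‖k t‖ ∂(mulMeasure μ) ≤ 1) (f : Lp ℂ 2 μ) : ‖mulConv μ k f‖ ≤ ‖f‖ := by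
  rw [mulConv_apply hk]
  refine (norm_integral_le_integral_norm _).trans ?_
  simp_rw [norm_smul, LinearIsometry.norm_map]
  rw [integral_mul_const]
  exact mul_le_of_le_one_left (norm_nonneg _) hk1

/-- The smoothing operator `C_k* C_k* C_k C_k`, where `k*(t) = k(1/t)`. -/
def smoothing (μ : Measure K) [μ.IsAddHaarMeasure] (k : K → ℂ) (f : Lp ℂ 2 μ) : Lp ℂ 2 μ :=
  mulConv μ (fun t => k t⁻¹) (mulConv μ (fun t => k t⁻¹) (mulConv μ k (mulConv μ k f)))

theorem smoothing_comm (k : K → ℂ) (f : Lp ℂ 2 μ) : smoothing μ k f =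
    mulConv μ k (mulConv μ k (mulConv μ (fun t => k t⁻¹) (mulConv μ (fun t => k t⁻¹) f))) := by
  rw [smoothing, mulConv_comm _ k, mulConv_comm _ k, mulConv_comm _ k, mulConv_comm _ k]

/-- The Inversion exchanges `C_k` and `C_k*`, which occur equally often and commute. -/
theorem inversionIsometry_smoothing (k : K → ℂ) (f : Lp ℂ 2 μ) :
    inversionIsometry μ (smoothing μ k f) = smoothing μ k (inversionIsometry μ f) := by
  rw [smoothing_comm k (inversionIsometry μ f), smoothing]
  simp only [inversionIsometry_mulConv, inv_inv]

/-- Each of the four factors is a contraction moving `f` by at most `ε`. For `C_k* = I C_k I` this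
is the hypothesis on the Inversion of `f`. -/
theorem norm_smoothing_sub_le {k : K → ℂ} (hk : Integrable k (mulMeasure μ))
    (hk1 : ∫ t, ‖k t‖ ∂(mulMeasure μ) ≤ 1) {f : Lp ℂ 2 μ} {ε : ℝ}
    (h1 : ‖mulConv μ k f - f‖ ≤ ε)
    (h2 : ‖mulConv μ k (inversionIsometry μ f) - inversionIsometry μ f‖ ≤ ε) :
    ‖smoothing μ k f - f‖ ≤ 4 * ε := by
  have hI : ∀ g, ‖mulConv μ (fun t => k t⁻¹) g‖ ≤ ‖g‖ := fun g => by
    rw [mulConv_comp_inv, LinearIsometry.norm_map]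
    exact (norm_mulConv_le hk hk1 _).trans (LinearIsometry.norm_map _ _).le
  have h3 : ‖mulConv μ (fun t => k t⁻¹) f - f‖ ≤ ε := by
    rw [← (inversionIsometry μ).norm_map, map_sub, mulConv_comp_inv,
      inversionIsometry_inversionIsometry]
    exact h2
  have step : ∀ (C : Lp ℂ 2 μ →L[ℂ] Lp ℂ 2 μ) (u : Lp ℂ 2 μ) (δ : ℝ), (∀ g, ‖C g‖ ≤ ‖g‖) →
      ‖C f - f‖ ≤ ε → ‖u - f‖ ≤ δ → ‖C u - f‖ ≤ δ + ε := by
    intro C u δ hC hCf hu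
    calc ‖C u - f‖ = ‖C (u - f) + (C f - f)‖ := by rw [map_sub]; abel_nf
      _ ≤ ‖C (u - f)‖ + ‖C f - f‖ := norm_add_le _ _
      _ ≤ δ + ε := add_le_add ((hC _).trans hu) hCf
  have h := step _ _ _ hI h3 (step _ _ _ hI h3 (step _ _ _ (norm_mulConv_le hk hk1) h1 h1))
  exact h.trans (by linarith)

namespace IsFourierOperator

theorem map_mulConv (hF : IsFourierOperator ψ μ c F) (k : K → ℂ) (f : Lp ℂ 2 μ) :
    F (mulConv μ k f) = mulConv μ (fun t => k t⁻¹) (F f) :=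
  map_mulConv_of_map_dilation (fun _ ht f => hF.map_dilation ht f) k f

theorem map_mulConv_comp_inv (hF : IsFourierOperator ψ μ c F) (k : K → ℂ) (f : Lp ℂ 2 μ) :
    F (mulConv μ (fun t => k t⁻¹) f) = mulConv μ k (F f) := by
  simp only [hF.map_mulConv, inv_inv]

/-- One factor `C_k*` controls the Fourier side: `F C_k* = C_k F = I C_r`, and `I`, `C_r` preserve
the domains of `A` and `A²`. A second factor is needed because `A` is applied before `F`. The two
factors `C_k` play the same role after `F`, which turns them into `C_k*`. -/
theorem smoothing_mem_domain (hF : IsFourierOperator ψ μ c F) {hψ : Continuous ψ} {k r : K → ℂ}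
    (hk : LogIntegrable μ k) (hr : LogIntegrable μ r)
    (hkr : ∀ f, mulConv μ k (F f) = inversionIsometry μ (mulConv μ r f)) {f : Lp ℂ 2 μ}
    (hf : f ∈ domASq μ) : smoothing μ k f ∈ (commutatorOp ψ hψ μ).domain := by
  set k' : K → ℂ := fun t => k t⁻¹ with hk'def
  have hk' : LogIntegrable μ k' := hk.comp_inv
  have hFk' : ∀ u, F (mulConv μ k' u) = inversionIsometry μ (mulConv μ r u) := fun u => by
    rw [hF.map_mulConv_comp_inv, hkr]
  have hFA : ∀ {u v}, (u, v) ∈ (opA μ).graph → ∃ w, (F (mulConv μ k' u), w) ∈ (opA μ).graph :=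
    fun h => by
      rw [hFk']
      exact ⟨_, opA_graph_inversion (hr.opA_graph h)⟩
  have hFA2 : ∀ {u}, u ∈ domASq μ → F (mulConv μ k' u) ∈ domASq μ := fun h => by
    rw [hFk']
    exact inversionIsometry_mem_domASq (hr.mulConv_mem_domASq h)
  -- By the Leibniz rule, `A C_k* C_k* u = C_k*(A C_k* u - C_l u)` where `l(t) = log|t| k*(t)`. The
  -- bracket is in the domain of `A`, and the remaining outer `C_k*` lets `F` map into that domain.
  have key : ∀ {u}, u ∈ domASq μ → ∃ p t, (mulConv μ k' (mulConv μ k' u), p) ∈ (opA μ).graph ∧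
      (F p, t) ∈ (opA μ).graph := by
    intro u hu
    obtain ⟨v, w, huv, hvw⟩ := mem_domASq_iff.1 (hk'.mulConv_mem_domASq hu)
    obtain ⟨u', -, hu', -⟩ := mem_domASq_iff.1 hu
    have h1 := hk'.opA_graph huv
    rw [mulConv_comm (fun t => (Real.log (normAbs t) : ℂ) * k' t) k'] at h1
    obtain ⟨t, ht⟩ := hFA ((opA μ).graph.sub_mem hvw
      (opA_graph_mulConv hu' hk'.log_mul hk'.log_mul_log_mul))
    rw [map_sub] at ht
    exact ⟨_, t, h1, ht⟩
  -- Applied to `C_k C_k f`, this handles `BA`; applied to `F C_k* C_k* f` on the next line, it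
  -- handles `AB`.
  obtain ⟨p, t, hp, ht⟩ := key (hk.mulConv_mem_domASq (hk.mulConv_mem_domASq hf))
  obtain ⟨p', t', hp', ht'⟩ := key (hFA2 (hk'.mulConv_mem_domASq hf))
  have hFf : F (smoothing μ k f) =
      mulConv μ k' (mulConv μ k' (F (mulConv μ k' (mulConv μ k' f)))) := by
    rw [smoothing_comm, hF.map_mulConv, hF.map_mulConv]
  rw [← hFf, ← hF.map_inverse hψ p'] at hp'
  rw [← hF.map_inverse hψ t] at ht
  exact LinearPMap.mem_domain_iff.2 ⟨_, mem_graph_commutatorOp_iff.2 ⟨_, _, _, _, hp,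
    hF.mem_graph_opB_iff.2 hp', hF.mem_graph_opB_iff.2 ht,
    (opA μ).graph.smul_mem _ (opA_graph_dilation_neg_one ht'), rfl⟩⟩

theorem dense_commutatorOp_domain_inversion (hF : IsFourierOperator ψ μ c F)
    {hψ : Continuous ψ} : Dense {f : Lp ℂ 2 μ | f ∈ (commutatorOp ψ hψ μ).domain ∧
      inversionIsometry μ f ∈ (commutatorOp ψ hψ μ).domain} := by
  rw [← dense_closure]
  refine dense_domASq.mono fun f hf => ?_
  rw [Metric.mem_closure_iff]
  intro ε hε
  have hε' : 0 < ε / 8 := by positivity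
  obtain ⟨N₁, hN₁, h1⟩ := exists_nhds_norm_mulConv_sub_le f hε'
  obtain ⟨N₂, hN₂, h2⟩ := exists_nhds_norm_mulConv_sub_le (inversionIsometry μ f) hε'
  obtain ⟨k, r, hk, hr, hkN, hk1, hkn, hkr⟩ := hF.exists_mulConv_map hψ (inter_mem hN₁ hN₂)
  refine ⟨smoothing μ k f, ⟨hF.smoothing_mem_domain hk hr hkr hf, ?_⟩, ?_⟩
  · rw [inversionIsometry_smoothing]
    exact hF.smoothing_mem_domain hk hr hkr (inversionIsometry_mem_domASq hf)
  · rw [dist_comm, dist_eq_norm]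
    refine (norm_smoothing_sub_le hk.integrable hkn
      (h1 k hk.integrable (fun t ht => hkN t fun h => ht h.1) hk1 hkn)
      (h2 k hk.integrable (fun t ht => hkN t fun h => ht h.2) hk1 hkn)).trans_lt ?_
    linarith

/-- The closed graph `V` is stable under dilations, and under `F` with a sign. The point is that
`FI`, a limit of averages of dilations, preserves `V` without a sign. -/
theorem inversion_mem_closure_graph (hF : IsFourierOperator ψ μ c F) {hψ : Continuous ψ}
    {f h : Lp ℂ 2 μ} (hfh : (f, h) ∈ (commutatorOp ψ hψ μ).graph.topologicalClosure) :
    (inversionIsometry μ f, -inversionIsometry μ h) ∈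
      (commutatorOp ψ hψ μ).graph.topologicalClosure := by
  set V := (commutatorOp ψ hψ μ).graph.topologicalClosure with hV
  have hVc : IsClosed (V : Set (Lp ℂ 2 μ × Lp ℂ 2 μ)) :=
    (commutatorOp ψ hψ μ).graph.isClosed_topologicalClosure
  have hVD : ∀ t ≠ 0, ∀ p ∈ V, (dilation μ t p.1, dilation μ t p.2) ∈ V := fun t ht p hp =>
    map_mem_closure (s := (commutatorOp ψ hψ μ).graph)
      (f := fun p : Lp ℂ 2 μ × Lp ℂ 2 μ => (dilation μ t p.1, dilation μ t p.2))
      (by fun_prop) hp fun q hq => hF.commutatorOp_graph_dilation (f := q.1) (h := q.2) hq ht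
  have hVF : ∀ p ∈ V, (F p.1, -F p.2) ∈ V := fun p hp =>
    map_mem_closure (s := (commutatorOp ψ hψ μ).graph)
      (f := fun p : Lp ℂ 2 μ × Lp ℂ 2 μ => (F p.1, -F p.2))
      (by fun_prop) hp fun q hq => hF.commutatorOp_graph_map (f := q.1) (h := q.2) hq
  have hFI : (F (inversionIsometry μ f), F (inversionIsometry μ h)) ∈ V := by
    rw [← SetLike.mem_coe, ← hVc.closure_eq, Metric.mem_closure_iff]
    intro ε hε
    obtain ⟨N₁, hN₁, h1⟩ := exists_nhds_norm_mulConv_sub_le (F (inversionIsometry μ f))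
      (half_pos hε)
    obtain ⟨N₂, hN₂, h2⟩ := exists_nhds_norm_mulConv_sub_le (F (inversionIsometry μ h))
      (half_pos hε)
    obtain ⟨k, r, hk, -, hkN, hk1, hkn, hkr⟩ := hF.exists_mulConv_map hψ (inter_mem hN₁ hN₂)
    -- `C_k F I = I C_r I` is convolution with `t ↦ r(1/t)`, so it maps `V` into itself; as `k`
    -- concentrates at `1` it tends to `F I` on `f` and on `h`.
    have hk2 : ∀ g, mulConv μ k (F (inversionIsometry μ g)) = mulConv μ (fun t => r t⁻¹) g :=
      fun g => by rw [hkr, mulConv_comp_inv]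
    refine ⟨(mulConv μ k (F (inversionIsometry μ f)), mulConv μ k (F (inversionIsometry μ h))),
      ?_, ?_⟩
    · rw [hk2, hk2]
      exact mulConv_mem_of_dilation_mem hVc hVD _ hfh
    · rw [dist_comm, Prod.dist_eq, max_lt_iff, dist_eq_norm, dist_eq_norm]
      exact ⟨(h1 k hk.integrable (fun t ht => hkN t fun h => ht h.1) hk1 hkn).trans_lt
          (half_lt_self hε),
        (h2 k hk.integrable (fun t ht => hkN t fun h => ht h.2) hk1 hkn).trans_lt
          (half_lt_self hε)⟩
  -- Applying `F` once more, with its sign, and then `c⁻¹ D_{-1}` undoes the first `F`.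
  have h3 := V.smul_mem (c : ℂ)⁻¹ (hVD (-1) (neg_ne_zero.2 one_ne_zero) _ (hVF _ hFI))
  rw [Prod.smul_mk, map_neg, hF.dilation_map_map hψ, hF.dilation_map_map hψ, smul_neg, smul_smul,
    smul_smul, inv_mul_cancel₀ hF.coe_ne_zero, one_smul, one_smul] at h3
  exact h3

end IsFourierOperator

end CommutatorDomain

/-! ### The commutator anticommutes with the Inversion -/

theorem mainTheorem4 {K : Type*} [Field K] [TopologicalSpace K] [IsLocalField K]
    [MeasurableSpace K] [BorelSpace K] (μ : Measure K) [μ.IsAddHaarMeasure]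
    (ψ : AddChar K Circle) (hψ : Continuous ψ) (hψ_ne : ψ ≠ 1) :
    -- densely many vectors lie, together with their image under the Inversion, in the domain
    Dense {f : Lp ℂ 2 μ | f ∈ (commutatorOp ψ hψ μ).domain ∧
      inversion μ f ∈ (commutatorOp ψ hψ μ).domain} ∧
    -- the commutator operator anticommutes with the Inversion on these vectors
    (∀ (f : Lp ℂ 2 μ) (hf : f ∈ (commutatorOp ψ hψ μ).domain)
      (hf' : inversion μ f ∈ (commutatorOp ψ hψ μ).domain),
      commutatorOp ψ hψ μ ⟨inversion μ f, hf'⟩ =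
        -inversion μ (commutatorOp ψ hψ μ ⟨f, hf⟩)) ∧
    -- the closure of the commutator operator anticommutes with the Inversion, domains included
    (commutatorOp ψ hψ μ).IsClosable ∧
    ∀ (f : Lp ℂ 2 μ) (hf : f ∈ (commutatorOp ψ hψ μ).closure.domain),
      ∃ hf' : inversion μ f ∈ (commutatorOp ψ hψ μ).closure.domain,
        (commutatorOp ψ hψ μ).closure ⟨inversion μ f, hf'⟩ =
          -inversion μ ((commutatorOp ψ hψ μ).closure ⟨f, hf⟩) := by
  obtain ⟨c, F, hF⟩ := exists_isFourierOperator (μ := μ) hψ hψ_ne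
  simp only [inversion_eq]
  have hd := hF.dense_commutatorOp_domain_inversion (hψ := hψ)
  have hcl := hF.isClosable_commutatorOp (hψ := hψ) (hd.mono fun f hf => hf.1)
  have hgraph := hcl.graph_closure_eq_closure_graph
  have hmem : ∀ {f h : Lp ℂ 2 μ}, (f, h) ∈ (commutatorOp ψ hψ μ).closure.graph →
      (inversionIsometry μ f, -inversionIsometry μ h) ∈ (commutatorOp ψ hψ μ).closure.graph := by
    intro f h hfh
    rw [← hgraph] at hfh ⊢
    exact hF.inversion_mem_closure_graph hfh
  have hle := LinearPMap.le_graph_of_le (commutatorOp ψ hψ μ).le_closure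
  -- Even the relation on the original domain is read off from the closure: its graph is
  -- single-valued and contains both candidates for the value at the Inversion of `f`.
  refine ⟨hd, fun f hf hf' => ?_, hcl, fun f hf => ?_⟩
  · exact LinearPMap.mem_graph_snd_inj _ (hle (LinearPMap.mem_graph _ ⟨_, hf'⟩))
      (hmem (hle (LinearPMap.mem_graph _ ⟨f, hf⟩))) rfl
  · have h := hmem (LinearPMap.mem_graph _ ⟨f, hf⟩)
    have hf' := LinearPMap.mem_domain_of_mem_graph h
    exact ⟨hf', ((LinearPMap.image_iff hf').2 h).symm⟩
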